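/- Let $p\ge 1$ and $q\ge 0$ be integers. Put $I_{p,1}=\mathrm{diag}(1,\dots,1,-1)$ (of size $p+1$), $J=\mathrm{diag}(I_{p,1},-I_q)$, and $$K_p=\begin{pmatrix}2I_{p-1}&0&0\\0&0&-i\\0&i&0\end{pmatrix},\qquad C=\begin{pmatrix}iI_{p-1}&0&0\\0&-i&i\\0&1&1\end{pmatrix}.$$ Let $\mathfrak u(p,1)=\{A: A^*I_{p,1}+I_{p,1}A=0\}$ and $\mathfrak u(K_p)=\{A: A^*K_p+K_pA=0\}$; since $C^*K_pC=2I_{p,1}$, the matrix $C$ of the Cayley transform gives the identification $\mathfrak u(p,1)=C^{-1}\mathfrak u(K_p)C$. Let $$\mathfrak{su}(p,1|q)_0=\left\{\begin{pmatrix}A&0\\0&B\end{pmatrix}: A\in\mathfrak u(p,1),\ B\in\mathfrak u(q),\ \mathrm{tr}A=\mathrm{tr}B\right\}$$ and let $G_0$ be the Lie group underlying $\mathrm{SU}(p,1|q)$, i.e. the group of even matrices $\gamma=\mathrm{diag}(\gamma_1,\gamma_2)$ with $\gamma^*J\gamma=J$ and $\mathrm{Ber}\,\gamma=\det\gamma_1/\det\gamma_2=1$.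 An even MASA of $\mathfrak{su}(p,1|q)$ is a maximal Abelian (real Lie) subalgebra of $\mathfrak{su}(p,1|q)_0$; an even MASG is a connected Lie subgroup of $G_0$ whose Lie algebra is an even MASA. Conjugacy means conjugacy by elements of $G_0$. For $\mathfrak h_1\subset\mathfrak u(p,1)$, $\mathfrak h_2\subset\mathfrak u(q)$ put $$\mathfrak h_1\boxtimes_0\mathfrak h_2=\{\mathrm{diag}(A,B): A\in\mathfrak h_1,\ B\in\mathfrak h_2,\ \mathrm{tr}A=\mathrm{tr}B\}.$$ Let $D(k)$ be the set of $k\times k$ diagonal matrices with purely imaginary entries. If $\mathfrak h_1$, $\mathfrak h_2$ are maximal Abelian subalgebras of $\mathfrak u(p,1)$ and $\mathfrak u(q)$, then $\mathfrak h_1\boxtimes_0\mathfrak h_2$ is an even MASA. The diagonal subalgebra $D(q)$ is a maximal Abelian subalgebra of $\mathfrak u(q)$, and the following are maximal Abelian subalgebras of $\mathfrak u(p,1)$ (those in (2)–(5) are written in $\mathfrak u(K_p)$ and moved to $\mathfrak u(p,1)$ by $A\mapsto C^{-1}AC$): 1. Quasi-elliptic: the diagonal matrices in $\mathfrak u(p,1)$.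 2. Quasi-hyperbolic: the matrices $\mathrm{diag}(D,z,-\overline z)$ with $D\in D(p-1)$, $z\in\mathbb C$. 3. Quasi-parabolic: the matrices $\begin{pmatrix}D&0&0\\0&iy&a\\0&0&iy\end{pmatrix}$ with $D\in D(p-1)$, $a,y\in\mathbb R$. 4. Nilpotent: the matrices $\begin{pmatrix}iyI_{p-1}&0&b^t\\2ib&iy&a\\0&0&iy\end{pmatrix}$ with $a,y\in\mathbb R$, $b\in\mathbb R^{p-1}$. 5. Quasi-nilpotent with parameter $k$, $1\le k\le p-2$: the matrices $\begin{pmatrix}D&0&0&0\\0&iyI_{p-k-1}&0&b^t\\0&2ib&iy&a\\0&0&0&iy\end{pmatrix}$ with $D\in D(k)$, $a,y\in\mathbb R$, $b\in\mathbb R^{p-k-1}$. Every even MASA of $\mathfrak{su}(p,1|q)$ is conjugate to $\mathfrak h_1\boxtimes_0 D(q)$ for some $\mathfrak h_1$ in this list. If $p\ge2$, the even MASAs $\mathfrak h_1\boxtimes_0D(q)$ for different entries $\mathfrak h_1$ of the list (including different $k$) are not conjugate. For every $p\ge1$ there are exactly $p+2$ conjugacy classes of even MASAs and exactly $p+2$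 conjugacy classes of even MASGs. -/

import Mathlib

open Matrix Complex

attribute [local instance] LieRing.ofAssociativeRing

noncomputable section

theorem fromBlocks_sub_fromBlocks {l m n o R : Type*} [AddGroup R] (A A' : Matrix n l R)
    (B B' : Matrix n m R) (C C' : Matrix o l R) (D D' : Matrix o m R) :
    fromBlocks A B C D - fromBlocks A' B' C' D' =
      fromBlocks (A - A') (B - B') (C - C') (D - D') := by
  ext i j; rcases i with i | i <;> rcases j with j | j <;> simp

/-- Coordinates of `ℂ^(p+1)`, for `p ≥ 1`: the first `p - 1` coordinates (left summand),
followed by the `p`-th and the `(p+1)`-st coordinate (right summand). -/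
abbrev Idx (p : ℕ) : Type := Fin (p - 1) ⊕ Fin 2

/-- The Lie algebra `{A | A* S + S A = 0}` of the unitary group of the form with matrix `S`. -/
def uForm {n : Type*} [Fintype n] [DecidableEq n] (S : Matrix n n ℂ) :
    LieSubalgebra ℝ (Matrix n n ℂ) where
  carrier := {A | Aᴴ * S + S * A = 0}
  zero_mem' := by simp
  add_mem' := by
    intro A B hA hB
    simp only [Set.mem_ofPred_eq] at hA hB ⊢
    rw [conjTranspose_add, Matrix.add_mul, Matrix.mul_add, add_add_add_comm, hA, hB, add_zero]
  smul_mem' := by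
    intro c A hA
    simp only [Set.mem_ofPred_eq] at hA ⊢
    rw [conjTranspose_smul, star_trivial, Matrix.smul_mul, Matrix.mul_smul, ← smul_add, hA,
      smul_zero]
  lie_mem' := by
    intro A B hA hB
    simp only [Set.mem_ofPred_eq] at hA hB ⊢
    have hA' : Aᴴ * S = -(S * A) := eq_neg_of_add_eq_zero_left hA
    have hB' : Bᴴ * S = -(S * B) := eq_neg_of_add_eq_zero_left hB
    rw [Ring.lie_def, conjTranspose_sub, conjTranspose_mul, conjTranspose_mul, Matrix.sub_mul,
      Matrix.mul_assoc, Matrix.mul_assoc, hA', hB', Matrix.mul_neg, Matrix.mul_neg,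
      ← Matrix.mul_assoc, ← Matrix.mul_assoc, hA', hB']
    noncomm_ring

/-- `I_{p,1} = diag(1, …, 1, -1)`. -/
def formJ (p : ℕ) : Matrix (Idx p) (Idx p) ℂ := fromBlocks 1 0 0 !![1, 0; 0, -1]

/-- `K_p`, the matrix of the form attached to the Siegel domain. -/
def formK (p : ℕ) : Matrix (Idx p) (Idx p) ℂ := fromBlocks ((2 : ℂ) • 1) 0 0 !![0, -I; I, 0]

/-- `J_{p,1|q} = diag(I_{p,1}, -I_q)`. -/
def formSuper (p q : ℕ) : Matrix (Idx p ⊕ Fin q) (Idx p ⊕ Fin q) ℂ :=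
  fromBlocks (formJ p) 0 0 (-1)

/-- `𝔲(p,1)`. -/
abbrev uPOne (p : ℕ) : LieSubalgebra ℝ (Matrix (Idx p) (Idx p) ℂ) := uForm (formJ p)

/-- `𝔲(q)`. -/
abbrev uQ (q : ℕ) : LieSubalgebra ℝ (Matrix (Fin q) (Fin q) ℂ) := uForm 1

/-- `𝔰𝔲(p,1|q)₀`: the even matrices `X` with `X* J + J X = 0` and vanishing supertrace. -/
def suEven (p q : ℕ) : LieSubalgebra ℝ (Matrix (Idx p ⊕ Fin q) (Idx p ⊕ Fin q) ℂ) where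
  carrier := {X | X.toBlocks₁₂ = 0 ∧ X.toBlocks₂₁ = 0 ∧ X ∈ uForm (formSuper p q) ∧
    X.toBlocks₁₁.trace - X.toBlocks₂₂.trace = 0}
  zero_mem' := ⟨rfl, rfl, (uForm (formSuper p q)).zero_mem,
    by simp [toBlocks₁₁, toBlocks₂₂, Matrix.trace]⟩
  add_mem' := by
    rintro X Y ⟨h1, h2, h3, h4⟩ ⟨k1, k2, k3, k4⟩
    refine ⟨?_, ?_, (uForm _).add_mem h3 k3, ?_⟩
    · change X.toBlocks₁₂ + Y.toBlocks₁₂ = 0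
      rw [h1, k1, add_zero]
    · change X.toBlocks₂₁ + Y.toBlocks₂₁ = 0
      rw [h2, k2, add_zero]
    · change (X.toBlocks₁₁ + Y.toBlocks₁₁).trace - (X.toBlocks₂₂ + Y.toBlocks₂₂).trace = 0
      rw [trace_add, trace_add, add_sub_add_comm, h4, k4, add_zero]
  smul_mem' := by
    rintro c X ⟨h1, h2, h3, h4⟩
    refine ⟨?_, ?_, (uForm _).smul_mem c h3, ?_⟩
    · change c • X.toBlocks₁₂ = 0
      rw [h1, smul_zero]
    · change c • X.toBlocks₂₁ = 0
      rw [h2, smul_zero]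
    · change (c • X.toBlocks₁₁).trace - (c • X.toBlocks₂₂).trace = 0
      rw [trace_smul, trace_smul, ← smul_sub, h4, smul_zero]
  lie_mem' := by
    rintro X Y ⟨h1, h2, h3, h4⟩ ⟨k1, k2, k3, k4⟩
    have hl : ⁅X, Y⁆ = fromBlocks ⁅X.toBlocks₁₁, Y.toBlocks₁₁⁆ 0 0
        ⁅X.toBlocks₂₂, Y.toBlocks₂₂⁆ := by
      conv_lhs => rw [← fromBlocks_toBlocks X, ← fromBlocks_toBlocks Y, h1, h2, k1, k2]
      simp [Ring.lie_def, fromBlocks_multiply, fromBlocks_sub_fromBlocks]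
    refine ⟨?_, ?_, (uForm _).lie_mem h3 k3, ?_⟩
    · rw [hl, toBlocks_fromBlocks₁₂]
    · rw [hl, toBlocks_fromBlocks₂₁]
    · rw [hl, toBlocks_fromBlocks₁₁, toBlocks_fromBlocks₂₂]
      simp [Ring.lie_def, trace_sub, trace_mul_comm X.toBlocks₁₁,
        trace_mul_comm X.toBlocks₂₂]

/-- `h` is a maximal Abelian subalgebra of `g`. -/
def IsMASA {L : Type*} [LieRing L] [LieAlgebra ℝ L] (g h : LieSubalgebra ℝ L) : Prop :=
  Maximal (fun k : LieSubalgebra ℝ L => k ≤ g ∧ IsLieAbelian k) h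

/-- `H` is an even MASA of `𝔰𝔲(p,1|q)`. -/
def IsEvenMASA (p q : ℕ)
    (H : LieSubalgebra ℝ (Matrix (Idx p ⊕ Fin q) (Idx p ⊕ Fin q) ℂ)) : Prop :=
  IsMASA (suEven p q) H

/-- `h₁ ⊠₀ h₂ = {diag(A, B) | A ∈ h₁, B ∈ h₂, tr A = tr B}`. -/
def boxZero {m n : Type*} [Fintype m] [DecidableEq m] [Fintype n] [DecidableEq n]
    (h₁ : LieSubalgebra ℝ (Matrix m m ℂ)) (h₂ : LieSubalgebra ℝ (Matrix n n ℂ)) :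
    LieSubalgebra ℝ (Matrix (m ⊕ n) (m ⊕ n) ℂ) where
  carrier := {X | ∃ A ∈ h₁, ∃ B ∈ h₂, A.trace = B.trace ∧ X = fromBlocks A 0 0 B}
  zero_mem' := ⟨0, h₁.zero_mem, 0, h₂.zero_mem, by simp, by simp⟩
  add_mem' := by
    rintro _ _ ⟨A, hA, B, hB, ht, rfl⟩ ⟨A', hA', B', hB', ht', rfl⟩
    exact ⟨A + A', h₁.add_mem hA hA', B + B', h₂.add_mem hB hB', by simp [ht, ht'],
      by simp [fromBlocks_add]⟩
  smul_mem' := by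
    rintro c _ ⟨A, hA, B, hB, ht, rfl⟩
    exact ⟨c • A, h₁.smul_mem c hA, c • B, h₂.smul_mem c hB, by simp [ht],
      by simp [fromBlocks_smul]⟩
  lie_mem' := by
    rintro _ _ ⟨A, hA, B, hB, ht, rfl⟩ ⟨A', hA', B', hB', ht', rfl⟩
    exact ⟨⁅A, A'⁆, h₁.lie_mem hA hA', ⁅B, B'⁆, h₂.lie_mem hB hB',
      by simp [Ring.lie_def, trace_sub, trace_mul_comm A, trace_mul_comm B],
      by simp [Ring.lie_def, fromBlocks_multiply, fromBlocks_sub_fromBlocks]⟩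

/-- The diagonal matrices in `𝔤`. -/
def diagIn {n : Type*} [Fintype n] [DecidableEq n] (g : LieSubalgebra ℝ (Matrix n n ℂ)) :
    LieSubalgebra ℝ (Matrix n n ℂ) where
  carrier := {A | A ∈ g ∧ A.IsDiag}
  zero_mem' := ⟨g.zero_mem, isDiag_zero⟩
  add_mem' := fun hA hB => ⟨g.add_mem hA.1 hB.1, hA.2.add hB.2⟩
  smul_mem' := fun c _ hA => ⟨g.smul_mem c hA.1, hA.2.smul c⟩
  lie_mem' := by
    rintro A B ⟨hA, hA'⟩ ⟨hB, hB'⟩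
    refine ⟨g.lie_mem hA hB, ?_⟩
    have hAB : A * B = B * A := by
      rw [← hA'.diagonal_diag, ← hB'.diagonal_diag, diagonal_mul_diagonal, diagonal_mul_diagonal]
      simp_rw [mul_comm]
    rw [Ring.lie_def, hAB, sub_self]
    exact isDiag_zero

/-- The matrix `diag(D, z, -z̄)` with `D = i diag(d)`. -/
def hypMatrix (p : ℕ) (d : Fin (p - 1) → ℝ) (z : ℂ) : Matrix (Idx p) (Idx p) ℂ :=
  fromBlocks (diagonal fun j => I * d j) 0 0 !![z, 0; 0, -(starRingEnd ℂ z)]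

/-- The subalgebra `{diag(D, z, -z̄)}` of `𝔲(K_p)`. -/
def hypAlg (p : ℕ) : LieSubalgebra ℝ (Matrix (Idx p) (Idx p) ℂ) where
  carrier := {A | ∃ d z, A = hypMatrix p d z}
  zero_mem' := ⟨0, 0, by
    ext i j; rcases i with i | i <;> rcases j with j | j <;>
      simp [hypMatrix] <;> fin_cases i <;> fin_cases j <;> simp⟩
  add_mem' := by
    rintro _ _ ⟨d, z, rfl⟩ ⟨d', z', rfl⟩
    refine ⟨d + d', z + z', ?_⟩
    rw [hypMatrix, hypMatrix, hypMatrix, fromBlocks_add, diagonal_add]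
    congr 1
    · simp [mul_add]
    · simp
    · simp
    · ext i j; fin_cases i <;> fin_cases j <;> simp [add_comm]
  smul_mem' := by
    rintro c _ ⟨d, z, rfl⟩
    refine ⟨c • d, c • z, ?_⟩
    rw [hypMatrix, hypMatrix, fromBlocks_smul, ← diagonal_smul]
    congr 1
    · congr 1; ext j; simp; ring
    · simp
    · simp
    · ext i j; fin_cases i <;> fin_cases j <;> simp
  lie_mem' := by
    rintro _ _ ⟨d, z, rfl⟩ ⟨d', z', rfl⟩
    refine ⟨0, 0, ?_⟩
    rw [Ring.lie_def, hypMatrix, hypMatrix, hypMatrix, fromBlocks_multiply, fromBlocks_multiply,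
      fromBlocks_sub_fromBlocks]
    congr 1
    · simp [mul_comm]
    · simp
    · simp
    · ext i j; fin_cases i <;> fin_cases j <;> simp [mul_comm]

/-- For `0 ≤ k ≤ p - 1`, the matrix with rows `(D, 0, 0, 0)`, `(0, iy I, 0, bᵗ)`,
`(0, 2ib, iy, a)`, `(0, 0, 0, iy)`, in blocks of sizes `k`, `p - k - 1`, `1`, `1`; here
`D = i diag(d)`. Only the entries `d j` with `j < k` and `b j` with `k ≤ j` are used. -/
def parMatrix (p k : ℕ) (d b : Fin (p - 1) → ℝ) (y a : ℝ) : Matrix (Idx p) (Idx p) ℂ :=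
  fromBlocks
    (diagonal fun j => if (j : ℕ) < k then I * d j else I * y)
    (of fun j l => if k ≤ (j : ℕ) ∧ l = 1 then (b j : ℂ) else 0)
    (of fun l j => if k ≤ (j : ℕ) ∧ l = 0 then 2 * I * (b j : ℂ) else 0)
    !![I * y, a; 0, I * y]

/-- The subalgebra of `𝔲(K_p)` that consists of the matrices `parMatrix p k d b y a`. -/
def parAlg (p k : ℕ) : LieSubalgebra ℝ (Matrix (Idx p) (Idx p) ℂ) where
  carrier := {A | ∃ d b y a, A = parMatrix p k d b y a}
  zero_mem' := ⟨0, 0, 0, 0, by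
    ext i j; rcases i with i | i <;> rcases j with j | j <;>
      simp [parMatrix] <;> fin_cases i <;> fin_cases j <;> simp⟩
  add_mem' := by
    rintro _ _ ⟨d, b, y, a, rfl⟩ ⟨d', b', y', a', rfl⟩
    refine ⟨d + d', b + b', y + y', a + a', ?_⟩
    rw [parMatrix, parMatrix, parMatrix, fromBlocks_add, diagonal_add]
    congr 1
    · congr 1; ext j; split_ifs <;> simp [mul_add]
    · ext i j; simp only [Matrix.add_apply, of_apply]; split_ifs <;> simp
    · ext i j; simp only [Matrix.add_apply, of_apply]; split_ifs <;> simp [mul_add]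
    · ext i j; fin_cases i <;> fin_cases j <;> simp [mul_add]
  smul_mem' := by
    rintro c _ ⟨d, b, y, a, rfl⟩
    refine ⟨c • d, c • b, c * y, c * a, ?_⟩
    rw [parMatrix, parMatrix, fromBlocks_smul, ← diagonal_smul]
    congr 1
    · congr 1; ext j; simp only [Pi.smul_apply]; split_ifs <;> simp <;> ring
    · ext i j; simp only [Matrix.smul_apply, of_apply]; split_ifs <;> simp
    · ext i j; simp only [Matrix.smul_apply, of_apply]; split_ifs <;> simp; ring
    · ext i j; fin_cases i <;> fin_cases j <;> simp <;> ring
  lie_mem' := by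
    rintro _ _ ⟨d, b, y, a, rfl⟩ ⟨d', b', y', a', rfl⟩
    have hcomm : parMatrix p k d b y a * parMatrix p k d' b' y' a' =
        parMatrix p k d' b' y' a' * parMatrix p k d b y a := by
      rw [parMatrix, parMatrix, fromBlocks_multiply, fromBlocks_multiply]
      congr 1
      · congr 1
        · simp_rw [diagonal_mul_diagonal, mul_comm]
        · ext i j
          simp [Matrix.mul_apply, Fin.sum_univ_two]
      · ext i j
        rw [Matrix.add_apply, Matrix.add_apply, diagonal_mul, diagonal_mul, Matrix.mul_apply,
          Matrix.mul_apply, Fin.sum_univ_two, Fin.sum_univ_two]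
        fin_cases j <;> simp
        split_ifs <;> first | omega | ring
      · ext i j
        have h0 : ∀ (c : Fin (p - 1) → ℂ) (e f : ℂ) (i : Fin 2), (!![e, f; 0, e] *
            (of fun l j => if k ≤ (j : ℕ) ∧ l = 0 then c j else 0 :
              Matrix (Fin 2) (Fin (p - 1)) ℂ)) i j =
            if k ≤ (j : ℕ) ∧ i = 0 then e * c j else 0 := by
          intro c e f i
          rw [Matrix.mul_apply, Fin.sum_univ_two]
          fin_cases i <;> simp
        rw [Matrix.add_apply, Matrix.add_apply, h0, h0, mul_diagonal, mul_diagonal, of_apply,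
          of_apply]
        split_ifs <;> first | omega | ring
      · ext i j
        fin_cases i <;> fin_cases j <;> simp [Matrix.mul_apply, Fin.sum_univ_two]
        · ring
        · congr 1
          · refine Finset.sum_congr rfl fun x _ => ?_
            split_ifs <;> ring
          · ring
        · ring
    refine ⟨0, 0, 0, 0, ?_⟩
    rw [Ring.lie_def, hcomm, sub_self]
    ext i j; rcases i with i | i <;> rcases j with j | j <;>
      simp [parMatrix] <;> fin_cases i <;> fin_cases j <;> simp

/-- The matrix of the Cayley transform `(z', z_p, z_{p+1}) ↦ (i z', i (z_{p+1} - z_p), z_{p+1} + z_p)`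
from the ball to the Siegel domain, in homogeneous coordinates. -/
def cayley (p : ℕ) : Matrix (Idx p) (Idx p) ℂ := fromBlocks (I • 1) 0 0 !![-I, I; 1, 1]

theorem cayley_inv_mul (p : ℕ) : (cayley p)⁻¹ * cayley p = 1 := by
  have h : cayley p * fromBlocks ((-I) • 1) 0 0 !![I / 2, 1 / 2; -I / 2, 1 / 2] = 1 := by
    rw [cayley, fromBlocks_multiply, ← fromBlocks_one]
    congr 1
    · simp [smul_smul]
    · simp
    · simp
    · ext i j
      fin_cases i <;> fin_cases j <;> simp <;> ring_nf <;> simp <;> norm_num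
  exact nonsing_inv_mul _ ((isUnit_iff_isUnit_det _).1 (IsUnit.of_mul_eq_one _ h))

/-- The Cayley transform carries the form of the Siegel domain to (twice) the form `I_{p,1}`. -/
theorem cayley_form (p : ℕ) : (cayley p)ᴴ * formK p * cayley p = (2 : ℂ) • formJ p := by
  rw [cayley, formK, formJ, fromBlocks_conjTranspose, fromBlocks_multiply, fromBlocks_multiply,
    fromBlocks_smul]
  congr 1
  · simp [smul_smul, mul_comm, mul_left_comm]
    ring_nf
    simp
  · simp
  · simp
  · ext i j
    fin_cases i <;> fin_cases j <;> simp [Matrix.mul_apply, Fin.sum_univ_two] <;> ring_nf <;>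
      simp <;> norm_num

/-- The conjugate `C⁻¹ h C = {X | C X C⁻¹ ∈ h}` of `h` by the Cayley matrix `C`. It carries
subalgebras of `𝔲(K_p)` to subalgebras of `𝔲(p,1)`. -/
def cayleyConj (p : ℕ) (h : LieSubalgebra ℝ (Matrix (Idx p) (Idx p) ℂ)) :
    LieSubalgebra ℝ (Matrix (Idx p) (Idx p) ℂ) where
  carrier := {X | cayley p * X * (cayley p)⁻¹ ∈ h}
  zero_mem' := by simp
  add_mem' := by
    intro X Y hX hY
    simp only [Set.mem_ofPred_eq] at hX hY ⊢
    rw [Matrix.mul_add, Matrix.add_mul]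
    exact h.add_mem hX hY
  smul_mem' := by
    intro c X hX
    simp only [Set.mem_ofPred_eq] at hX ⊢
    rw [Matrix.mul_smul, Matrix.smul_mul]
    exact h.smul_mem c hX
  lie_mem' := by
    intro X Y hX hY
    simp only [Set.mem_ofPred_eq] at hX hY ⊢
    have key : ∀ U V : Matrix (Idx p) (Idx p) ℂ, cayley p * (U * V) * (cayley p)⁻¹ =
        (cayley p * U * (cayley p)⁻¹) * (cayley p * V * (cayley p)⁻¹) := by
      intro U V
      calc cayley p * (U * V) * (cayley p)⁻¹
          = cayley p * U * 1 * V * (cayley p)⁻¹ := by simp only [Matrix.mul_assoc, Matrix.one_mul]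
        _ = _ := by rw [← cayley_inv_mul p]; simp only [Matrix.mul_assoc]
    have := h.lie_mem hX hY
    rw [Ring.lie_def] at this ⊢
    rwa [Matrix.mul_sub, Matrix.sub_mul, key, key]

/-- The labels of the model subalgebras of `𝔲(p,1)`; quasi-nilpotent: `1 ≤ k ≤ p - 2`. -/
inductive MASAType (p : ℕ) : Type
  | quasiElliptic : MASAType p
  | quasiParabolic : MASAType p
  | quasiHyperbolic : MASAType p
  | nilpotent : MASAType p
  | quasiNilpotent (k : ℕ) (hk : 1 ≤ k) (hkp : k + 2 ≤ p) : MASAType p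

/-- The model subalgebras of `𝔲(p,1)`. All but the first are given in `𝔲(K_p)` and moved to
`𝔲(p,1)` by the Cayley transform. In the nilpotent case (`k = 0`) there is no block `D`, in the
quasi-parabolic case (`k = p - 1`) there is no vector `b`. -/
def modelAlg (p : ℕ) : MASAType p → LieSubalgebra ℝ (Matrix (Idx p) (Idx p) ℂ)
  | .quasiElliptic => diagIn (uPOne p)
  | .quasiParabolic => cayleyConj p (parAlg p (p - 1))
  | .quasiHyperbolic => cayleyConj p (hypAlg p)
  | .nilpotent => cayleyConj p (parAlg p 0)
  | .quasiNilpotent k _ _ => cayleyConj p (parAlg p k)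

/-- The Berezinian of a supermatrix. -/
def ber {m n : Type*} [Fintype m] [DecidableEq m] [Fintype n] [DecidableEq n]
    (X : Matrix (m ⊕ n) (m ⊕ n) ℂ) : ℂ :=
  (X.toBlocks₁₁ - X.toBlocks₁₂ * X.toBlocks₂₂⁻¹ * X.toBlocks₂₁).det * (X.toBlocks₂₂.det)⁻¹

/-- The Lie group underlying `SU(p,1|q)`: the even matrices `γ` with `γ* J γ = J`, `Ber γ = 1`. -/
def suGroup (p q : ℕ) : Subgroup (GL (Idx p ⊕ Fin q) ℂ) where
  carrier := {γ | γ.val.toBlocks₁₂ = 0 ∧ γ.val.toBlocks₂₁ = 0 ∧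
    γ.valᴴ * formSuper p q * γ.val = formSuper p q ∧ ber γ.val = 1}
  one_mem' := by
    refine ⟨?_, ?_, by simp, ?_⟩ <;>
    rw [Units.val_one, ← fromBlocks_one]
    · rw [toBlocks_fromBlocks₁₂]
    · rw [toBlocks_fromBlocks₂₁]
    · rw [ber, toBlocks_fromBlocks₁₁, toBlocks_fromBlocks₁₂, toBlocks_fromBlocks₂₁,
        toBlocks_fromBlocks₂₂]
      simp
  mul_mem' := by
    rintro α β ⟨h1, h2, h3, h4⟩ ⟨k1, k2, k3, k4⟩
    have hm : (α * β).val = fromBlocks (α.val.toBlocks₁₁ * β.val.toBlocks₁₁) 0 0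
        (α.val.toBlocks₂₂ * β.val.toBlocks₂₂) := by
      conv_lhs => rw [Units.val_mul, ← fromBlocks_toBlocks α.val, ← fromBlocks_toBlocks β.val,
        h1, h2, k1, k2]
      simp [fromBlocks_multiply]
    refine ⟨by rw [hm, toBlocks_fromBlocks₁₂], by rw [hm, toBlocks_fromBlocks₂₁], ?_, ?_⟩
    · rw [Units.val_mul, conjTranspose_mul]
      calc _ = β.valᴴ * (α.valᴴ * formSuper p q * α.val) * β.val := by
            simp only [Matrix.mul_assoc]
        _ = _ := by rw [h3, k3]
    · rw [hm]
      simp only [ber, h1, h2, k1, k2, toBlocks_fromBlocks₁₁, toBlocks_fromBlocks₁₂,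
        toBlocks_fromBlocks₂₁, toBlocks_fromBlocks₂₂, Matrix.mul_zero, sub_zero,
        det_mul, mul_inv] at h4 k4 ⊢
      rw [mul_mul_mul_comm, h4, k4, one_mul]
  inv_mem' := by
    rintro α ⟨h1, h2, h3, h4⟩
    have hα : α.val = fromBlocks α.val.toBlocks₁₁ 0 0 α.val.toBlocks₂₂ := by
      conv_lhs => rw [← fromBlocks_toBlocks α.val, h1, h2]
    have hl : α⁻¹.val * α.val = 1 := by rw [← Units.val_mul, inv_mul_cancel, Units.val_one]
    have hr : α.val * α⁻¹.val = 1 := by rw [← Units.val_mul, mul_inv_cancel, Units.val_one]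
    rw [hα, ← fromBlocks_toBlocks α⁻¹.val, fromBlocks_multiply, ← fromBlocks_one,
      fromBlocks_inj] at hl hr
    obtain ⟨l1, l2, l3, l4⟩ := hl
    obtain ⟨r1, r2, r3, r4⟩ := hr
    simp only [Matrix.mul_zero, Matrix.zero_mul, add_zero, zero_add] at l1 l2 l3 l4 r1 r2 r3 r4
    have e1 : α⁻¹.val.toBlocks₁₂ = 0 := by
      rw [← Matrix.mul_one α⁻¹.val.toBlocks₁₂, ← r4, ← Matrix.mul_assoc, l2, Matrix.zero_mul]
    have e2 : α⁻¹.val.toBlocks₂₁ = 0 := by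
      rw [← Matrix.mul_one α⁻¹.val.toBlocks₂₁, ← r1, ← Matrix.mul_assoc, l3, Matrix.zero_mul]
    refine ⟨e1, e2, ?_, ?_⟩
    · have hr' : α.val * α⁻¹.val = 1 := by
        rw [← Units.val_mul, mul_inv_cancel, Units.val_one]
      have hr'' : α⁻¹.valᴴ * α.valᴴ = 1 := by
        rw [← conjTranspose_mul, hr', conjTranspose_one]
      calc α⁻¹.valᴴ * formSuper p q * α⁻¹.val
          = α⁻¹.valᴴ * (α.valᴴ * formSuper p q * α.val) * α⁻¹.val := by rw [h3]
        _ = (α⁻¹.valᴴ * α.valᴴ) * formSuper p q * (α.val * α⁻¹.val) := by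
            simp only [Matrix.mul_assoc]
        _ = _ := by rw [hr', hr'', Matrix.one_mul, Matrix.mul_one]
    · have d1 := congrArg det l1
      have d2 := congrArg det l4
      rw [det_mul, det_one] at d1 d2
      simp only [ber, h1, h2, e1, e2, Matrix.mul_zero, sub_zero] at h4 ⊢
      rw [eq_inv_of_mul_eq_one_left d1, eq_inv_of_mul_eq_one_left d2, ← mul_inv, h4, inv_one]

/-- `H'` is conjugate to `H` under the Lie group underlying `SU(p,1|q)`. -/
def ConjAlg (p q : ℕ)
    (H H' : LieSubalgebra ℝ (Matrix (Idx p ⊕ Fin q) (Idx p ⊕ Fin q) ℂ)) : Prop :=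
  ∃ γ ∈ suGroup p q, (H' : Set (Matrix (Idx p ⊕ Fin q) (Idx p ⊕ Fin q) ℂ)) =
    (fun X => γ.val * X * γ⁻¹.val) '' H

/-- The Lie algebra of a matrix group `G`, as a set: all `X` with `exp (tX) ∈ G` for all `t`. -/
def lieSet {n : Type*} [Fintype n] [DecidableEq n] (G : Subgroup (GL n ℂ)) :
    Set (Matrix n n ℂ) :=
  {X | ∀ t : ℝ, ∃ g ∈ G, g.val = NormedSpace.exp (t • X)}

/-- `G` is an even MASG of `SU(p,1|q)`: a connected Lie subgroup (that is, one which is generated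
by the exponentials of its Lie algebra) whose Lie algebra is an even MASA. As this Lie algebra has
no odd part, the super Lie subgroup is an ordinary Lie subgroup of the underlying Lie group. -/
def IsEvenMASG (p q : ℕ) (G : Subgroup (GL (Idx p ⊕ Fin q) ℂ)) : Prop :=
  G ≤ suGroup p q ∧
  G = Subgroup.closure {g | ∃ X ∈ lieSet G, g.val = NormedSpace.exp X} ∧
  ∃ H, IsEvenMASA p q H ∧ lieSet G = H

/-- `G'` is conjugate to `G` under the Lie group underlying `SU(p,1|q)`. -/
def ConjGrp (p q : ℕ) (G G' : Subgroup (GL (Idx p ⊕ Fin q) ℂ)) : Prop :=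
  ∃ γ ∈ suGroup p q, G' = G.map (MulAut.conj γ).toMonoidHom

end

noncomputable section

section Sesquilinear

variable {n : Type*} [Fintype n]

/-- The sesquilinear form `x* S y`. -/
def sesq (S : Matrix n n ℂ) (x y : n → ℂ) : ℂ := star x ⬝ᵥ S *ᵥ y

theorem sesq_add_left (S : Matrix n n ℂ) (x x' y : n → ℂ) :
    sesq S (x + x') y = sesq S x y + sesq S x' y := by
  simp [sesq, add_dotProduct]

theorem sesq_add_right (S : Matrix n n ℂ) (x y y' : n → ℂ) :
    sesq S x (y + y') = sesq S x y + sesq S x y' := by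
  simp [sesq, mulVec_add]

theorem sesq_smul_left (S : Matrix n n ℂ) (c : ℂ) (x y : n → ℂ) :
    sesq S (c • x) y = star c * sesq S x y := by
  simp [sesq]

theorem sesq_smul_right (S : Matrix n n ℂ) (c : ℂ) (x y : n → ℂ) :
    sesq S x (c • y) = c * sesq S x y := by
  simp [sesq, mulVec_smul]

theorem sesq_sub_left (S : Matrix n n ℂ) (x x' y : n → ℂ) :
    sesq S (x - x') y = sesq S x y - sesq S x' y := by
  simp [sesq, sub_dotProduct]

theorem sesq_sub_right (S : Matrix n n ℂ) (x y y' : n → ℂ) :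
    sesq S x (y - y') = sesq S x y - sesq S x y' := by
  simp [sesq, mulVec_sub]

theorem star_sesq {S : Matrix n n ℂ} (hS : S.IsHermitian) (x y : n → ℂ) :
    star (sesq S x y) = sesq S y x := by
  rw [sesq, sesq, star_dotProduct, star_star, star_mulVec, hS.eq, dotProduct_mulVec]

theorem sesq_self_im {S : Matrix n n ℂ} (hS : S.IsHermitian) (x : n → ℂ) :
    (sesq S x x).im = 0 := by
  have h := congrArg Complex.im (star_sesq hS x x)
  simp only [star_def, conj_im] at h
  linarith

theorem sesq_self_eq_re {S : Matrix n n ℂ} (hS : S.IsHermitian) (x : n → ℂ) :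
    sesq S x x = ((sesq S x x).re : ℂ) :=
  Complex.ext (by simp) (by simp [sesq_self_im hS])

theorem sesq_mulVec_of_mem_uForm [DecidableEq n] {S X : Matrix n n ℂ} (hX : X ∈ uForm S) (x y : n → ℂ) :
    sesq S (X *ᵥ x) y = -sesq S x (X *ᵥ y) := by
  have h : Xᴴ * S = -(S * X) := eq_neg_of_add_eq_zero_left hX
  rw [sesq, sesq, star_mulVec, ← dotProduct_mulVec, mulVec_mulVec, mulVec_mulVec, h, neg_mulVec,
    dotProduct_neg]

/-- The functional `y ↦ x* S y`. -/
def sesqDual (S : Matrix n n ℂ) (x : n → ℂ) : (n → ℂ) →ₗ[ℂ] ℂ where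
  toFun y := sesq S x y
  map_add' := sesq_add_right S x
  map_smul' c y := sesq_smul_right S c x y

@[simp] theorem sesqDual_apply (S : Matrix n n ℂ) (x y : n → ℂ) : sesqDual S x y = sesq S x y := rfl

theorem conjTranspose_mul_mul_apply {m : Type*} (S : Matrix n n ℂ) (P Q : Matrix n m ℂ) (i j : m) :
    (Pᴴ * S * Q) i j = sesq S (fun a => P a i) (fun a => Q a j) := by
  rw [Matrix.mul_assoc, Matrix.mul_apply, sesq, dotProduct]
  rfl

/-- A nonzero functional cuts down the dimension of a subspace by one. -/
theorem finrank_inf_ker_add_one (W : Submodule ℂ (n → ℂ)) (φ : (n → ℂ) →ₗ[ℂ] ℂ)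
    {u : n → ℂ} (hu : u ∈ W) (hφ : φ u ≠ 0) :
    Module.finrank ℂ ↥(W ⊓ LinearMap.ker φ) + 1 = Module.finrank ℂ W := by
  have hne : φ.domRestrict W ≠ 0 := fun h => hφ (by simpa using LinearMap.congr_fun h ⟨u, hu⟩)
  have h1 := Module.Dual.finrank_ker_add_one_of_ne_zero (f := φ.domRestrict W) hne
  rw [← h1, ← Submodule.map_comap_subtype,
    (Submodule.equivSubtypeMap W (Submodule.comap W.subtype (LinearMap.ker φ))).finrank_eq.symm]
  rfl

/-- A commuting family of matrices has a common eigenvector in each invariant subspace. -/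
theorem exists_common_eigenvector [DecidableEq n] {ι : Type*} {X : ι → Matrix n n ℂ}
    (hX : ∀ i j, X i * X j = X j * X i) (W : Submodule ℂ (n → ℂ)) (hne : W ≠ ⊥)
    (hW : ∀ i, ∀ x ∈ W, X i *ᵥ x ∈ W) :
    ∃ v ∈ W, v ≠ 0 ∧ ∀ i, ∃ c : ℂ, X i *ᵥ v = c • v := by
  induction hr : Module.finrank ℂ W using Nat.strong_induction_on generalizing W with
  | _ r ih =>
  by_cases hs : ∀ i, ∃ c : ℂ, ∀ x ∈ W, X i *ᵥ x = c • x
  · obtain ⟨v, hv, hv0⟩ := W.ne_bot_iff.1 hne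
    exact ⟨v, hv, hv0, fun i => (hs i).imp fun c hc => hc v hv⟩
  · push Not at hs
    obtain ⟨i, hi⟩ := hs
    have : Nontrivial W := (Submodule.nontrivial_iff_ne_bot).2 hne
    obtain ⟨c, hc⟩ := Module.End.exists_eigenvalue ((toLin' (X i)).restrict
      (p := W) (q := W) (fun x hx => by simpa using hW i x hx))
    obtain ⟨w, hw, hw0⟩ := hc.exists_hasEigenvector
    have hw' : X i *ᵥ (w : n → ℂ) = c • (w : n → ℂ) := by
      simpa using congrArg Subtype.val (Module.End.mem_eigenspace_iff.1 hw)
    let W' : Submodule ℂ (n → ℂ) := W ⊓ LinearMap.ker (toLin' (X i) - c • LinearMap.id)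
    have hmem : ∀ x, x ∈ W' ↔ x ∈ W ∧ X i *ᵥ x = c • x := by
      intro x
      simp [W', sub_eq_zero]
    have hlt : W' < W := by
      refine lt_of_le_of_ne inf_le_left fun h => ?_
      obtain ⟨x, hx, hx'⟩ := hi c
      exact hx' ((hmem x).1 (h ▸ hx)).2
    obtain ⟨v, hv, h⟩ := ih _ (hr ▸ Submodule.finrank_lt_finrank_of_lt hlt) W'
      (W'.ne_bot_iff.2 ⟨w, (hmem _).2 ⟨w.2, hw'⟩, by simpa using hw0⟩)
      (fun j x hx => by
        rw [hmem] at hx ⊢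
        refine ⟨hW j x hx.1, ?_⟩
        rw [mulVec_mulVec, hX, ← mulVec_mulVec, hx.2, mulVec_smul]) rfl
    exact ⟨v, hlt.le hv, h⟩

/-- The `S`-orthogonal complement of a common eigenvector of skew-adjoint matrices is
invariant. -/
theorem mulVec_mem_inf_ker_sesqDual [DecidableEq n] {S : Matrix n n ℂ}
    {X : Matrix n n ℂ} (hX : X ∈ uForm S) {W : Submodule ℂ (n → ℂ)}
    (hW : ∀ x ∈ W, X *ᵥ x ∈ W) {u : n → ℂ} (hu : ∃ c : ℂ, X *ᵥ u = c • u) :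
    ∀ x ∈ W ⊓ LinearMap.ker (sesqDual S u), X *ᵥ x ∈ W ⊓ LinearMap.ker (sesqDual S u) := by
  rintro x ⟨hx, hx'⟩
  obtain ⟨c, hc⟩ := hu
  refine ⟨hW x hx, ?_⟩
  rw [SetLike.mem_coe, LinearMap.mem_ker, sesqDual_apply] at hx' ⊢
  have := sesq_mulVec_of_mem_uForm hX u x
  rw [hc, sesq_smul_left, hx', mul_zero] at this
  exact neg_eq_zero.1 this.symm

/-- If the form is not positive definite on an invariant subspace, then this subspace contains a
common eigenvector which is not positive. -/
theorem exists_common_eigenvector_nonpos [DecidableEq n] {ι : Type*} {S : Matrix n n ℂ}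
    (hS : S.IsHermitian) {X : ι → Matrix n n ℂ} (hXS : ∀ i, X i ∈ uForm S)
    (hX : ∀ i j, X i * X j = X j * X i) (W : Submodule ℂ (n → ℂ))
    (hW : ∀ i, ∀ x ∈ W, X i *ᵥ x ∈ W) (hne : ∃ x ∈ W, x ≠ 0 ∧ (sesq S x x).re ≤ 0) :
    ∃ v ∈ W, v ≠ 0 ∧ (sesq S v v).re ≤ 0 ∧ ∀ i, ∃ c : ℂ, X i *ᵥ v = c • v := by
  induction hr : Module.finrank ℂ W using Nat.strong_induction_on generalizing W with
  | _ r ih =>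
  obtain ⟨x, hx, hx0, hxx⟩ := hne
  obtain ⟨u, hu, hu0, huX⟩ := exists_common_eigenvector hX W (W.ne_bot_iff.2 ⟨x, hx, hx0⟩) hW
  by_cases hpos : (sesq S u u).re ≤ 0
  · exact ⟨u, hu, hu0, hpos, huX⟩
  · push Not at hpos
    have huu : sesq S u u ≠ 0 := fun h => by simp [h] at hpos
    have hfr := finrank_inf_ker_add_one W (sesqDual S u) hu huu
    set c : ℂ := sesq S u x / sesq S u u with hc
    set y := x - c • u with hy
    have huy : sesq S u y = 0 := by
      rw [hy, sesq_sub_right, sesq_smul_right, hc, div_mul_cancel₀ _ huu, sub_self]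
    have hyu : sesq S y u = 0 := by rw [← star_sesq hS, huy, star_zero]
    have hxy : x = y + c • u := by simp [hy]
    have hq : (sesq S x x).re = (sesq S y y).re + normSq c * (sesq S u u).re := by
      rw [hxy, sesq_add_left, sesq_add_right, sesq_add_right, sesq_smul_right, sesq_smul_left,
        sesq_smul_left, huy, hyu, sesq_smul_right, sesq_self_eq_re hS u, ← mul_assoc, star_def,
        ← normSq_eq_conj_mul_self]
      simp
    have hcn := mul_nonneg (normSq_nonneg c) hpos.le
    have hy0 : y ≠ 0 := by
      intro h
      have hcx : c ≠ 0 := by rintro h'; apply hx0; rw [hxy, h, h']; simp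
      have := mul_pos (normSq_pos.2 hcx) hpos
      rw [h] at hq
      simp [sesq] at hq
      simp [sesq] at this hxx
      linarith
    obtain ⟨v, hv, h⟩ := ih (Module.finrank ℂ ↥(W ⊓ LinearMap.ker (sesqDual S u))) (by omega) _
      (fun i => mulVec_mem_inf_ker_sesqDual (hXS i) (hW i) (huX i))
      ⟨y, ⟨W.sub_mem hx (W.smul_mem c hu), huy⟩, hy0, by linarith⟩ rfl
    exact ⟨v, hv.1, h⟩

theorem exists_smul_sesq_self_eq_one {S : Matrix n n ℂ} (hS : S.IsHermitian) {v : n → ℂ}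
    (hv : 0 < (sesq S v v).re) : ∃ c : ℂ, c ≠ 0 ∧ sesq S (c • v) (c • v) = 1 := by
  have hs : Real.sqrt (sesq S v v).re ≠ 0 := (Real.sqrt_pos.2 hv).ne'
  refine ⟨((Real.sqrt (sesq S v v).re)⁻¹ : ℝ), by simpa using hs, ?_⟩
  rw [sesq_smul_left, sesq_smul_right, sesq_self_eq_re hS v, star_def, conj_ofReal]
  norm_cast
  rw [← mul_assoc, ← mul_inv, Real.mul_self_sqrt hv.le, inv_mul_cancel₀ hv.ne']

theorem orthonormal_cons {S : Matrix n n ℂ} (hS : S.IsHermitian) {r : ℕ} {u : n → ℂ}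
    {e : Fin r → n → ℂ} (hu : sesq S u u = 1) (hue : ∀ a, sesq S u (e a) = 0)
    (he : ∀ a a', sesq S (e a) (e a') = if a = a' then 1 else 0) :
    ∀ a a' : Fin (r + 1), sesq S ((Fin.cons u e : Fin (r + 1) → n → ℂ) a)
      ((Fin.cons u e : Fin (r + 1) → n → ℂ) a') = if a = a' then 1 else 0 := by
  have heu : ∀ a, sesq S (e a) u = 0 := fun a => by rw [← star_sesq hS, hue, star_zero]
  intro a a'
  refine Fin.cases ?_ (fun a => ?_) a <;> refine Fin.cases ?_ (fun a' => ?_) a'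
  · simp [hu]
  · simp [hue, (Fin.succ_ne_zero a').symm]
  · simp [heu]
  · simp [he]

/-- On an invariant subspace on which the form is positive definite, commuting skew-adjoint
matrices have an orthonormal basis of common eigenvectors. -/
theorem exists_orthonormal_eigenvectors [DecidableEq n] {ι : Type*} {S : Matrix n n ℂ}
    (hS : S.IsHermitian) {X : ι → Matrix n n ℂ} (hXS : ∀ i, X i ∈ uForm S)
    (hX : ∀ i j, X i * X j = X j * X i) {r : ℕ} (W : Submodule ℂ (n → ℂ))
    (hr : Module.finrank ℂ W = r) (hW : ∀ i, ∀ x ∈ W, X i *ᵥ x ∈ W)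
    (hpos : ∀ x ∈ W, x ≠ 0 → 0 < (sesq S x x).re) :
    ∃ e : Fin r → n → ℂ, (∀ a, e a ∈ W) ∧
      (∀ a a', sesq S (e a) (e a') = if a = a' then 1 else 0) ∧
      ∀ a i, ∃ c : ℂ, X i *ᵥ e a = c • e a := by
  induction r generalizing W with
  | zero => exact ⟨Fin.elim0, fun a => a.elim0, fun a => a.elim0, fun a => a.elim0⟩
  | succ r ih =>
    obtain ⟨v, hv, hv0, hvX⟩ := exists_common_eigenvector hX W
      (by rintro rfl; simp at hr) hW
    obtain ⟨c, hc, huu⟩ := exists_smul_sesq_self_eq_one hS (hpos v hv hv0)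
    set u := c • v with hu
    have huX : ∀ i, ∃ c : ℂ, X i *ᵥ u = c • u := fun i => by
      obtain ⟨d, hd⟩ := hvX i
      exact ⟨d, by rw [hu, mulVec_smul, hd, smul_comm]⟩
    have huW : u ∈ W := W.smul_mem c hv
    have hfr := finrank_inf_ker_add_one W (sesqDual S u) huW (by simp [huu])
    obtain ⟨e, heW, he, heX⟩ := ih (W ⊓ LinearMap.ker (sesqDual S u)) (by omega)
      (fun i => mulVec_mem_inf_ker_sesqDual (hXS i) (hW i) (huX i))
      (fun x hx => hpos x hx.1)
    refine ⟨Fin.cons u e, ?_, orthonormal_cons hS huu (fun a => (heW a).2) he, ?_⟩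
    · exact Fin.cases huW fun a => (heW a).1
    · exact Fin.cases huX fun a => heX a

/-- Vectors with real inner products have real coordinates with respect to some orthonormal
basis. -/
theorem exists_orthonormal_im_eq_zero {ι : Type*} {S : Matrix n n ℂ}
    (hS : S.IsHermitian) {r : ℕ} (W : Submodule ℂ (n → ℂ)) (b : ι → n → ℂ)
    (hr : Module.finrank ℂ W = r) (hb : ∀ i, b i ∈ W)
    (hbb : ∀ i j, (sesq S (b i) (b j)).im = 0)
    (hpos : ∀ x ∈ W, x ≠ 0 → 0 < (sesq S x x).re) :
    ∃ e : Fin r → n → ℂ, (∀ a, e a ∈ W) ∧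
      (∀ a a', sesq S (e a) (e a') = if a = a' then 1 else 0) ∧
      ∀ a i, (sesq S (e a) (b i)).im = 0 := by
  induction r generalizing W b with
  | zero => exact ⟨Fin.elim0, fun a => a.elim0, fun a => a.elim0, fun a => a.elim0⟩
  | succ r ih =>
    obtain ⟨u, huW, huu, hub⟩ : ∃ u ∈ W, sesq S u u = 1 ∧ ∀ i, (sesq S u (b i)).im = 0 := by
      by_cases h0 : ∃ i, b i ≠ 0
      · obtain ⟨i, hi⟩ := h0
        have hp := hpos _ (hb i) hi
        have hs : Real.sqrt (sesq S (b i) (b i)).re ≠ 0 := (Real.sqrt_pos.2 hp).ne'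
        refine ⟨(((Real.sqrt (sesq S (b i) (b i)).re)⁻¹ : ℝ) : ℂ) • b i, W.smul_mem _ (hb i),
          ?_, fun j => ?_⟩
        · rw [sesq_smul_left, sesq_smul_right, sesq_self_eq_re hS (b i), star_def, conj_ofReal]
          norm_cast
          rw [← mul_assoc, ← mul_inv, Real.mul_self_sqrt hp.le, inv_mul_cancel₀ hp.ne']
        · rw [sesq_smul_left, star_def, conj_ofReal, im_ofReal_mul, hbb, mul_zero]
      · push Not at h0
        obtain ⟨v, hv, hv0⟩ := W.ne_bot_iff.1 (by rintro rfl; simp at hr)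
        obtain ⟨c, hc, huu⟩ := exists_smul_sesq_self_eq_one hS (hpos v hv hv0)
        exact ⟨c • v, W.smul_mem c hv, huu, fun i => by simp [h0 i, sesq]⟩
    have hfr := finrank_inf_ker_add_one W (sesqDual S u) huW (by simp [huu])
    have hstar : ∀ i, sesq S (b i) u = sesq S u (b i) := fun i => by
      rw [← star_sesq hS, star_def, conj_eq_iff_im.2 (hub i)]
    have hc : ∀ i, star (sesq S u (b i)) = sesq S u (b i) := fun i => by
      rw [star_def, conj_eq_iff_im.2 (hub i)]
    obtain ⟨e, heW, he, heb⟩ := ih (W ⊓ LinearMap.ker (sesqDual S u))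
      (fun i => b i - sesq S u (b i) • u) (by omega)
      (fun i => ⟨W.sub_mem (hb i) (W.smul_mem _ huW), by
        simp [sesq_sub_right, sesq_smul_right, huu]⟩)
      (fun i j => by
        simp only [sesq_sub_left, sesq_sub_right, sesq_smul_left, sesq_smul_right, huu, hstar, hc]
        simp [hbb, hub])
      (fun x hx => hpos x hx.1)
    refine ⟨Fin.cons u e, ?_, orthonormal_cons hS huu (fun a => (heW a).2) he, ?_⟩
    · exact Fin.cases huW fun a => (heW a).1
    · refine Fin.cases hub fun a i => ?_
      have heu : sesq S (e a) u = 0 := by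
        rw [← star_sesq hS, show sesq S u (e a) = 0 from (heW a).2, star_zero]
      have := heb a i
      rwa [sesq_sub_right, sesq_smul_right, heu, mul_zero, sub_zero] at this

/-- In a Lorentzian space, orthogonal non-positive vectors are dependent. -/
theorem exists_smul_of_nonpos {S : Matrix n n ℂ} (hS : S.IsHermitian) (l : (n → ℂ) →ₗ[ℂ] ℂ)
    (hl : ∀ x, x ≠ 0 → l x = 0 → 0 < (sesq S x x).re) {v y : n → ℂ} (hv0 : v ≠ 0)
    (hv : (sesq S v v).re ≤ 0) (hy : (sesq S y y).re ≤ 0) (hvy : sesq S v y = 0) :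
    ∃ c : ℂ, y = c • v := by
  have hlv : l v ≠ 0 := fun h => absurd (hl v hv0 h) hv.not_gt
  refine ⟨l y / l v, ?_⟩
  by_contra hne
  have hyv : sesq S y v = 0 := by rw [← star_sesq hS, hvy, star_zero]
  have h := hl (y - (l y / l v) • v) (sub_ne_zero.2 hne) (by simp [hlv])
  rw [sesq_sub_left, sesq_sub_right, sesq_sub_right, sesq_smul_left, sesq_smul_left,
    sesq_smul_right, sesq_smul_right, hvy, hyv, sesq_self_eq_re hS v, ← mul_assoc, star_def,
    ← normSq_eq_conj_mul_self] at h
  have := mul_nonneg (normSq_nonneg (l y / l v)) (neg_nonneg.2 hv)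
  simp at h this
  linarith

end Sesquilinear

section Forms

theorem formJ_mul_formJ (p : ℕ) : formJ p * formJ p = 1 := by
  rw [formJ, fromBlocks_multiply, ← fromBlocks_one]
  congr 1
  · simp
  · simp
  · simp
  · ext i j; fin_cases i <;> fin_cases j <;> simp

theorem formK_mul_formK_inv (p : ℕ) :
    formK p * fromBlocks ((1 / 2 : ℂ) • 1) 0 0 !![0, -I; I, 0] = 1 := by
  rw [formK, fromBlocks_multiply, ← fromBlocks_one]
  congr 1
  · simp [smul_smul]
  · simp
  · simp
  · ext i j; fin_cases i <;> fin_cases j <;> simp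

theorem isUnit_formK (p : ℕ) : IsUnit (formK p) := IsUnit.of_mul_eq_one _ (formK_mul_formK_inv p)

theorem isUnit_formJ (p : ℕ) : IsUnit (formJ p) := IsUnit.of_mul_eq_one _ (formJ_mul_formJ p)

theorem isHermitian_formJ (p : ℕ) : (formJ p).IsHermitian := by
  rw [IsHermitian, formJ, fromBlocks_conjTranspose]
  congr 1
  · simp
  · simp
  · simp
  · ext i j; fin_cases i <;> fin_cases j <;> simp

theorem isUnit_of_conjTranspose_mul_mul {n : Type*} [Fintype n] [DecidableEq n]
    {S T P : Matrix n n ℂ} (hT : IsUnit T) (h : Pᴴ * S * P = T) : IsUnit P := by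
  rw [isUnit_iff_isUnit_det, ← h, det_mul, IsUnit.mul_iff] at hT
  exact (isUnit_iff_isUnit_det _).2 hT.2

theorem mem_uForm_of_mul_eq {n : Type*} [Fintype n] [DecidableEq n] {S T P X Y : Matrix n n ℂ}
    (h : Pᴴ * S * P = T) (hX : X ∈ uForm S) (hXY : X * P = P * Y) : Y ∈ uForm T := by
  have hX' : Xᴴ * S + S * X = 0 := hX
  change Yᴴ * T + T * Y = 0
  calc Yᴴ * T + T * Y = (P * Y)ᴴ * S * P + Pᴴ * S * (P * Y) := by
        rw [← h, conjTranspose_mul]; simp only [Matrix.mul_assoc]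
    _ = Pᴴ * (Xᴴ * S + S * X) * P := by
        rw [← hXY, conjTranspose_mul]
        simp only [Matrix.mul_assoc, Matrix.mul_add, Matrix.add_mul]
    _ = 0 := by rw [hX']; simp

theorem mem_uForm_smul {n : Type*} [Fintype n] [DecidableEq n] {S X : Matrix n n ℂ} {c : ℂ}
    (hc : c ≠ 0) : X ∈ uForm (c • S) ↔ X ∈ uForm S := by
  change Xᴴ * (c • S) + c • S * X = 0 ↔ Xᴴ * S + S * X = 0
  rw [Matrix.mul_smul, Matrix.smul_mul, ← smul_add, smul_eq_zero, or_iff_right hc]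

/-- The matrix with columns `e j`. -/
def ofCols {n m : Type*} (e : m → n → ℂ) : Matrix n m ℂ := of fun a j => e j a

theorem mul_ofCols_eq_mul_diagonal {n : Type*} [Fintype n] [DecidableEq n] {X : Matrix n n ℂ}
    {e : n → n → ℂ} {c : n → ℂ} (h : ∀ j, X *ᵥ e j = c j • e j) :
    X * ofCols e = ofCols e * diagonal c := by
  ext a j
  rw [mul_diagonal]
  exact (congrFun (h j) a).trans (mul_comm _ _)

theorem conjTranspose_ofCols_mul_mul {n m : Type*} [Fintype n] (S : Matrix n n ℂ)
    (e : m → n → ℂ) (i j : m) :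
    ((ofCols e)ᴴ * S * ofCols e) i j = sesq S (e i) (e j) :=
  conjTranspose_mul_mul_apply S _ _ i j

theorem mul_eq_mul_inv_mul {n : Type*} [Fintype n] [DecidableEq n] {P : Matrix n n ℂ}
    (hP : IsUnit P) (X : Matrix n n ℂ) : X * P = P * (P⁻¹ * X * P) := by
  rw [Matrix.mul_assoc, mul_nonsing_inv_cancel_left _ _ ((isUnit_iff_isUnit_det _).1 hP)]

theorem commute_of_mul_eq {n : Type*} [Fintype n] [DecidableEq n] {P X X' Y Y' : Matrix n n ℂ}
    (hP : IsUnit P) (h : X * P = P * Y) (h' : X' * P = P * Y') (hX : X * X' = X' * X) :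
    Y * Y' = Y' * Y := by
  refine hP.mul_left_cancel ?_
  rw [← Matrix.mul_assoc, ← h, Matrix.mul_assoc, ← h', ← Matrix.mul_assoc, hX, Matrix.mul_assoc, h,
    ← Matrix.mul_assoc, h', Matrix.mul_assoc]

theorem sesq_one_self_re {n : Type*} [Fintype n] [DecidableEq n] (x : n → ℂ) :
    (sesq 1 x x).re = ∑ j, normSq (x j) := by
  simp [sesq, dotProduct, ← normSq_eq_conj_mul_self]

theorem sesq_one_self_pos {n : Type*} [Fintype n] [DecidableEq n] {x : n → ℂ} (hx : x ≠ 0) :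
    0 < (sesq 1 x x).re := by
  rw [sesq_one_self_re]
  obtain ⟨j, hj⟩ := Function.ne_iff.1 hx
  exact Finset.sum_pos' (fun _ _ => normSq_nonneg _) ⟨j, Finset.mem_univ _, normSq_pos.2 hj⟩

/-- Commuting skew-Hermitian matrices are simultaneously unitarily diagonalizable. -/
theorem exists_unitary_diagonalizing {n ι : Type*} [Fintype n] [DecidableEq n]
    {X : ι → Matrix n n ℂ} (hXS : ∀ i, X i ∈ uForm (1 : Matrix n n ℂ))
    (hX : ∀ i j, X i * X j = X j * X i) :
    ∃ U : Matrix n n ℂ, Uᴴ * U = 1 ∧ ∃ d : ι → n → ℝ,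
      ∀ i, X i * U = U * diagonal fun j => I * d i j := by
  obtain ⟨e, -, he, heX⟩ := exists_orthonormal_eigenvectors isHermitian_one hXS hX ⊤
    (r := Fintype.card n) (by simp) (by simp) (fun x _ hx => sesq_one_self_pos hx)
  choose c hc using heX
  let f := Fintype.equivFin n
  have hU : (ofCols (e ∘ f))ᴴ * ofCols (e ∘ f) = 1 := by
    ext i j
    have := conjTranspose_ofCols_mul_mul 1 (e ∘ f) i j
    rw [Matrix.mul_one] at this
    rw [this, Function.comp_apply, Function.comp_apply, he, Matrix.one_apply]
    simp only [f.apply_eq_iff_eq]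
  refine ⟨ofCols (e ∘ f), hU, fun i j => (c (f j) i).im, fun i => ?_⟩
  have hXU := mul_ofCols_eq_mul_diagonal (X := X i) (e := e ∘ f) (c := fun j => c (f j) i)
    fun j => hc (f j) i
  have hD := mem_uForm_of_mul_eq (T := 1) (by rwa [Matrix.mul_one]) (hXS i) hXU
  rw [hXU]
  congr 2
  ext j
  have hj : star (c (f j) i) + c (f j) i = 0 := by
    have : (diagonal fun j => c (f j) i)ᴴ * (1 : Matrix n n ℂ) +
      (1 : Matrix n n ℂ) * (diagonal fun j => c (f j) i) = 0 := hD
    simpa using congrFun₂ this j j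
  have := congrArg re hj
  simp at this
  apply Complex.ext <;> simp
  linarith

end Forms

section Siegel

variable {p : ℕ}

/-- The general element of the stabilizer in `𝔲(K_p)` of the `p`-th coordinate line. -/
def siegelMatrix (M : Matrix (Fin (p - 1)) (Fin (p - 1)) ℂ) (b : Fin (p - 1) → ℂ) (z : ℂ) (a : ℝ) :
    Matrix (Idx p) (Idx p) ℂ :=
  fromBlocks M (of fun j l => if l = 1 then b j else 0)
    (of fun l j => if l = 0 then 2 * I * star (b j) else 0) !![z, a; 0, -(starRingEnd ℂ z)]

theorem exists_eq_siegelMatrix {Y : Matrix (Idx p) (Idx p) ℂ} (hY : Y ∈ uForm (formK p)) {z : ℂ}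
    (hz : Y *ᵥ Pi.single (Sum.inr 0) 1 = z • Pi.single (Sum.inr 0) 1) :
    ∃ M ∈ uForm (1 : Matrix (Fin (p - 1)) (Fin (p - 1)) ℂ), ∃ b a, Y = siegelMatrix M b z a := by
  have hK : Yᴴ * formK p + formK p * Y = 0 := hY
  have hcol : ∀ i, Y i (Sum.inr 0) = z * (Pi.single (Sum.inr 0) 1 : Idx p → ℂ) i := by
    intro i
    have := congrFun hz i
    simpa using this
  have e11 : ∀ i j, star (Y (Sum.inl j) (Sum.inl i)) + Y (Sum.inl i) (Sum.inl j) = 0 := by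
    intro i j
    have := congrFun₂ hK (Sum.inl i) (Sum.inl j)
    simp [formK, Matrix.mul_apply, Matrix.one_apply] at this
    rw [mul_comm, ← mul_add] at this
    simpa using this
  have e12 : ∀ j, Y (Sum.inr 1) (Sum.inl j) = 0 := by
    intro j
    have := congrFun₂ hK (Sum.inr 0) (Sum.inl j)
    simp [formK, Matrix.mul_apply, Matrix.one_apply, hcol] at this
    simpa using this
  have e21 : ∀ j, Y (Sum.inr 0) (Sum.inl j) = 2 * I * star (Y (Sum.inl j) (Sum.inr 1)) := by
    intro j
    have := congrFun₂ hK (Sum.inr 1) (Sum.inl j)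
    simp [formK, Matrix.mul_apply, Matrix.one_apply] at this
    simp
    linear_combination (-I) * this + Y (Sum.inr 0) (Sum.inl j) * I_mul_I
  have e22 : Y (Sum.inr 1) (Sum.inr 1) = -(starRingEnd ℂ z) := by
    have := congrFun₂ hK (Sum.inr 0) (Sum.inr 1)
    simp [formK, Matrix.mul_apply, hcol] at this
    linear_combination I * this + (Y (Sum.inr 1) (Sum.inr 1) + starRingEnd ℂ z) * I_mul_I
  have e22' : (Y (Sum.inr 0) (Sum.inr 1)).im = 0 := by
    have := congrFun₂ hK (Sum.inr 1) (Sum.inr 1)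
    simp [formK, Matrix.mul_apply] at this
    have := congrArg im this
    have h2 := congrArg re ‹_ = (0 : ℂ)›
    simp at this h2
    linarith
  refine ⟨Y.toBlocks₁₁, ?_, fun j => Y (Sum.inl j) (Sum.inr 1), (Y (Sum.inr 0) (Sum.inr 1)).re, ?_⟩
  · change _ * 1 + 1 * _ = 0
    ext i j
    simpa [toBlocks₁₁] using e11 i j
  · ext i j
    rcases i with i | i <;> rcases j with j | j
    · simp [siegelMatrix, toBlocks₁₁]
    · fin_cases j <;> simp [siegelMatrix, hcol]
    · fin_cases i <;> simp [siegelMatrix, e12, e21]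
    · fin_cases i <;> fin_cases j <;> simp [siegelMatrix, hcol, e22]
      exact Complex.ext (by simp) (by simp [e22'])

theorem siegelMatrix_commute {M M' : Matrix (Fin (p - 1)) (Fin (p - 1)) ℂ}
    {b b' : Fin (p - 1) → ℂ} {z z' : ℂ} {a a' : ℝ}
    (h : siegelMatrix M b z a * siegelMatrix M' b' z' a' =
      siegelMatrix M' b' z' a' * siegelMatrix M b z a) :
    M * M' = M' * M ∧
    (∀ j, (M *ᵥ b') j - b j * star z' = (M' *ᵥ b) j - b' j * star z) ∧
    2 * I * (star b ⬝ᵥ b') + z * a' - a * star z' =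
      2 * I * (star b' ⬝ᵥ b) + z' * a - a' * star z := by
  rw [siegelMatrix, siegelMatrix, fromBlocks_multiply, fromBlocks_multiply, fromBlocks_inj] at h
  obtain ⟨h1, h2, -, h4⟩ := h
  have h0 : ∀ u v : Fin (p - 1) → ℂ,
      (of fun j l => if l = 1 then u j else 0 : Matrix (Fin (p - 1)) (Fin 2) ℂ) *
        (of fun l j => if l = 0 then v j else 0 : Matrix (Fin 2) (Fin (p - 1)) ℂ) = 0 := by
    intro u v
    ext i j
    simp [Matrix.mul_apply]
  refine ⟨?_, fun j => ?_, ?_⟩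
  · simpa [h0] using h1
  · have := congrFun₂ h2 j 1
    simp [Matrix.mul_apply] at this
    simp [mulVec, dotProduct]
    linear_combination this
  · have := congrFun₂ h4 0 1
    simp [Matrix.mul_apply, mul_assoc, ← Finset.mul_sum] at this
    simp [dotProduct]
    linear_combination this

/-- A family of matrices is carried into a Siegel model by an isometry of `K_p`. -/
def SiegelReducible {ι : Type*} (X : ι → Matrix (Idx p) (Idx p) ℂ) : Prop :=
  ∃ P : Matrix (Idx p) (Idx p) ℂ, Pᴴ * formK p * P = formK p ∧
    ((∀ i, ∃ Y ∈ hypAlg p, X i * P = P * Y) ∨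
      ∃ k ≤ p - 1, ∀ i, ∃ Y ∈ parAlg p k, X i * P = P * Y)

theorem SiegelReducible.of_mul_eq {ι : Type*} {X X' : ι → Matrix (Idx p) (Idx p) ℂ}
    {Q : Matrix (Idx p) (Idx p) ℂ} (hX' : SiegelReducible X')
    (hQ : Qᴴ * formK p * Q = formK p) (h : ∀ i, X i * Q = Q * X' i) : SiegelReducible X := by
  obtain ⟨P, hP, hY⟩ := hX'
  have key : ∀ (A : LieSubalgebra ℝ (Matrix (Idx p) (Idx p) ℂ)),
      (∀ i, ∃ Y ∈ A, X' i * P = P * Y) → ∀ i, ∃ Y ∈ A, X i * (Q * P) = Q * P * Y := by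
    intro A hA i
    obtain ⟨Y, hY, hXY⟩ := hA i
    exact ⟨Y, hY, by rw [← Matrix.mul_assoc, h, Matrix.mul_assoc, hXY, Matrix.mul_assoc]⟩
  refine ⟨Q * P, ?_, hY.imp (key _) fun ⟨k, hk, hA⟩ => ⟨k, hk, key _ hA⟩⟩
  calc (Q * P)ᴴ * formK p * (Q * P) = Pᴴ * (Qᴴ * formK p * Q) * P := by
        rw [conjTranspose_mul]; simp only [Matrix.mul_assoc]
    _ = _ := by rw [hQ, hP]

theorem isometry_fromBlocks_unitary {U : Matrix (Fin (p - 1)) (Fin (p - 1)) ℂ} (hU : Uᴴ * U = 1) :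
    (fromBlocks U 0 0 1)ᴴ * formK p * fromBlocks U 0 0 1 = formK p := by
  rw [formK, fromBlocks_conjTranspose, fromBlocks_multiply, fromBlocks_multiply]
  simp [hU]

theorem siegelMatrix_mul_fromBlocks_unitary {U M M' : Matrix (Fin (p - 1)) (Fin (p - 1)) ℂ}
    (hU : Uᴴ * U = 1) (hM : M * U = U * M') {b b' : Fin (p - 1) → ℂ} (hb : b = U *ᵥ b') (z : ℂ)
    (a : ℝ) :
    siegelMatrix M b z a * fromBlocks U 0 0 1 = fromBlocks U 0 0 1 * siegelMatrix M' b' z a := by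
  have hb' : star b ᵥ* U = star b' := by
    rw [hb, star_mulVec, vecMul_vecMul, hU, vecMul_one]
  rw [siegelMatrix, siegelMatrix, fromBlocks_multiply, fromBlocks_multiply]
  congr 1
  · simp [hM]
  · ext i j
    fin_cases j <;> simp [Matrix.mul_apply, hb, mulVec, dotProduct]
  · ext i j
    have := congrFun hb' j
    simp only [vecMul, dotProduct, Pi.star_apply] at this
    fin_cases i <;> simp [Matrix.mul_apply, mul_assoc, ← Finset.mul_sum]
    simpa using this
  · simp

/-- The element of the Heisenberg group of `K_p` with parameters `c` and `s`. -/
def heisenberg (c : Fin (p - 1) → ℂ) (s : ℝ) : Matrix (Idx p) (Idx p) ℂ :=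
  fromBlocks 1 (of fun j l => if l = 1 then c j else 0)
    (of fun l j => if l = 0 then 2 * I * star (c j) else 0)
    !![1, I * (star c ⬝ᵥ c) + s; 0, 1]

theorem isometry_heisenberg (c : Fin (p - 1) → ℂ) (s : ℝ) :
    (heisenberg c s)ᴴ * formK p * heisenberg c s = formK p := by
  rw [heisenberg, formK, fromBlocks_conjTranspose, fromBlocks_multiply, fromBlocks_multiply]
  have hcc : starRingEnd ℂ (star c ⬝ᵥ c) = star c ⬝ᵥ c := by
    simp [dotProduct, mul_comm]
  congr 1
  · ext i j
    simp [Matrix.mul_apply]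
  · ext i j
    fin_cases j <;> simp [Matrix.mul_apply]
    rw [conj_ofNat]
    linear_combination (2 * c i) * I_mul_I
  · ext i j
    fin_cases i <;> simp [Matrix.mul_apply]
    linear_combination (2 * starRingEnd ℂ (c j)) * I_mul_I
  · ext i j
    fin_cases i <;> fin_cases j <;> simp [Matrix.mul_apply, hcc]
    have : ∑ x, (starRingEnd ℂ) (c x) * c x = star c ⬝ᵥ c := rfl
    rw [this]
    linear_combination (2 * (star c ⬝ᵥ c)) * I_mul_I

theorem exists_equiv_card_le (m : ℕ) (P : Fin m → Prop) :
    ∃ k ≤ m, ∃ e : {j // P j} ⊕ {j // ¬P j} ≃ Fin m,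
      (∀ x, (e (Sum.inl x) : ℕ) < k) ∧ ∀ x, k ≤ (e (Sum.inr x) : ℕ) := by
  classical
  have hc : Fintype.card {j // P j} + Fintype.card {j // ¬P j} = m := by
    rw [← Fintype.card_sum, Fintype.card_congr (Equiv.sumCompl P), Fintype.card_fin]
  refine ⟨Fintype.card {j // P j}, by omega,
    (Equiv.sumCongr (Fintype.equivFin _) (Fintype.equivFin _)).trans
      (finSumFinEquiv.trans (finCongr hc)), fun x => ?_, fun x => ?_⟩
  · simp
  · simp

theorem siegelReducible_par {ι : Type*} (d : ι → Fin (p - 1) → ℝ) (b : ι → Fin (p - 1) → ℂ)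
    (y : ι → ℝ) (a : ι → ℝ) (hb : ∀ j, (∀ i, d i j = y i) ∨ ∀ i, b i j = 0)
    (hbb : ∀ i i', (star (b i) ⬝ᵥ b i').im = 0) :
    SiegelReducible fun i => siegelMatrix (diagonal fun j => I * d i j) (b i) (I * y i) (a i) := by
  classical
  obtain ⟨P, hP⟩ : ∃ P : Fin (p - 1) → Prop, ∀ j, P j ↔ ¬∀ i, d i j = y i := ⟨_, fun _ => Iff.rfl⟩
  obtain ⟨k, hk, e, hel, her⟩ := exists_equiv_card_le (p - 1) P
  have hbP : ∀ i (x : {j // P j}), b i x = 0 := fun i x => (hb x).resolve_left ((hP x).1 x.2) i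
  have hdP : ∀ i (x : {j // ¬P j}), d i x = y i := fun i x => (not_not.1 (mt (hP x).2 x.2)) i
  obtain ⟨f, -, hf, hfb⟩ := exists_orthonormal_im_eq_zero (n := {j // ¬P j}) isHermitian_one ⊤
    (fun i x => b i x) (r := Fintype.card {j // ¬P j}) (by simp) (fun _ => trivial)
    (fun i i' => by
      have h := hbb i i'
      rw [dotProduct, ← (Equiv.sumCompl P).sum_comp, Fintype.sum_sum_type] at h
      simpa [hbP, sesq, dotProduct] using h)
    (fun x _ hx => sesq_one_self_pos hx)
  let g := Fintype.equivFin {j // ¬P j}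
  set R := ofCols (f ∘ g) with hR
  have hRR : Rᴴ * R = 1 := by
    ext i j
    have := conjTranspose_ofCols_mul_mul 1 (f ∘ g) i j
    rw [Matrix.mul_one] at this
    rw [this, Function.comp_apply, Function.comp_apply, hf, Matrix.one_apply]
    simp only [g.apply_eq_iff_eq]
  set s := Equiv.sumCompl P with hs
  set U : Matrix (Fin (p - 1)) (Fin (p - 1)) ℂ :=
    (fromBlocks 1 0 0 R).submatrix s.symm e.symm with hU
  have hUU : Uᴴ * U = 1 := by
    rw [hU, conjTranspose_submatrix, submatrix_mul_equiv, fromBlocks_conjTranspose,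
      fromBlocks_multiply]
    simp [hRR]
  have hbU : ∀ i, b i = U *ᵥ (Uᴴ *ᵥ b i) := fun i => by
    rw [mulVec_mulVec, mul_eq_one_comm.1 hUU, one_mulVec]
  have hUl : ∀ i x, (Uᴴ *ᵥ b i) (e (Sum.inl x)) = 0 := by
    intro i x
    rw [mulVec, dotProduct, ← s.sum_comp, Fintype.sum_sum_type]
    simp [hU, hs, hbP]
  have hUr : ∀ i x, ((Uᴴ *ᵥ b i) (e (Sum.inr x))).im = 0 := by
    intro i x
    rw [← hfb (g x) i, mulVec, dotProduct, ← s.sum_comp, Fintype.sum_sum_type]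
    simp [hU, hs, hbP, hR, ofCols, sesq, dotProduct]
  have hjl : ∀ j : Fin (p - 1), (j : ℕ) < k → ∃ x, j = e (Sum.inl x) := by
    intro j hj
    obtain ⟨x | x, rfl⟩ := e.surjective j
    · exact ⟨x, rfl⟩
    · exact absurd hj (her x).not_gt
  have hjr : ∀ j : Fin (p - 1), k ≤ (j : ℕ) → ∃ x, j = e (Sum.inr x) := by
    intro j hj
    obtain ⟨x | x, rfl⟩ := e.surjective j
    · exact absurd (hel x) hj.not_gt
    · exact ⟨x, rfl⟩
  refine ⟨fromBlocks U 0 0 1, isometry_fromBlocks_unitary hUU, Or.inr ⟨k, hk, fun i => ?_⟩⟩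
  let d' : Fin (p - 1) → ℝ := fun j => d i (s (e.symm j))
  refine ⟨_, ⟨d', fun j => ((Uᴴ *ᵥ b i) j).re, y i, a i, rfl⟩, ?_⟩
  rw [siegelMatrix_mul_fromBlocks_unitary hUU
    (M' := diagonal fun j => if (j : ℕ) < k then I * d' j else I * y i) ?_ (hbU i)]
  · congr 1
    rw [siegelMatrix, parMatrix]
    congr 1
    · ext j l
      rw [of_apply, of_apply]
      by_cases hj : k ≤ (j : ℕ)
      · obtain ⟨x, rfl⟩ := hjr j hj
        simp only [hj, true_and]
        split_ifs
        · exact Complex.ext (by simp) (by simpa using hUr i x)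
        · rfl
      · obtain ⟨x, rfl⟩ := hjl j (not_le.1 hj)
        simp [hj, hUl]
    · ext l j
      rw [of_apply, of_apply]
      by_cases hj : k ≤ (j : ℕ)
      · obtain ⟨x, rfl⟩ := hjr j hj
        simp only [hj, true_and]
        split_ifs
        · congr 1
          exact Complex.ext (by simp) (by simpa using hUr i x)
        · rfl
      · obtain ⟨x, rfl⟩ := hjl j (not_le.1 hj)
        simp [hj, hUl]
    · simp
  · ext j l
    rw [diagonal_mul, mul_diagonal]
    obtain ⟨j, rfl⟩ := s.surjective j
    obtain ⟨l, rfl⟩ := e.surjective l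
    rcases j with j | j <;> rcases l with l | l
    · simp only [hU, submatrix_apply, Equiv.symm_apply_apply, fromBlocks_apply₁₁, hel, if_true, d']
      by_cases h : j = l
      · subst h; simp
      · simp [Matrix.one_apply_ne h]
    · simp [hU]
    · simp [hU]
    · simp only [hU, submatrix_apply, Equiv.symm_apply_apply, fromBlocks_apply₂₂,
        (her l).not_gt, if_false]
      rw [mul_comm]
      congr 3
      exact hdP i j

theorem siegelReducible_hyp {ι : Type*} (d : ι → Fin (p - 1) → ℝ) (z : ι → ℂ) (a : ι → ℝ)
    {i₀ : ι} (hz : (z i₀).re ≠ 0) (ha : ∀ i, (z i).re * a i₀ = (z i₀).re * a i) :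
    SiegelReducible fun i => siegelMatrix (diagonal fun j => I * d i j) 0 (z i) (a i) := by
  refine ⟨heisenberg 0 (-(a i₀ / (2 * (z i₀).re))), isometry_heisenberg _ _, Or.inl fun i =>
    ⟨_, ⟨d i, z i, rfl⟩, ?_⟩⟩
  have h1 : z i + starRingEnd ℂ (z i) = 2 * (z i).re := by rw [add_conj]; simp
  have h2 : (a i : ℂ) = 2 * (z i).re * (a i₀ / (2 * (z i₀).re)) := by
    have := ha i
    have hz' : ((z i₀).re : ℂ) ≠ 0 := by exact_mod_cast hz
    field_simp
    exact_mod_cast (mul_comm _ _).trans this.symm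
  beta_reduce
  rw [siegelMatrix, heisenberg, hypMatrix, fromBlocks_multiply, fromBlocks_multiply]
  congr 1
  · ext i j; simp [Matrix.mul_apply]
  · ext i j; simp [Matrix.mul_apply]
  · ext i j; fin_cases i <;> simp [vecHead, vecTail]
  · ext l j
    fin_cases l <;> fin_cases j <;> simp [Matrix.mul_apply]
    rw [h2]
    linear_combination (-(a i₀ / (2 * (z i₀).re) : ℂ)) * h1

end Siegel

section SiegelReduction

variable {p : ℕ}

theorem siegelMatrix_mulVec_single (M : Matrix (Fin (p - 1)) (Fin (p - 1)) ℂ)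
    (b : Fin (p - 1) → ℂ) (z : ℂ) (a : ℝ) :
    siegelMatrix M b z a *ᵥ Pi.single (Sum.inr 0) 1 = z • Pi.single (Sum.inr 0) 1 := by
  ext i
  rcases i with i | i
  · simp [siegelMatrix]
  · fin_cases i <;> simp [siegelMatrix]

theorem heisenberg_mulVec_single (c : Fin (p - 1) → ℂ) (s : ℝ) :
    heisenberg c s *ᵥ Pi.single (Sum.inr 0) 1 = Pi.single (Sum.inr 0) 1 := by
  ext i
  rcases i with i | i
  · simp [heisenberg]
  · fin_cases i <;> simp [heisenberg]

theorem exists_siegelMatrix_mul_heisenberg {M : Matrix (Fin (p - 1)) (Fin (p - 1)) ℂ}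
    {b : Fin (p - 1) → ℂ} {z : ℂ} {a : ℝ} (hX : siegelMatrix M b z a ∈ uForm (formK p))
    (c : Fin (p - 1) → ℂ) :
    ∃ b' a', (∀ j, b' j = b j + (M *ᵥ c) j + star z * c j) ∧
      siegelMatrix M b z a * heisenberg c 0 = heisenberg c 0 * siegelMatrix M b' z a' := by
  have hQ := isometry_heisenberg c 0
  have hu := isUnit_of_conjTranspose_mul_mul (isUnit_formK p) hQ
  have hdet := (isUnit_iff_isUnit_det _).1 hu
  have hXY := mul_eq_mul_inv_mul hu (siegelMatrix M b z a)
  set Y := (heisenberg c 0)⁻¹ * siegelMatrix M b z a * heisenberg c 0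
  have hz : Y *ᵥ Pi.single (Sum.inr 0) 1 = z • Pi.single (Sum.inr 0) 1 := by
    have hinv : (heisenberg c 0)⁻¹ *ᵥ (Pi.single (Sum.inr 0) 1 : Idx p → ℂ) =
        Pi.single (Sum.inr 0) 1 := by
      conv_lhs => rw [← heisenberg_mulVec_single c 0]
      rw [mulVec_mulVec, nonsing_inv_mul _ hdet, one_mulVec]
    rw [← mulVec_mulVec, heisenberg_mulVec_single, ← mulVec_mulVec, siegelMatrix_mulVec_single,
      mulVec_smul, hinv]
  obtain ⟨M', -, b', a', hY⟩ := exists_eq_siegelMatrix (mem_uForm_of_mul_eq hQ hX hXY) hz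
  refine ⟨b', a', ?_⟩
  rw [hY] at hXY
  have h := hXY
  rw [siegelMatrix, siegelMatrix, heisenberg, fromBlocks_multiply, fromBlocks_multiply,
    fromBlocks_inj] at h
  obtain ⟨h1, h2, -, -⟩ := h
  have hM : M' = M := by
    ext i j
    have := congrFun₂ h1 i j
    simpa [Matrix.mul_apply] using this.symm
  refine ⟨fun j => ?_, by rw [hXY, hM]⟩
  · have := congrFun₂ h2 j 1
    simp [Matrix.mul_apply] at this
    simp [mulVec, dotProduct]
    linear_combination -this

theorem siegelReducible_diagonal {ι : Type*} (d : ι → Fin (p - 1) → ℝ)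
    (b : ι → Fin (p - 1) → ℂ) (z : ι → ℂ) (a : ι → ℝ)
    (hX : ∀ i, siegelMatrix (diagonal fun j => I * d i j) (b i) (z i) (a i) ∈ uForm (formK p))
    (hc : ∀ i i', siegelMatrix (diagonal fun j => I * d i j) (b i) (z i) (a i) *
        siegelMatrix (diagonal fun j => I * d i' j) (b i') (z i') (a i') =
      siegelMatrix (diagonal fun j => I * d i' j) (b i') (z i') (a i') *
        siegelMatrix (diagonal fun j => I * d i j) (b i) (z i) (a i)) :
    SiegelReducible fun i => siegelMatrix (diagonal fun j => I * d i j) (b i) (z i) (a i) := by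
  have hb : ∀ j, ∃ c : ℂ, (∀ i, I * d i j + star (z i) = 0) ∨
      ∀ i, b i j + I * d i j * c + star (z i) * c = 0 := by
    intro j
    by_cases h : ∀ i, I * d i j + star (z i) = 0
    · exact ⟨0, Or.inl h⟩
    · push Not at h
      obtain ⟨i₀, h₀⟩ := h
      refine ⟨-(b i₀ j / (I * d i₀ j + star (z i₀))), Or.inr fun i => ?_⟩
      have := (siegelMatrix_commute (hc i₀ i)).2.1 j
      rw [mulVec_diagonal, mulVec_diagonal] at this
      field_simp
      linear_combination this
  choose c hcb using hb
  choose b' a' hb' ha' using fun i => exists_siegelMatrix_mul_heisenberg (hX i) c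
  have hb'' : ∀ j, (∀ i, I * d i j + star (z i) = 0) ∨ ∀ i, b' i j = 0 := fun j =>
    (hcb j).imp_right fun h i => by rw [← h i, hb', mulVec_diagonal]
  refine SiegelReducible.of_mul_eq (Q := heisenberg c 0) ?_ (isometry_heisenberg c 0) ha'
  have hu := isUnit_of_conjTranspose_mul_mul (isUnit_formK p) (isometry_heisenberg c 0)
  have hcomm := fun i i' =>
    (siegelMatrix_commute (commute_of_mul_eq hu (ha' i) (ha' i') (hc i i'))).2.2
  by_cases hz : ∀ i, (z i).re = 0
  · have hzy : ∀ i, z i = I * ((z i).im : ℝ) := fun i =>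
      Complex.ext (by simp [hz]) (by simp)
    have hpar := siegelReducible_par d b' (fun i => (z i).im) a'
      (fun j => (hb'' j).imp_left fun h i => by
        have := congrArg im (h i)
        simp at this
        linarith)
      (fun i i' => by
        have h := hcomm i i'
        have hs : star (b' i') ⬝ᵥ b' i = star (star (b' i) ⬝ᵥ b' i') := by
          simp [dotProduct, mul_comm]
        rw [hs, hzy i, hzy i'] at h
        have := congrArg re h
        simp at this
        linarith)
    simpa only [← hzy] using hpar
  · push Not at hz
    obtain ⟨i₀, h₀⟩ := hz
    have hb0 : ∀ i, b' i = 0 := fun i => by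
      ext j
      refine (hb'' j).resolve_left (fun h => h₀ ?_) i
      simpa using congrArg re (h i₀)
    simp only [hb0]
    refine siegelReducible_hyp d z a' h₀ fun i => ?_
    have h := congrArg re (hcomm i i₀)
    simp [hb0] at h
    linarith

theorem siegelReducible_siegelMatrix {ι : Type*}
    (M : ι → Matrix (Fin (p - 1)) (Fin (p - 1)) ℂ) (b : ι → Fin (p - 1) → ℂ) (z : ι → ℂ)
    (a : ι → ℝ) (hM : ∀ i, M i ∈ uForm (1 : Matrix (Fin (p - 1)) (Fin (p - 1)) ℂ))
    (hX : ∀ i, siegelMatrix (M i) (b i) (z i) (a i) ∈ uForm (formK p))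
    (hc : ∀ i i', siegelMatrix (M i) (b i) (z i) (a i) *
        siegelMatrix (M i') (b i') (z i') (a i') =
      siegelMatrix (M i') (b i') (z i') (a i') * siegelMatrix (M i) (b i) (z i) (a i)) :
    SiegelReducible fun i => siegelMatrix (M i) (b i) (z i) (a i) := by
  obtain ⟨U, hU, d, hd⟩ := exists_unitary_diagonalizing hM
    fun i i' => (siegelMatrix_commute (hc i i')).1
  have hXY := fun i => siegelMatrix_mul_fromBlocks_unitary hU (hd i) (b := b i) (b' := Uᴴ *ᵥ b i)
    (by rw [mulVec_mulVec, mul_eq_one_comm.1 hU, one_mulVec]) (z i) (a i)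
  have hQ := isometry_fromBlocks_unitary hU
  have hu := isUnit_of_conjTranspose_mul_mul (isUnit_formK p) hQ
  exact (siegelReducible_diagonal d _ z a (fun i => mem_uForm_of_mul_eq hQ (hX i) (hXY i))
    fun i i' => commute_of_mul_eq hu (hXY i) (hXY i') (hc i i')).of_mul_eq hQ hXY

end SiegelReduction

section Lorentz

variable {p : ℕ}

theorem sesq_formJ_self_re_pos {x : Idx p → ℂ} (hx : x ≠ 0) (h : x (Sum.inr 1) = 0) :
    0 < (sesq (formJ p) x x).re := by
  have key : (sesq (formJ p) x x).re = ∑ j, normSq (x j) := by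
    rw [sesq, dotProduct]
    simp [formJ, mulVec, dotProduct, Matrix.one_apply, h, ← normSq_eq_conj_mul_self]
  rw [key]
  obtain ⟨j, hj⟩ := Function.ne_iff.1 hx
  exact Finset.sum_pos' (fun _ _ => normSq_nonneg _) ⟨j, Finset.mem_univ _, normSq_pos.2 hj⟩

theorem exists_smul_of_nonpos_formJ {v y : Idx p → ℂ} (hv0 : v ≠ 0)
    (hv : (sesq (formJ p) v v).re ≤ 0) (hy : (sesq (formJ p) y y).re ≤ 0)
    (hvy : sesq (formJ p) v y = 0) : ∃ c : ℂ, y = c • v :=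
  exists_smul_of_nonpos (isHermitian_formJ p) (LinearMap.proj (Sum.inr 1))
    (fun _ hx h => sesq_formJ_self_re_pos hx h) hv0 hv hy hvy

theorem card_idx (hp : 1 ≤ p) : Fintype.card (Idx p) = p + 1 := by
  simp; omega

/-- Commuting elements of `𝔲(p,1)` with a common negative eigenvector are simultaneously
diagonalizable. -/
theorem exists_diagonalizing_of_neg (hp : 1 ≤ p) {ι : Type*} {X : ι → Matrix (Idx p) (Idx p) ℂ}
    (hXS : ∀ i, X i ∈ uPOne p) (hX : ∀ i j, X i * X j = X j * X i) {v : Idx p → ℂ}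
    (hv : (sesq (formJ p) v v).re < 0) (hvX : ∀ i, ∃ c : ℂ, X i *ᵥ v = c • v) :
    ∃ P : Matrix (Idx p) (Idx p) ℂ, Pᴴ * formJ p * P = formJ p ∧
      ∀ i, ∃ Y ∈ diagIn (uPOne p), X i * P = P * Y := by
  have hJ := isHermitian_formJ p
  have hvv : sesq (formJ p) v v ≠ 0 := fun h => by simp [h] at hv
  obtain ⟨c, hc0, hc⟩ := exists_smul_sesq_self_eq_one (S := -formJ p) hJ.neg (v := v)
    (by simpa [sesq, neg_mulVec] using hv)
  have hfr := finrank_inf_ker_add_one ⊤ (sesqDual (formJ p) v) (u := v) trivial hvv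
  rw [finrank_top, Module.finrank_fintype_fun_eq_card, card_idx hp] at hfr
  obtain ⟨e, heW, he, heX⟩ := exists_orthonormal_eigenvectors hJ hXS hX (r := p)
    (⊤ ⊓ LinearMap.ker (sesqDual (formJ p) v)) (by omega)
    (fun i => mulVec_mem_inf_ker_sesqDual (hXS i) (fun _ _ => Submodule.mem_top) (hvX i))
    (fun x hx hx0 => by
      by_contra hneg
      obtain ⟨d, rfl⟩ := exists_smul_of_nonpos_formJ (y := x) (by rintro rfl; simp [sesq] at hv)
        hv.le (not_lt.1 hneg) hx.2
      have : sesq (formJ p) v (d • v) = 0 := hx.2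
      rw [sesq_smul_right, mul_eq_zero, or_iff_left hvv] at this
      exact hx0 (by rw [this, zero_smul]))
  obtain ⟨g⟩ : Nonempty ({j : Idx p // j ≠ Sum.inr 1} ≃ Fin p) := by
    rw [← Fintype.card_eq, Fintype.card_subtype_compl, card_idx hp]
    simp
  have hve : ∀ a, sesq (formJ p) v (e a) = 0 := fun a => (heW a).2
  have hev : ∀ a, sesq (formJ p) (e a) v = 0 := fun a => by rw [← star_sesq hJ, hve, star_zero]
  let f : Idx p → Idx p → ℂ := fun j => if h : j = Sum.inr 1 then c • v else e (g ⟨j, h⟩)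
  have hf : ∀ j, ∀ h : j ≠ Sum.inr 1, f j = e (g ⟨j, h⟩) := fun j h => dif_neg h
  have hf' : f (Sum.inr 1) = c • v := dif_pos rfl
  have hP : (ofCols f)ᴴ * formJ p * ofCols f = formJ p := by
    have hdiag : formJ p = diagonal fun j => if j = Sum.inr 1 then -1 else 1 := by
      ext i j
      rcases i with i | i <;> rcases j with j | j
      · simp [formJ, Matrix.one_apply, diagonal_apply]
      · simp [formJ]
      · simp [formJ]
      · fin_cases i <;> fin_cases j <;> simp [formJ]
    ext i j
    rw [conjTranspose_ofCols_mul_mul]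
    conv_rhs => rw [hdiag, diagonal_apply]
    by_cases hi : i = Sum.inr 1 <;> by_cases hj : j = Sum.inr 1
    · subst hi; subst hj
      rw [hf', if_pos rfl, if_pos rfl]
      simpa [sesq, neg_mulVec, neg_eq_iff_eq_neg] using hc
    · subst hi
      rw [hf', hf j hj, sesq_smul_left, hve, mul_zero, if_neg (Ne.symm hj)]
    · subst hj
      rw [hf', hf i hi, sesq_smul_right, hev, mul_zero, if_neg hi]
    · rw [hf i hi, hf j hj, he, if_neg hi]
      simp
  refine ⟨ofCols f, hP, fun i => ?_⟩
  have hfX : ∀ j, ∃ d : ℂ, X i *ᵥ f j = d • f j := by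
    intro j
    by_cases hj : j = Sum.inr 1
    · subst hj
      obtain ⟨d, hd⟩ := hvX i
      exact ⟨d, by rw [hf', mulVec_smul, hd, smul_comm]⟩
    · rw [hf j hj]
      exact heX _ i
  choose d hd using hfX
  have hXP := mul_ofCols_eq_mul_diagonal hd
  exact ⟨diagonal d, ⟨mem_uForm_of_mul_eq hP (hXS i) hXP, isDiag_diagonal d⟩, hXP⟩

/-- A null vector is the `p`-th vector of a basis adapted to the Siegel domain. -/
theorem exists_siegel_basis (hp : 1 ≤ p) {v : Idx p → ℂ} (hv0 : v ≠ 0)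
    (hv : sesq (formJ p) v v = 0) :
    ∃ P : Matrix (Idx p) (Idx p) ℂ, Pᴴ * formJ p * P = (1 / 2 : ℂ) • formK p ∧
      P *ᵥ Pi.single (Sum.inr 0) 1 = v := by
  have hJ := isHermitian_formJ p
  obtain ⟨w, hvw, hww⟩ : ∃ w, sesq (formJ p) v w = -I / 2 ∧ sesq (formJ p) w w = 0 := by
    obtain ⟨w₀, h₀⟩ : ∃ w₀, sesq (formJ p) v w₀ ≠ 0 := by
      refine ⟨formJ p *ᵥ v, ?_⟩
      rw [sesq, mulVec_mulVec, formJ_mul_formJ, one_mulVec]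
      intro h
      have := sesq_one_self_pos hv0
      simp [sesq, h] at this
    obtain ⟨w₁, hw₁⟩ : ∃ w₁, w₁ = ((-I / 2) / sesq (formJ p) v w₀) • w₀ := ⟨_, rfl⟩
    have h₁ : sesq (formJ p) v w₁ = -I / 2 := by
      rw [hw₁, sesq_smul_right, div_mul_cancel₀ _ h₀]
    have h₁' : sesq (formJ p) w₁ v = I / 2 := by
      rw [← star_sesq hJ, h₁]; simp
    refine ⟨w₁ + (I * (sesq (formJ p) w₁ w₁).re) • v, ?_, ?_⟩
    · rw [sesq_add_right, sesq_smul_right, hv, h₁, mul_zero, add_zero]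
    · rw [sesq_add_right, sesq_add_left, sesq_add_left, sesq_smul_right, sesq_smul_left,
        sesq_smul_left, sesq_smul_right, hv, h₁, h₁']
      conv_lhs => rw [sesq_self_eq_re hJ w₁]
      simp
      linear_combination (sesq (formJ p) w₁ w₁).re * I_mul_I
  have hwv : sesq (formJ p) w v = I / 2 := by rw [← star_sesq hJ, hvw]; simp
  have hI : I / 2 ≠ 0 := by simp
  have hfr := finrank_inf_ker_add_one ⊤ (sesqDual (formJ p) v) (u := w) trivial
    (by rw [sesqDual_apply, hvw, neg_div]; exact neg_ne_zero.2 hI)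
  have hfr' := finrank_inf_ker_add_one (⊤ ⊓ LinearMap.ker (sesqDual (formJ p) v))
    (sesqDual (formJ p) w) (u := v) ⟨trivial, hv⟩ (by rw [sesqDual_apply, hwv]; exact hI)
  rw [finrank_top, Module.finrank_fintype_fun_eq_card, card_idx hp] at hfr
  obtain ⟨e, heW, he, -⟩ := exists_orthonormal_eigenvectors (ι := Empty) (X := Empty.elim) hJ
    (fun i => i.elim) (fun i => i.elim) (r := p - 1) _ (by omega) (fun i => i.elim)
    (fun x (hx : x ∈ ⊤ ⊓ LinearMap.ker (sesqDual (formJ p) v) ⊓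
        LinearMap.ker (sesqDual (formJ p) w)) hx0 => by
      by_contra hneg
      obtain ⟨d, rfl⟩ := exists_smul_of_nonpos_formJ (y := x) hv0 (by simp [hv])
        (not_lt.1 hneg) hx.1.2
      have : sesq (formJ p) w (d • v) = 0 := hx.2
      rw [sesq_smul_right, mul_eq_zero, hwv, or_iff_left hI] at this
      exact hx0 (by rw [this, zero_smul]))
  have hve : ∀ a, sesq (formJ p) v (e a) = 0 := fun a => (heW a).1.2
  have hev : ∀ a, sesq (formJ p) (e a) v = 0 := fun a => by rw [← star_sesq hJ, hve, star_zero]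
  have hwe : ∀ a, sesq (formJ p) w (e a) = 0 := fun a => (heW a).2
  have hew : ∀ a, sesq (formJ p) (e a) w = 0 := fun a => by rw [← star_sesq hJ, hwe, star_zero]
  refine ⟨ofCols (Sum.elim e ![v, w]), ?_, ?_⟩
  · ext i j
    rw [conjTranspose_ofCols_mul_mul]
    rcases i with i | i <;> rcases j with j | j
    · simp [he, formK, Matrix.one_apply]
    · fin_cases j <;> simp [hev, hew, formK]
    · fin_cases i <;> simp [hve, hwe, formK]
    · fin_cases i <;> fin_cases j <;> simp [hv, hvw, hwv, hww, formK] <;> ring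
  · ext i
    simp [ofCols]

/-- Commuting elements of `𝔲(p,1)` are simultaneously conjugate to elements of one of the
models. -/
theorem exists_isometry_into_model (hp : 1 ≤ p) {ι : Type*} {X : ι → Matrix (Idx p) (Idx p) ℂ}
    (hXS : ∀ i, X i ∈ uPOne p) (hX : ∀ i j, X i * X j = X j * X i) :
    ∃ P : Matrix (Idx p) (Idx p) ℂ, Pᴴ * formJ p * P = formJ p ∧
      ∃ t, ∀ i, ∃ Y ∈ modelAlg p t, X i * P = P * Y := by
  have hJ := isHermitian_formJ p
  obtain ⟨v, -, hv0, hv, hvX⟩ := exists_common_eigenvector_nonpos hJ hXS hX ⊤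
    (fun _ _ _ => trivial) ⟨Pi.single (Sum.inr 1) 1, trivial, by simp, by simp [sesq, formJ]⟩
  rcases hv.lt_or_eq with hneg | hnull
  · obtain ⟨P, hP, h⟩ := exists_diagonalizing_of_neg hp hXS hX hneg hvX
    exact ⟨P, hP, .quasiElliptic, h⟩
  · obtain ⟨P, hP, hPv⟩ := exists_siegel_basis hp hv0
      (by rw [sesq_self_eq_re hJ, hnull, ofReal_zero])
    have hT : IsUnit ((1 / 2 : ℂ) • formK p) := by
      rw [isUnit_iff_isUnit_det, det_smul]
      exact ((by simp : IsUnit (1 / 2 : ℂ)).pow _).mul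
        ((isUnit_iff_isUnit_det _).1 (isUnit_formK p))
    have hu := isUnit_of_conjTranspose_mul_mul hT hP
    have hXY := fun i => mul_eq_mul_inv_mul hu (X i)
    set Y := fun i => P⁻¹ * X i * P with hY
    have hYK : ∀ i, Y i ∈ uForm (formK p) := fun i =>
      (mem_uForm_smul (by norm_num)).1 (mem_uForm_of_mul_eq hP (hXS i) (hXY i))
    choose z hz using hvX
    have hYz : ∀ i, Y i *ᵥ Pi.single (Sum.inr 0) 1 = z i • Pi.single (Sum.inr 0) 1 := by
      intro i
      have hinv : P⁻¹ *ᵥ v = Pi.single (Sum.inr 0) 1 := by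
        rw [← hPv, mulVec_mulVec, nonsing_inv_mul _ ((isUnit_iff_isUnit_det _).1 hu), one_mulVec]
      rw [hY, ← mulVec_mulVec, hPv, ← mulVec_mulVec, hz, mulVec_smul, hinv]
    choose M hM b a hYM using fun i => exists_eq_siegelMatrix (hYK i) (hYz i)
    have hYc : ∀ i j, Y i * Y j = Y j * Y i := fun i j =>
      commute_of_mul_eq hu (hXY i) (hXY j) (hX i j)
    have hred : SiegelReducible Y := by
      have := siegelReducible_siegelMatrix M b z a hM (fun i => hYM i ▸ hYK i)
        (fun i j => by rw [← hYM, ← hYM, hYc])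
      simpa only [← hYM] using this
    obtain ⟨Q, hQ, hred⟩ := hred
    have hiso : (P * Q * cayley p)ᴴ * formJ p * (P * Q * cayley p) = formJ p := by
      calc _ = (cayley p)ᴴ * (Qᴴ * (Pᴴ * formJ p * P) * Q) * cayley p := by
            simp only [conjTranspose_mul, Matrix.mul_assoc]
        _ = formJ p := by
            rw [hP, Matrix.mul_smul, Matrix.smul_mul, hQ, Matrix.mul_smul, Matrix.smul_mul,
              cayley_form, smul_smul]
            norm_num
    have hdet := isUnit_det_of_left_inverse (cayley_inv_mul p)
    have key : ∀ A : LieSubalgebra ℝ (Matrix (Idx p) (Idx p) ℂ), (∀ i, ∃ Z ∈ A, Y i * Q = Q * Z) →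
        ∀ i, ∃ Z ∈ cayleyConj p A, X i * (P * Q * cayley p) = P * Q * cayley p * Z := by
      intro A hA i
      obtain ⟨Z, hZ, h⟩ := hA i
      have e1 : cayley p * ((cayley p)⁻¹ * Z * cayley p) = Z * cayley p := by
        rw [Matrix.mul_assoc, mul_nonsing_inv_cancel_left _ _ hdet]
      refine ⟨(cayley p)⁻¹ * Z * cayley p, ?_, ?_⟩
      · change cayley p * ((cayley p)⁻¹ * Z * cayley p) * (cayley p)⁻¹ ∈ A
        rwa [e1, mul_nonsing_inv_cancel_right _ _ hdet]
      · rw [Matrix.mul_assoc (P * Q), e1, ← Matrix.mul_assoc, ← Matrix.mul_assoc, hXY,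
          Matrix.mul_assoc P, h, Matrix.mul_assoc, Matrix.mul_assoc, Matrix.mul_assoc]
    refine ⟨P * Q * cayley p, hiso, ?_⟩
    rcases hred with h | ⟨k, hk, h⟩
    · exact ⟨.quasiHyperbolic, key _ h⟩
    · rcases Nat.eq_zero_or_pos k with rfl | hk0
      · exact ⟨.nilpotent, key _ h⟩
      · by_cases hkp : k = p - 1
        · subst hkp; exact ⟨.quasiParabolic, key _ h⟩
        · exact ⟨.quasiNilpotent k hk0 (by omega), key _ h⟩

end Lorentz

section MASA

variable {n : Type*} [Fintype n] [DecidableEq n]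

theorem isLieAbelian_iff_commute {h : LieSubalgebra ℝ (Matrix n n ℂ)} :
    IsLieAbelian h ↔ ∀ X ∈ h, ∀ Y ∈ h, X * Y = Y * X := by
  constructor
  · intro ha X hX Y hY
    have := congrArg Subtype.val (ha.trivial ⟨X, hX⟩ ⟨Y, hY⟩)
    rw [LieSubalgebra.coe_bracket, Ring.lie_def] at this
    exact sub_eq_zero.1 this
  · refine fun hc => ⟨fun X Y => Subtype.ext ?_⟩
    rw [LieSubalgebra.coe_bracket, Ring.lie_def, hc _ X.2 _ Y.2, sub_self]
    rfl

/-- A maximal Abelian subalgebra is an Abelian subalgebra which contains its centralizer. -/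
theorem isMASA_iff {g h : LieSubalgebra ℝ (Matrix n n ℂ)} :
    IsMASA g h ↔ h ≤ g ∧ (∀ X ∈ h, ∀ Y ∈ h, X * Y = Y * X) ∧
      ∀ X ∈ g, (∀ Y ∈ h, X * Y = Y * X) → X ∈ h := by
  constructor
  · rintro ⟨⟨hg, ha⟩, hmax⟩
    rw [isLieAbelian_iff_commute] at ha
    refine ⟨hg, ha, fun X hX hXh => ?_⟩
    have hc : ∀ Y ∈ h, ∀ Z ∈ h, ∀ a b : ℝ,
        (Y + a • X) * (Z + b • X) = (Z + b • X) * (Y + a • X) := by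
      intro Y hY Z hZ a b
      have h1 : Commute Y Z := ha Y hY Z hZ
      have h2 : Commute X Y := hXh Y hY
      have h3 : Commute X Z := hXh Z hZ
      exact ((h1.add_left (h3.smul_left a)).add_right
        ((h2.symm.smul_right b).add_left (((Commute.refl X).smul_left a).smul_right b))).eq
    let k : LieSubalgebra ℝ (Matrix n n ℂ) :=
      { carrier := {U | ∃ Y ∈ h, ∃ a : ℝ, U = Y + a • X}
        zero_mem' := ⟨0, h.zero_mem, 0, by simp⟩
        add_mem' := by
          rintro _ _ ⟨Y, hY, a, rfl⟩ ⟨Z, hZ, b, rfl⟩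
          exact ⟨Y + Z, h.add_mem hY hZ, a + b, by rw [add_smul, add_add_add_comm]⟩
        smul_mem' := by
          rintro c _ ⟨Y, hY, a, rfl⟩
          exact ⟨c • Y, h.smul_mem c hY, c * a, by rw [smul_add, mul_smul]⟩
        lie_mem' := by
          rintro _ _ ⟨Y, hY, a, rfl⟩ ⟨Z, hZ, b, rfl⟩
          exact ⟨0, h.zero_mem, 0, by rw [Ring.lie_def, hc Y hY Z hZ, sub_self]; simp⟩ }
    have hle : h ≤ k := fun U hU => ⟨U, hU, 0, by simp⟩
    refine hmax (y := k) ⟨?_, ?_⟩ hle ⟨0, h.zero_mem, 1, by simp⟩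
    · rintro _ ⟨Y, hY, a, rfl⟩
      exact g.add_mem (hg hY) (g.smul_mem a hX)
    · rw [isLieAbelian_iff_commute]
      rintro _ ⟨Y, hY, a, rfl⟩ _ ⟨Z, hZ, b, rfl⟩
      exact hc Y hY Z hZ a b
  · rintro ⟨hg, ha, hmax⟩
    refine ⟨⟨hg, isLieAbelian_iff_commute.2 ha⟩, fun k ⟨hk, hka⟩ hle X hX => hmax X (hk hX) ?_⟩
    exact fun Y hY => isLieAbelian_iff_commute.1 hka X hX Y (hle hY)

theorem IsMASA.of_conj {g h g' h' : LieSubalgebra ℝ (Matrix n n ℂ)} {P : Matrix n n ℂ}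
    (hP : IsUnit P) (hg : ∀ X, X ∈ g ↔ P * X * P⁻¹ ∈ g') (hh : ∀ X, X ∈ h ↔ P * X * P⁻¹ ∈ h')
    (hM : IsMASA g' h') : IsMASA g h := by
  have hl : P⁻¹ * P = 1 := nonsing_inv_mul _ ((isUnit_iff_isUnit_det _).1 hP)
  have hr : P * P⁻¹ = 1 := mul_nonsing_inv _ ((isUnit_iff_isUnit_det _).1 hP)
  have hmul : ∀ X Y, P * X * P⁻¹ * (P * Y * P⁻¹) = P * (X * Y) * P⁻¹ := by
    intro X Y
    calc _ = P * X * (P⁻¹ * P) * Y * P⁻¹ := by simp only [Matrix.mul_assoc]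
      _ = _ := by rw [hl, Matrix.mul_one, Matrix.mul_assoc P X Y]
  have hinj : ∀ X Y, P * X * P⁻¹ = P * Y * P⁻¹ → X = Y := by
    intro X Y h
    have := congrArg (fun Z => P⁻¹ * Z * P) h
    simpa only [← Matrix.mul_assoc, hl, Matrix.one_mul, Matrix.mul_assoc _ P⁻¹ P, Matrix.mul_one]
      using this
  have hsurj : ∀ Y, P * (P⁻¹ * Y * P) * P⁻¹ = Y := by
    intro Y
    rw [← Matrix.mul_assoc, ← Matrix.mul_assoc, hr, Matrix.one_mul, Matrix.mul_assoc, hr,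
      Matrix.mul_one]
  rw [isMASA_iff] at hM ⊢
  obtain ⟨h1, h2, h3⟩ := hM
  refine ⟨fun X hX => (hg X).2 (h1 ((hh X).1 hX)), fun X hX Y hY => hinj _ _ ?_,
    fun X hX hXh => (hh X).2 (h3 _ ((hg X).1 hX) fun Y hY => ?_)⟩
  · rw [← hmul, ← hmul, h2 _ ((hh X).1 hX) _ ((hh Y).1 hY)]
  · rw [← hsurj Y, hmul, hmul, hXh _ ((hh _).2 (by rwa [hsurj]))]

theorem isDiag_of_commute_diagonal {X : Matrix n n ℂ} {c : n → ℂ} (hc : Function.Injective c)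
    (h : X * diagonal c = diagonal c * X) : X.IsDiag := by
  intro i j hij
  have := congrFun₂ h i j
  rw [mul_diagonal, diagonal_mul, mul_comm, ← sub_eq_zero, ← sub_mul, mul_eq_zero] at this
  exact this.resolve_left (sub_ne_zero.2 fun h => hij (hc h).symm)

theorem isDiag_commute {X Y : Matrix n n ℂ} (hX : X.IsDiag) (hY : Y.IsDiag) : X * Y = Y * X := by
  rw [← hX.diagonal_diag, ← hY.diagonal_diag, diagonal_mul_diagonal, diagonal_mul_diagonal]
  simp_rw [mul_comm]

theorem isMASA_diagIn (s : n → ℂ) :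
    IsMASA (uForm (diagonal s)) (diagIn (uForm (diagonal s))) := by
  refine isMASA_iff.2 ⟨fun X hX => hX.1, fun X hX Y hY => isDiag_commute hX.2 hY.2,
    fun X hX h => ⟨hX, ?_⟩⟩
  let c : n → ℂ := fun j => I * ((Fintype.equivFin n j : ℕ) : ℝ)
  have hc : Function.Injective c := by
    intro i j hij
    simpa [c, Fin.val_inj] using hij
  refine isDiag_of_commute_diagonal hc (h _ ⟨?_, isDiag_diagonal c⟩)
  change (diagonal c)ᴴ * diagonal s + diagonal s * diagonal c = 0
  rw [diagonal_conjTranspose, diagonal_mul_diagonal, diagonal_mul_diagonal, diagonal_add]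
  ext i j
  simp [diagonal_apply, c, mul_comm]

theorem formJ_eq_diagonal (p : ℕ) : formJ p = diagonal (Sum.elim 1 ![1, -1]) := by
  ext i j
  rcases i with i | i <;> rcases j with j | j
  · simp [formJ, Matrix.one_apply, diagonal_apply]
  · simp [formJ]
  · simp [formJ]
  · fin_cases i <;> fin_cases j <;> simp [formJ]

theorem isMASA_diagIn_uPOne (p : ℕ) : IsMASA (uPOne p) (diagIn (uPOne p)) := by
  rw [uPOne, formJ_eq_diagonal]
  exact isMASA_diagIn _

theorem isMASA_diagIn_uQ (q : ℕ) : IsMASA (uQ q) (diagIn (uQ q)) := by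
  rw [uQ, ← diagonal_one]
  exact isMASA_diagIn _

end MASA

section Models

variable {p : ℕ}

theorem isUnit_cayley (p : ℕ) : IsUnit (cayley p) :=
  (isUnit_iff_isUnit_det _).2 (isUnit_det_of_left_inverse (cayley_inv_mul p))

theorem cayley_mul_inv (p : ℕ) : cayley p * (cayley p)⁻¹ = 1 :=
  mul_nonsing_inv _ ((isUnit_iff_isUnit_det _).1 (isUnit_cayley p))

theorem mem_uPOne_iff_cayley (X : Matrix (Idx p) (Idx p) ℂ) :
    X ∈ uPOne p ↔ cayley p * X * (cayley p)⁻¹ ∈ uForm (formK p) := by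
  constructor
  · intro hX
    have hX' : X ∈ uForm ((2 : ℂ) • formJ p) := (mem_uForm_smul two_ne_zero).2 hX
    refine mem_uForm_of_mul_eq (P := (cayley p)⁻¹) ?_ hX' ?_
    · rw [← cayley_form]
      calc ((cayley p)⁻¹)ᴴ * ((cayley p)ᴴ * formK p * cayley p) * (cayley p)⁻¹
          = (cayley p * (cayley p)⁻¹)ᴴ * formK p * (cayley p * (cayley p)⁻¹) := by
            simp only [conjTranspose_mul, Matrix.mul_assoc]
        _ = _ := by rw [cayley_mul_inv, conjTranspose_one, Matrix.one_mul, Matrix.mul_one]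
    · rw [← Matrix.mul_assoc, ← Matrix.mul_assoc, cayley_inv_mul, Matrix.one_mul]
  · intro hX
    refine (mem_uForm_smul (two_ne_zero)).1 (mem_uForm_of_mul_eq (cayley_form p) hX ?_)
    rw [Matrix.mul_assoc, cayley_inv_mul, Matrix.mul_one]

theorem isMASA_cayleyConj {A : LieSubalgebra ℝ (Matrix (Idx p) (Idx p) ℂ)}
    (hA : IsMASA (uForm (formK p)) A) : IsMASA (uPOne p) (cayleyConj p A) :=
  hA.of_conj (isUnit_cayley p) mem_uPOne_iff_cayley fun _ => Iff.rfl

theorem hypMatrix_eq_diagonal (d : Fin (p - 1) → ℝ) (z : ℂ) :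
    hypMatrix p d z = diagonal (Sum.elim (fun j => I * d j) ![z, -(starRingEnd ℂ z)]) := by
  ext i j
  rcases i with i | i <;> rcases j with j | j
  · simp [hypMatrix, diagonal_apply]
  · simp [hypMatrix]
  · simp [hypMatrix]
  · fin_cases i <;> fin_cases j <;> simp [hypMatrix]

theorem siegelMatrix_mem_uForm {M : Matrix (Fin (p - 1)) (Fin (p - 1)) ℂ}
    (hM : M ∈ uForm (1 : Matrix (Fin (p - 1)) (Fin (p - 1)) ℂ)) (b : Fin (p - 1) → ℂ) (z : ℂ)
    (a : ℝ) : siegelMatrix M b z a ∈ uForm (formK p) := by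
  have hM' : Mᴴ * 1 + 1 * M = 0 := hM
  rw [Matrix.mul_one, Matrix.one_mul] at hM'
  change _ + _ = _
  rw [siegelMatrix, formK, fromBlocks_conjTranspose, fromBlocks_multiply, fromBlocks_multiply,
    fromBlocks_add, ← fromBlocks_zero]
  congr 1
  · simp [← smul_add, hM']
  · ext i j
    fin_cases j <;> simp [Matrix.mul_apply]
    rw [conj_ofNat]
    linear_combination (2 * b i) * I_mul_I
  · ext i j
    fin_cases i <;> simp [vecHead, vecTail]
    linear_combination (2 * starRingEnd ℂ (b j)) * I_mul_I
  · ext i j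
    fin_cases i <;> fin_cases j <;> simp [Matrix.mul_apply, mul_comm]

theorem diagonal_I_mul_mem_uForm {n : Type*} [Fintype n] [DecidableEq n] (d : n → ℝ) :
    diagonal (fun j => I * (d j : ℂ)) ∈ uForm (1 : Matrix n n ℂ) := by
  change _ * 1 + 1 * _ = 0
  ext i j
  simp [diagonal_conjTranspose, diagonal_apply]
  split_ifs <;> simp

theorem hypMatrix_mem_uForm (d : Fin (p - 1) → ℝ) (z : ℂ) :
    hypMatrix p d z ∈ uForm (formK p) := by
  convert! siegelMatrix_mem_uForm (diagonal_I_mul_mem_uForm d) 0 z 0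
  rw [hypMatrix, siegelMatrix]
  congr 1
  · ext i j; simp
  · ext i j; simp

theorem isMASA_hypAlg (p : ℕ) : IsMASA (uForm (formK p)) (hypAlg p) := by
  refine isMASA_iff.2 ⟨?_, ?_, ?_⟩
  · rintro _ ⟨d, z, rfl⟩
    exact hypMatrix_mem_uForm d z
  · rintro _ ⟨d, z, rfl⟩ _ ⟨d', z', rfl⟩
    rw [hypMatrix_eq_diagonal, hypMatrix_eq_diagonal]
    exact isDiag_commute (isDiag_diagonal _) (isDiag_diagonal _)
  · intro X hX h
    have hdiag : X.IsDiag := by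
      have := h _ ⟨fun j : Fin (p - 1) => (j : ℕ) + 1, 1, rfl⟩
      rw [hypMatrix_eq_diagonal] at this
      refine isDiag_of_commute_diagonal ?_ this
      refine Function.Injective.sumElim (fun i j hij => ?_) (fun i j hij => ?_) fun i j hij => ?_
      · simpa [Fin.val_inj] using hij
      · revert hij
        fin_cases i <;> fin_cases j <;> norm_num [Complex.ext_iff]
      · have := congrArg re hij
        fin_cases j <;> simp at this
    obtain ⟨c, rfl⟩ : ∃ c, X = diagonal c := ⟨_, hdiag.diagonal_diag.symm⟩
    have hK : (diagonal c)ᴴ * formK p + formK p * diagonal c = 0 := hX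
    refine ⟨fun j => (c (Sum.inl j)).im, c (Sum.inr 0), ?_⟩
    rw [hypMatrix_eq_diagonal]
    congr 1
    ext j
    rcases j with j | j
    · have := congrArg re (congrFun₂ hK (Sum.inl j) (Sum.inl j))
      simp [formK, diagonal_conjTranspose] at this
      apply Complex.ext <;> simp
      linarith
    · fin_cases j
      · simp
      · have := congrFun₂ hK (Sum.inr 0) (Sum.inr 1)
        simp [formK, diagonal_conjTranspose] at this
        simp
        linear_combination I * this + (c (Sum.inr 1) + starRingEnd ℂ (c (Sum.inr 0))) * I_mul_I

theorem parMatrix_eq_siegelMatrix (k : ℕ) (d b : Fin (p - 1) → ℝ) (y a : ℝ) :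
    parMatrix p k d b y a = siegelMatrix
      (diagonal fun j => if (j : ℕ) < k then I * d j else I * y)
      (fun j => if k ≤ (j : ℕ) then (b j : ℂ) else 0) (I * y) a := by
  rw [parMatrix, siegelMatrix]
  congr 1
  · ext j l
    simp only [of_apply]
    split_ifs <;> first | rfl | tauto
  · ext l j
    simp only [of_apply]
    split_ifs <;> first | tauto | simp
  · simp

theorem parMatrix_mem_uForm (k : ℕ) (d b : Fin (p - 1) → ℝ) (y a : ℝ) :
    parMatrix p k d b y a ∈ uForm (formK p) := by
  rw [parMatrix_eq_siegelMatrix]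
  refine siegelMatrix_mem_uForm ?_ _ _ _
  convert diagonal_I_mul_mem_uForm (fun j : Fin (p - 1) => if (j : ℕ) < k then d j else y) using 3
  split_ifs <;> rfl

theorem siegelMatrix_diagonal_mul_comm {m m' : Fin (p - 1) → ℂ} {b b' : Fin (p - 1) → ℝ}
    {y y' : ℝ} {a a' : ℝ} (h : ∀ j, (m j = I * y ∧ m' j = I * y') ∨ (b j = 0 ∧ b' j = 0)) :
    siegelMatrix (diagonal m) (fun j => b j) (I * y) a *
        siegelMatrix (diagonal m') (fun j => b' j) (I * y') a' =
      siegelMatrix (diagonal m') (fun j => b' j) (I * y') a' *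
        siegelMatrix (diagonal m) (fun j => b j) (I * y) a := by
  rw [siegelMatrix, siegelMatrix, fromBlocks_multiply, fromBlocks_multiply]
  congr 1
  · congr 1
    · simp_rw [diagonal_mul_diagonal, mul_comm]
    · ext i j
      simp [Matrix.mul_apply]
  · ext i j
    rcases h i with ⟨h1, h2⟩ | ⟨h1, h2⟩ <;> fin_cases j <;>
      simp [h1, h2, Matrix.mul_apply, diagonal_apply] <;> ring
  · ext i j
    rcases h j with ⟨h1, h2⟩ | ⟨h1, h2⟩ <;> fin_cases i <;>
      simp [h1, h2, Matrix.mul_apply, diagonal_apply, vecHead, vecTail] <;> ring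
  · ext i j
    fin_cases i <;> fin_cases j <;> simp [Matrix.mul_apply]
    · ring
    · congr 1
      · exact Finset.sum_congr rfl fun x _ => by ring
      · ring
    · ring

theorem parMatrix_mul_comm (k : ℕ) (d b d' b' : Fin (p - 1) → ℝ) (y a y' a' : ℝ) :
    parMatrix p k d b y a * parMatrix p k d' b' y' a' =
      parMatrix p k d' b' y' a' * parMatrix p k d b y a := by
  have key : ∀ b : Fin (p - 1) → ℝ,
      (fun j : Fin (p - 1) => if k ≤ (j : ℕ) then ((b j : ℝ) : ℂ) else 0) =
        fun j : Fin (p - 1) => ((if k ≤ (j : ℕ) then b j else 0 : ℝ) : ℂ) := by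
    intro b
    ext j
    split_ifs <;> simp
  simp only [parMatrix_eq_siegelMatrix, key]
  refine siegelMatrix_diagonal_mul_comm fun j => ?_
  by_cases hj : (j : ℕ) < k
  · exact Or.inr (by simp [hj.not_ge])
  · exact Or.inl (by simp [hj])

theorem isMASA_parAlg (p k : ℕ) : IsMASA (uForm (formK p)) (parAlg p k) := by
  refine isMASA_iff.2 ⟨?_, ?_, ?_⟩
  · rintro _ ⟨d, b, y, a, rfl⟩
    exact parMatrix_mem_uForm k d b y a
  · rintro _ ⟨d, b, y, a, rfl⟩ _ ⟨d', b', y', a', rfl⟩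
    exact parMatrix_mul_comm k d b d' b' y a y' a'
  · intro X hX h
    have hE : ∀ i, X i (Sum.inr 0) =
        X (Sum.inr 1) (Sum.inr 1) * (Pi.single (Sum.inr 0) 1 : Idx p → ℂ) i := by
      intro i
      have := congrFun₂ (h _ ⟨0, 0, 0, 1, rfl⟩) i (Sum.inr 1)
      rcases i with i | i
      · simpa [parMatrix, Matrix.mul_apply, diagonal_apply] using this
      · fin_cases i <;> simpa [parMatrix, Matrix.mul_apply, diagonal_apply] using this
    obtain ⟨z, hz⟩ : ∃ z, z = X (Sum.inr 1) (Sum.inr 1) := ⟨_, rfl⟩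
    obtain ⟨M, hM, c, a, rfl⟩ := exists_eq_siegelMatrix hX (z := z)
      (by ext i; simpa [hz] using hE i)
    have hzI : z = I * (z.im : ℝ) := by
      have := congrArg re hz
      simp [siegelMatrix] at this
      apply Complex.ext <;> simp
      linarith
    have hcomm := fun d b =>
      siegelMatrix_commute (parMatrix_eq_siegelMatrix (p := p) k d b 0 0 ▸ h _ ⟨d, b, 0, 0, rfl⟩)
    have hs : ∀ j : Fin (p - 1), k ≤ (j : ℕ) → (fun l : Fin (p - 1) => if k ≤ (l : ℕ) then
        (((Pi.single j 1 : Fin (p - 1) → ℝ) l : ℝ) : ℂ) else 0) = Pi.single j 1 := by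
      intro j hj
      ext l
      by_cases hl : l = j
      · subst hl; simp [hj]
      · simp [hl]
    have hMcol : ∀ i j : Fin (p - 1), k ≤ (j : ℕ) → M i j = if i = j then z else 0 := by
      intro i j hj
      have h1 := (hcomm 0 (Pi.single j 1)).2.1 i
      have h2 := congrFun (hs j hj) i
      beta_reduce at h2
      rw [hs j hj, h2] at h1
      have hz' : z + starRingEnd ℂ z = 0 := by rw [hzI]; simp
      split_ifs with hij
      · subst hij
        simp at h1
        linear_combination h1 - hz'
      · simpa [hij] using h1
    have hMdiag : M.IsDiag := by
      intro i j hij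
      by_cases hj : k ≤ (j : ℕ)
      · rw [hMcol i j hj, if_neg hij]
      · have := congrFun₂ (hcomm (fun j : Fin (p - 1) => (j : ℕ) + 1) 0).1 i j
        simp only [mul_diagonal, diagonal_mul, not_le.1 hj, if_true] at this
        by_contra hne
        rw [mul_comm] at this
        have := congrArg im (mul_right_cancel₀ hne this)
        split_ifs at this
        · simp at this
          exact hij (Fin.ext this.symm)
        · norm_num at this
          norm_cast at this
    have hc0 : ∀ j : Fin (p - 1), (j : ℕ) < k → c j = 0 := by
      intro j hj
      have := (hcomm 1 0).2.1 j
      rw [mulVec_diagonal] at this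
      simpa [hj, mulVec, dotProduct] using this
    have hcr : ∀ j : Fin (p - 1), k ≤ (j : ℕ) → (c j).im = 0 := by
      intro j hj
      have := (hcomm 0 (Pi.single j 1)).2.2
      rw [hs j hj] at this
      simpa [← Pi.single_star, conj_eq_iff_im] using this
    have hMim : ∀ j, M j j = I * ((M j j).im : ℝ) := by
      intro j
      have hM' : Mᴴ * 1 + 1 * M = 0 := hM
      have := congrArg re (congrFun₂ hM' j j)
      simp at this
      apply Complex.ext <;> simp
      linarith
    refine ⟨fun j => (M j j).im, fun j => (c j).re, z.im, a, ?_⟩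
    rw [parMatrix_eq_siegelMatrix, ← hzI]
    congr 1
    · rw [← hMdiag.diagonal_diag]
      congr 1
      ext j
      split_ifs with hj
      · simpa using hMim j
      · simp [hMcol j j (not_lt.1 hj)]
    · ext j
      split_ifs with hj
      · exact Complex.ext (by simp) (by simpa using hcr j hj)
      · exact hc0 j (not_le.1 hj)

end Models

section Box

variable {p q : ℕ}

theorem isMASA_modelAlg (t : MASAType p) : IsMASA (uPOne p) (modelAlg p t) := by
  cases t with
  | quasiElliptic => exact isMASA_diagIn_uPOne p
  | quasiHyperbolic => exact isMASA_cayleyConj (isMASA_hypAlg p)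
  | quasiParabolic => exact isMASA_cayleyConj (isMASA_parAlg p _)
  | nilpotent => exact isMASA_cayleyConj (isMASA_parAlg p _)
  | quasiNilpotent k _ _ => exact isMASA_cayleyConj (isMASA_parAlg p k)

theorem fromBlocks_mem_boxZero {m n : Type*} [Fintype m] [DecidableEq m] [Fintype n]
    [DecidableEq n] {h₁ : LieSubalgebra ℝ (Matrix m m ℂ)} {h₂ : LieSubalgebra ℝ (Matrix n n ℂ)}
    {A : Matrix m m ℂ} {B : Matrix n n ℂ} :
    fromBlocks A 0 0 B ∈ boxZero h₁ h₂ ↔ A ∈ h₁ ∧ B ∈ h₂ ∧ A.trace = B.trace := by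
  constructor
  · rintro ⟨A', hA, B', hB, ht, h⟩
    obtain ⟨rfl, -, -, rfl⟩ := fromBlocks_inj.1 h
    exact ⟨hA, hB, ht⟩
  · rintro ⟨hA, hB, ht⟩
    exact ⟨A, hA, B, hB, ht, rfl⟩

theorem suEven_eq_boxZero (p q : ℕ) : suEven p q = boxZero (uPOne p) (uQ q) := by
  have key : ∀ A : Matrix (Idx p) (Idx p) ℂ, ∀ B : Matrix (Fin q) (Fin q) ℂ,
      fromBlocks A 0 0 B ∈ uForm (formSuper p q) ↔ A ∈ uPOne p ∧ B ∈ uQ q := by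
    intro A B
    change _ + _ = 0 ↔ _ + _ = 0 ∧ _ + _ = 0
    rw [formSuper, fromBlocks_conjTranspose, fromBlocks_multiply, fromBlocks_multiply,
      fromBlocks_add, ← fromBlocks_zero, fromBlocks_inj]
    simp only [conjTranspose_zero, Matrix.zero_mul, Matrix.mul_zero, add_zero, zero_add,
      Matrix.mul_neg, Matrix.neg_mul, Matrix.mul_one, Matrix.one_mul, true_and]
    rw [← neg_add, neg_zero, eq_self, true_and, neg_eq_zero]
  ext X
  constructor
  · rintro ⟨h1, h2, h3, h4⟩
    rw [← fromBlocks_toBlocks X, h1, h2] at h3 ⊢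
    exact fromBlocks_mem_boxZero.2 ⟨((key _ _).1 h3).1, ((key _ _).1 h3).2, sub_eq_zero.1 h4⟩
  · rintro ⟨A, hA, B, hB, ht, rfl⟩
    refine ⟨toBlocks_fromBlocks₁₂ _ _ _ _, toBlocks_fromBlocks₂₁ _ _ _ _, (key A B).2 ⟨hA, hB⟩, ?_⟩
    rw [toBlocks_fromBlocks₁₁, toBlocks_fromBlocks₂₂, ht, sub_self]

theorem fromBlocks_diag_commute_iff {m n : Type*} [Fintype m] [DecidableEq m] [Fintype n]
    [DecidableEq n] {A A' : Matrix m m ℂ} {B B' : Matrix n n ℂ} :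
    fromBlocks A 0 0 B * fromBlocks A' 0 0 B' = fromBlocks A' 0 0 B' * fromBlocks A 0 0 B ↔
      A * A' = A' * A ∧ B * B' = B' * B := by
  simp [fromBlocks_multiply, fromBlocks_inj]

theorem re_trace_eq_zero {n : Type*} [Fintype n] [DecidableEq n] {S A : Matrix n n ℂ}
    (hS : S * S = 1) (hA : A ∈ uForm S) : A.trace.re = 0 := by
  have h : Aᴴ * S + S * A = 0 := hA
  have h1 : S * A * S = -Aᴴ := by
    rw [eq_neg_of_add_eq_zero_right h, Matrix.neg_mul, Matrix.mul_assoc, hS, Matrix.mul_one]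
  have h2 : A.trace = -star A.trace := by
    rw [← trace_conjTranspose, ← trace_neg, ← h1, trace_mul_comm, ← Matrix.mul_assoc, hS,
      Matrix.one_mul]
  have := congrArg re h2
  simp at this
  linarith

theorem smul_one_mem_uForm {n : Type*} [Fintype n] [DecidableEq n] (S : Matrix n n ℂ) {c : ℂ}
    (hc : c.re = 0) : c • (1 : Matrix n n ℂ) ∈ uForm S := by
  change _ + _ = _
  rw [conjTranspose_smul, conjTranspose_one, Matrix.smul_mul, Matrix.mul_smul, Matrix.one_mul,
    Matrix.mul_one, ← add_smul]
  rw [show star c + c = 0 from Complex.ext (by simp [hc]) (by simp), zero_smul]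

theorem smul_one_mem_of_isMASA {n : Type*} [Fintype n] [DecidableEq n] {S : Matrix n n ℂ}
    {h : LieSubalgebra ℝ (Matrix n n ℂ)} (hh : IsMASA (uForm S) h) {c : ℂ} (hc : c.re = 0) :
    c • (1 : Matrix n n ℂ) ∈ h :=
  (isMASA_iff.1 hh).2.2 _ (smul_one_mem_uForm S hc) fun Y _ => by simp

/-- A maximal Abelian subalgebra of `𝔲(p,1)` contains a scalar matrix of each imaginary trace. -/
theorem exists_scalar_trace_eq (hp : 1 ≤ p) {h : LieSubalgebra ℝ (Matrix (Idx p) (Idx p) ℂ)}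
    (hh : IsMASA (uPOne p) h) {t : ℂ} (ht : t.re = 0) :
    ∃ c : ℂ, c • (1 : Matrix (Idx p) (Idx p) ℂ) ∈ h ∧
      (c • (1 : Matrix (Idx p) (Idx p) ℂ)).trace = t := by
  have hp0 : ((p + 1 : ℝ) : ℂ) ≠ 0 := by exact_mod_cast (p.succ_ne_zero)
  refine ⟨t / ((p + 1 : ℝ) : ℂ), smul_one_mem_of_isMASA hh ?_, ?_⟩
  · rw [div_ofReal_re, ht, zero_div]
  · rw [trace_smul, trace_one, card_idx hp, smul_eq_mul]
    push_cast at hp0 ⊢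
    rw [div_mul_cancel₀ _ hp0]

theorem isEvenMASA_boxZero (hp : 1 ≤ p) {h₁ : LieSubalgebra ℝ (Matrix (Idx p) (Idx p) ℂ)}
    {h₂ : LieSubalgebra ℝ (Matrix (Fin q) (Fin q) ℂ)} (H₁ : IsMASA (uPOne p) h₁)
    (H₂ : IsMASA (uQ q) h₂) : IsEvenMASA p q (boxZero h₁ h₂) := by
  obtain ⟨le₁, ab₁, max₁⟩ := isMASA_iff.1 H₁
  obtain ⟨le₂, ab₂, max₂⟩ := isMASA_iff.1 H₂
  rw [IsEvenMASA, suEven_eq_boxZero]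
  refine isMASA_iff.2 ⟨?_, ?_, ?_⟩
  · rintro _ ⟨A, hA, B, hB, ht, rfl⟩
    exact fromBlocks_mem_boxZero.2 ⟨le₁ hA, le₂ hB, ht⟩
  · rintro _ ⟨A, hA, B, hB, ht, rfl⟩ _ ⟨A', hA', B', hB', ht', rfl⟩
    exact fromBlocks_diag_commute_iff.2 ⟨ab₁ A hA A' hA', ab₂ B hB B' hB'⟩
  · rintro _ ⟨A, hA, B, hB, ht, rfl⟩ h
    refine fromBlocks_mem_boxZero.2 ⟨max₁ A hA fun A' hA' => ?_, max₂ B hB fun B' hB' => ?_, ht⟩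
    · obtain ⟨c, hc, hct⟩ :=
        exists_scalar_trace_eq hp H₁ (re_trace_eq_zero (formJ_mul_formJ p) (le₁ hA'))
      have := (fromBlocks_diag_commute_iff.1 (h _ (fromBlocks_mem_boxZero.2
        ⟨h₁.sub_mem hA' hc, h₂.zero_mem, by rw [trace_sub, hct, sub_self, trace_zero]⟩))).1
      simpa [Matrix.mul_sub, Matrix.sub_mul] using this
    · obtain ⟨c, hc, hct⟩ := exists_scalar_trace_eq hp H₁ (t := B'.trace)
        (re_trace_eq_zero (S := 1) (Matrix.one_mul 1) (le₂ hB'))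
      exact (fromBlocks_diag_commute_iff.1 (h _ (fromBlocks_mem_boxZero.2 ⟨hc, hB', hct⟩))).2

end Box

section Group

variable {p q : ℕ}

theorem mem_suGroup_iff {γ : GL (Idx p ⊕ Fin q) ℂ} : γ ∈ suGroup p q ↔
    ∃ (α : Matrix (Idx p) (Idx p) ℂ) (β : Matrix (Fin q) (Fin q) ℂ), γ.val = fromBlocks α 0 0 β ∧
      αᴴ * formJ p * α = formJ p ∧ βᴴ * β = 1 ∧ α.det = β.det := by
  have key : ∀ (α : Matrix (Idx p) (Idx p) ℂ) (β : Matrix (Fin q) (Fin q) ℂ),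
      ((fromBlocks α 0 0 β)ᴴ * formSuper p q * fromBlocks α 0 0 β = formSuper p q ∧
        ber (fromBlocks α 0 0 β) = 1) ↔
      αᴴ * formJ p * α = formJ p ∧ βᴴ * β = 1 ∧ α.det = β.det := by
    intro α β
    rw [formSuper, fromBlocks_conjTranspose, fromBlocks_multiply, fromBlocks_multiply,
      fromBlocks_inj, ber, toBlocks_fromBlocks₁₁, toBlocks_fromBlocks₁₂, toBlocks_fromBlocks₂₁,
      toBlocks_fromBlocks₂₂]
    simp only [conjTranspose_zero, Matrix.zero_mul, Matrix.mul_zero, add_zero, zero_add,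
      Matrix.mul_neg, Matrix.neg_mul, Matrix.mul_one, neg_zero, true_and, neg_inj, sub_zero,
      and_assoc]
    refine and_congr_right fun _ => and_congr_right fun h => ?_
    have hβ : β.det ≠ 0 := by
      intro h0
      have := congrArg det h
      rw [det_mul, h0, mul_zero, det_one] at this
      exact zero_ne_one this
    rw [← div_eq_mul_inv, div_eq_one_iff_eq hβ]
  constructor
  · rintro ⟨h1, h2, h3, h4⟩
    have hγ : γ.val = fromBlocks γ.val.toBlocks₁₁ 0 0 γ.val.toBlocks₂₂ := by
      conv_lhs => rw [← fromBlocks_toBlocks γ.val, h1, h2]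
    rw [hγ] at h3 h4
    exact ⟨_, _, hγ, (key _ _).1 ⟨h3, h4⟩⟩
  · rintro ⟨α, β, hγ, h⟩
    obtain ⟨h3, h4⟩ := (key α β).2 h
    refine ⟨?_, ?_, ?_, ?_⟩ <;> rw [hγ]
    · exact toBlocks_fromBlocks₁₂ _ _ _ _
    · exact toBlocks_fromBlocks₂₁ _ _ _ _
    · exact h3
    · exact h4

theorem conj_fromBlocks_mem {γ : GL (Idx p ⊕ Fin q) ℂ} (hγ : γ ∈ suGroup p q)
    {X : Matrix (Idx p ⊕ Fin q) (Idx p ⊕ Fin q) ℂ} (hX : X ∈ suEven p q) :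
    γ.val * X * γ⁻¹.val ∈ suEven p q := by
  rw [suEven_eq_boxZero] at hX ⊢
  obtain ⟨A, hA, B, hB, ht, rfl⟩ := hX
  obtain ⟨α, β, hγ', -, -, -⟩ := mem_suGroup_iff.1 hγ
  obtain ⟨α', β', hγi, hα', hβ', -⟩ := mem_suGroup_iff.1 ((suGroup p q).inv_mem hγ)
  have hi : γ⁻¹.val * γ.val = 1 := by rw [← Units.val_mul, inv_mul_cancel, Units.val_one]
  rw [hγ', hγi, fromBlocks_multiply, ← fromBlocks_one, fromBlocks_inj] at hi
  simp only [Matrix.mul_zero, Matrix.zero_mul, add_zero, zero_add, true_and] at hi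
  obtain ⟨hα, hβ⟩ := hi
  rw [hγ', hγi, fromBlocks_multiply, fromBlocks_multiply]
  simp only [Matrix.mul_zero, Matrix.zero_mul, add_zero, zero_add]
  refine fromBlocks_mem_boxZero.2 ⟨mem_uForm_of_mul_eq hα' hA ?_,
    mem_uForm_of_mul_eq (P := β') (by rwa [Matrix.mul_one]) hB ?_, ?_⟩
  · rw [← Matrix.mul_assoc, ← Matrix.mul_assoc, hα, Matrix.one_mul]
  · rw [← Matrix.mul_assoc, ← Matrix.mul_assoc, hβ, Matrix.one_mul]
  · rw [trace_mul_comm, ← Matrix.mul_assoc, hα, Matrix.one_mul, trace_mul_comm, ← Matrix.mul_assoc,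
      hβ, Matrix.one_mul, ht]

theorem norm_det_eq_one {n : Type*} [Fintype n] [DecidableEq n] {S P : Matrix n n ℂ}
    (hS : IsUnit S) (h : Pᴴ * S * P = S) : ‖P.det‖ = 1 := by
  have h1 := congrArg (fun M => ‖M.det‖) h
  have h2 : ‖S.det‖ ≠ 0 := norm_ne_zero_iff.2 ((isUnit_iff_isUnit_det _).1 hS).ne_zero
  simp only [det_mul, det_conjTranspose, norm_mul, norm_star] at h1
  have h3 : ‖P.det‖ * ‖P.det‖ = 1 := by
    refine mul_right_cancel₀ h2 ?_
    linarith
  nlinarith [norm_nonneg P.det]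

/-- Isometries of the two blocks can be rescaled to an element of the special group. -/
theorem exists_smul_mem_suGroup (hp : 1 ≤ p) {P : Matrix (Idx p) (Idx p) ℂ}
    {Q : Matrix (Fin q) (Fin q) ℂ} (hP : Pᴴ * formJ p * P = formJ p) (hQ : Qᴴ * Q = 1) :
    ∃ c : ℂ, ∃ δ ∈ suGroup p q, δ.val = fromBlocks (c • P) 0 0 Q := by
  have hPn := norm_det_eq_one (isUnit_formJ p) hP
  have hQn : ‖Q.det‖ = 1 := norm_det_eq_one isUnit_one (by rwa [Matrix.mul_one])
  have hP0 : P.det ≠ 0 := norm_ne_zero_iff.1 (by rw [hPn]; exact one_ne_zero)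
  have hQ0 : Q.det ≠ 0 := norm_ne_zero_iff.1 (by rw [hQn]; exact one_ne_zero)
  obtain ⟨c, hc⟩ := IsAlgClosed.exists_pow_nat_eq (Q.det / P.det) (Nat.succ_pos p)
  have hcn : ‖c‖ = 1 := by
    have := congrArg norm hc
    rw [norm_pow, norm_div, hPn, hQn, div_one] at this
    exact (pow_eq_one_iff_of_nonneg (norm_nonneg c) p.succ_ne_zero).1 this
  have hcc : star c * c = 1 := by
    rw [star_def, ← normSq_eq_conj_mul_self, normSq_eq_norm_sq, hcn]; simp
  have hdet : (c • P).det = Q.det := by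
    rw [det_smul, card_idx hp, hc, div_mul_cancel₀ _ hP0]
  have hu : IsUnit (fromBlocks (c • P) 0 0 Q) := by
    rw [isUnit_iff_isUnit_det, det_fromBlocks_zero₂₁, hdet]
    exact (mul_ne_zero hQ0 hQ0).isUnit
  refine ⟨c, hu.unit, mem_suGroup_iff.2 ⟨c • P, Q, rfl, ?_, hQ, hdet⟩, rfl⟩
  rw [conjTranspose_smul, Matrix.smul_mul, Matrix.smul_mul, Matrix.mul_smul, smul_smul, hcc,
    one_smul, hP]

theorem conj_mul_conj {n : Type*} [Fintype n] [DecidableEq n] (γ : GL n ℂ) (X Y : Matrix n n ℂ) :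
    γ.val * X * γ⁻¹.val * (γ.val * Y * γ⁻¹.val) = γ.val * (X * Y) * γ⁻¹.val := by
  simp only [Matrix.mul_assoc]
  rw [← Matrix.mul_assoc γ⁻¹.val γ.val, ← Units.val_mul, inv_mul_cancel, Units.val_one,
    Matrix.one_mul]

theorem conj_conj_inv {n : Type*} [Fintype n] [DecidableEq n] (γ : GL n ℂ) (X : Matrix n n ℂ) :
    γ.val * (γ⁻¹.val * X * γ.val) * γ⁻¹.val = X := by
  simp only [Matrix.mul_assoc]
  rw [← Units.val_mul, mul_inv_cancel, Units.val_one, Matrix.mul_one, ← Matrix.mul_assoc,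
    ← Units.val_mul, mul_inv_cancel, Units.val_one, Matrix.one_mul]

theorem conj_inv_conj {n : Type*} [Fintype n] [DecidableEq n] (γ : GL n ℂ) (X : Matrix n n ℂ) :
    γ⁻¹.val * (γ.val * X * γ⁻¹.val) * γ.val = X := by
  simpa using conj_conj_inv γ⁻¹ X

theorem isEvenMASA_conjAlg_box (hp : 1 ≤ p)
    {H : LieSubalgebra ℝ (Matrix (Idx p ⊕ Fin q) (Idx p ⊕ Fin q) ℂ)} (hH : IsEvenMASA p q H) :
    ∃ t : MASAType p, ConjAlg p q H (boxZero (modelAlg p t) (diagIn (uQ q))) := by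
  obtain ⟨hle, hab, hmax⟩ := isMASA_iff.1 hH
  have hbl : ∀ X : H, ∃ (A : Matrix (Idx p) (Idx p) ℂ) (B : Matrix (Fin q) (Fin q) ℂ),
      A ∈ uPOne p ∧ B ∈ uQ q ∧ A.trace = B.trace ∧ X.1 = fromBlocks A 0 0 B := by
    intro X
    have := hle X.2
    rw [suEven_eq_boxZero] at this
    obtain ⟨A, hA, B, hB, ht, h⟩ := this
    exact ⟨A, B, hA, hB, ht, h⟩
  choose A B hA hB ht hX using hbl
  have hcomm : ∀ X Y, A X * A Y = A Y * A X ∧ B X * B Y = B Y * B X := by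
    intro X Y
    have := hab X.1 X.2 Y.1 Y.2
    rw [hX, hX Y] at this
    exact fromBlocks_diag_commute_iff.1 this
  obtain ⟨P, hP, t, hPt⟩ := exists_isometry_into_model hp hA fun X Y => (hcomm X Y).1
  obtain ⟨Q, hQ, d, hd⟩ := exists_unitary_diagonalizing hB fun X Y => (hcomm X Y).2
  obtain ⟨c, δ, hδ, hδv⟩ := exists_smul_mem_suGroup hp hP hQ
  have hδi := (suGroup p q).inv_mem hδ
  have hbox := isEvenMASA_boxZero hp (isMASA_modelAlg t) (isMASA_diagIn_uQ q)
  obtain ⟨ble, bab, bmax⟩ := isMASA_iff.1 hbox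
  have hmem : ∀ X ∈ H, δ⁻¹.val * X * δ.val ∈ boxZero (modelAlg p t) (diagIn (uQ q)) := by
    intro X hXH
    obtain ⟨Y, hY, hYP⟩ := hPt ⟨X, hXH⟩
    have hD : diagonal (fun j => I * (d ⟨X, hXH⟩ j : ℂ)) ∈ diagIn (uQ q) :=
      ⟨diagonal_I_mul_mem_uForm _, isDiag_diagonal _⟩
    have hXδ : X * δ.val = δ.val * fromBlocks Y 0 0 (diagonal fun j => I * (d ⟨X, hXH⟩ j : ℂ)) := by
      refine (congrArg (· * δ.val) (hX ⟨X, hXH⟩)).trans ?_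
      rw [hδv, fromBlocks_multiply, fromBlocks_multiply]
      simp [hYP, hd]
    have heq : δ⁻¹.val * X * δ.val =
        fromBlocks Y 0 0 (diagonal fun j => I * (d ⟨X, hXH⟩ j : ℂ)) := by
      rw [Matrix.mul_assoc, hXδ, ← Matrix.mul_assoc, ← Units.val_mul, inv_mul_cancel,
        Units.val_one, Matrix.one_mul]
    have hsu := conj_fromBlocks_mem hδi (hle hXH)
    rw [inv_inv, heq, suEven_eq_boxZero, fromBlocks_mem_boxZero] at hsu
    rw [heq]
    exact fromBlocks_mem_boxZero.2 ⟨hY, hD, hsu.2.2⟩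
  refine ⟨t, δ⁻¹, hδi, Set.Subset.antisymm (fun Y hY => ?_) ?_⟩
  · refine ⟨δ.val * Y * δ⁻¹.val, hmax _ (conj_fromBlocks_mem hδ (ble hY)) fun X hXH => ?_, ?_⟩
    · rw [← conj_conj_inv δ X, conj_mul_conj, conj_mul_conj, bab Y hY _ (hmem X hXH)]
    · beta_reduce
      rw [inv_inv, conj_inv_conj]
  · rintro _ ⟨X, hXH, rfl⟩
    beta_reduce
    rw [inv_inv]
    exact hmem X hXH

theorem ConjAlg.refl (H : LieSubalgebra ℝ (Matrix (Idx p ⊕ Fin q) (Idx p ⊕ Fin q) ℂ)) :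
    ConjAlg p q H H :=
  ⟨1, (suGroup p q).one_mem, by simp⟩

theorem ConjAlg.symm {H H' : LieSubalgebra ℝ (Matrix (Idx p ⊕ Fin q) (Idx p ⊕ Fin q) ℂ)}
    (h : ConjAlg p q H H') : ConjAlg p q H' H := by
  obtain ⟨γ, hγ, h⟩ := h
  refine ⟨γ⁻¹, (suGroup p q).inv_mem hγ, ?_⟩
  rw [h, Set.image_image]
  simp only [inv_inv, conj_inv_conj, Set.image_id']

theorem ConjAlg.trans {H H' H'' : LieSubalgebra ℝ (Matrix (Idx p ⊕ Fin q) (Idx p ⊕ Fin q) ℂ)}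
    (h : ConjAlg p q H H') (h' : ConjAlg p q H' H'') : ConjAlg p q H H'' := by
  obtain ⟨γ, hγ, h⟩ := h
  obtain ⟨γ', hγ', h'⟩ := h'
  refine ⟨γ' * γ, (suGroup p q).mul_mem hγ' hγ, ?_⟩
  rw [h', h, Set.image_image]
  simp only [_root_.mul_inv_rev, Units.val_mul, Matrix.mul_assoc]

end Group

section GLConj

/-- Two subalgebras of a matrix algebra are conjugate under the general linear group. -/
def GLConj {n : Type*} [Fintype n] [DecidableEq n] (h h' : LieSubalgebra ℝ (Matrix n n ℂ)) :
    Prop :=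
  ∃ g : GL n ℂ, (∀ X ∈ h, g.val * X * g⁻¹.val ∈ h') ∧ ∀ Y ∈ h', g⁻¹.val * Y * g.val ∈ h

section

variable {n : Type*} [Fintype n] [DecidableEq n] {h h' h'' : LieSubalgebra ℝ (Matrix n n ℂ)}

theorem GLConj.refl (h : LieSubalgebra ℝ (Matrix n n ℂ)) : GLConj h h := ⟨1, by simp, by simp⟩

theorem GLConj.symm (H : GLConj h h') : GLConj h' h := by
  obtain ⟨g, h1, h2⟩ := H
  exact ⟨g⁻¹, by simpa using h2, by simpa using h1⟩

theorem GLConj.trans (H : GLConj h h') (H' : GLConj h' h'') : GLConj h h'' := by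
  obtain ⟨g, h1, h2⟩ := H
  obtain ⟨g', h1', h2'⟩ := H'
  refine ⟨g' * g, fun X hX => ?_, fun X hX => ?_⟩
  · simpa only [_root_.mul_inv_rev, Units.val_mul, Matrix.mul_assoc] using h1' _ (h1 X hX)
  · simpa only [_root_.mul_inv_rev, Units.val_mul, Matrix.mul_assoc] using h2 _ (h2' X hX)

/-- The common kernel of the nilpotent elements of `h`. -/
def nilpotentKer (h : LieSubalgebra ℝ (Matrix n n ℂ)) : Submodule ℂ (n → ℂ) :=
  ⨅ X ∈ {X ∈ h | IsNilpotent X}, LinearMap.ker (toLin' X)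

theorem mem_nilpotentKer {x : n → ℂ} :
    x ∈ nilpotentKer h ↔ ∀ X ∈ h, IsNilpotent X → X *ᵥ x = 0 := by
  simp [nilpotentKer]

theorem isNilpotent_conj (g : GL n ℂ) {X : Matrix n n ℂ} (hX : IsNilpotent X) :
    IsNilpotent (g.val * X * g⁻¹.val) := by
  obtain ⟨k, hk⟩ := hX
  exact ⟨k, by rw [Units.conj_pow, hk, mul_zero, zero_mul]⟩

theorem GLConj.finrank_nilpotentKer_le (H : GLConj h h') :
    Module.finrank ℂ (nilpotentKer h') ≤ Module.finrank ℂ (nilpotentKer h) := by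
  obtain ⟨g, h1, -⟩ := H
  have hle : nilpotentKer h' ≤ (nilpotentKer h).map (toLin' g.val) := by
    intro x hx
    rw [mem_nilpotentKer] at hx
    refine ⟨g⁻¹.val *ᵥ x, mem_nilpotentKer.2 fun X hX hn => ?_, ?_⟩
    · have := congrArg (fun v => g⁻¹.val *ᵥ v) (hx _ (h1 X hX) (isNilpotent_conj g hn))
      simpa only [mulVec_mulVec, mulVec_zero, ← Matrix.mul_assoc, ← Units.val_mul, inv_mul_cancel,
        Units.val_one, Matrix.one_mul] using this
    · rw [toLin'_apply, mulVec_mulVec, ← Units.val_mul, mul_inv_cancel, Units.val_one, one_mulVec]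
  exact (Submodule.finrank_mono hle).trans (Submodule.finrank_map_le _ _)

theorem GLConj.finrank_nilpotentKer_eq (H : GLConj h h') :
    Module.finrank ℂ (nilpotentKer h) = Module.finrank ℂ (nilpotentKer h') :=
  le_antisymm H.symm.finrank_nilpotentKer_le H.finrank_nilpotentKer_le

theorem nilpotentKer_eq_top (hd : ∀ X ∈ h, X.IsDiag) : nilpotentKer h = ⊤ := by
  refine eq_top_iff.2 fun x _ => mem_nilpotentKer.2 fun X hX hn => ?_
  obtain ⟨c, rfl⟩ : ∃ c, X = diagonal c := ⟨_, (hd X hX).diagonal_diag.symm⟩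
  obtain ⟨k, hk⟩ := hn
  have hc : c = 0 := by
    ext j
    have := congrFun₂ hk j j
    rw [diagonal_pow, diagonal_apply_eq] at this
    exact eq_zero_of_pow_eq_zero this
  rw [hc]
  simp

theorem eq_zero_of_isNilpotent_of_mulVec_eq {X : Matrix n n ℂ} (hX : IsNilpotent X) {v : n → ℂ}
    (hv : v ≠ 0) {c : ℂ} (h : X *ᵥ v = c • v) : c = 0 := by
  obtain ⟨k, hk⟩ := hX
  have hpow : ∀ m : ℕ, X ^ m *ᵥ v = c ^ m • v := by
    intro m
    induction m with
    | zero => simp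
    | succ m ih => rw [pow_succ, ← mulVec_mulVec, h, mulVec_smul, ih, smul_smul, pow_succ, mul_comm]
  have := hpow k
  rw [hk, zero_mulVec] at this
  exact eq_zero_of_pow_eq_zero ((smul_eq_zero.1 this.symm).resolve_right hv)

end

variable {p : ℕ}

theorem mem_nilpotentKer_parAlg {k : ℕ} {x : Idx p → ℂ} :
    x ∈ nilpotentKer (parAlg p k) ↔
      x (Sum.inr 1) = 0 ∧ ∀ j : Fin (p - 1), k ≤ (j : ℕ) → x (Sum.inl j) = 0 := by
  rw [mem_nilpotentKer]
  constructor
  · intro h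
    have hnil : ∀ b a, IsNilpotent (parMatrix p k 0 b 0 a) := by
      intro b a
      refine ⟨3, ?_⟩
      rw [pow_succ, pow_two, parMatrix, fromBlocks_multiply, fromBlocks_multiply,
        ← fromBlocks_zero]
      congr 1
      · ext i j; simp [Matrix.mul_apply]
      · ext i j; fin_cases j <;> simp [Matrix.mul_apply]
      · ext i j; fin_cases i <;> simp [Matrix.mul_apply, vecHead, vecTail]
      · ext i j; fin_cases i <;> fin_cases j <;>
          simp [Matrix.mul_apply, vecHead, vecTail, vecMul, dotProduct]
    refine ⟨?_, fun j hj => ?_⟩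
    · have := congrFun (h _ ⟨0, 0, 0, 1, rfl⟩ (hnil 0 1)) (Sum.inr 0)
      simpa [parMatrix, mulVec, dotProduct] using this
    · have := congrFun (h _ ⟨0, Pi.single j 1, 0, 0, rfl⟩ (hnil _ 0)) (Sum.inr 0)
      simp [parMatrix, mulVec, dotProduct] at this
      rw [Finset.sum_eq_single j (fun l _ hl => by simp [hl]) (by simp)] at this
      simpa [hj] using this
  · rintro ⟨h1, h2⟩ _ ⟨d, b, y, a, rfl⟩ hn
    have hy : I * (y : ℂ) = 0 := by
      refine eq_zero_of_isNilpotent_of_mulVec_eq hn (v := Pi.single (Sum.inr 0) 1) (by simp) ?_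
      rw [parMatrix_eq_siegelMatrix, siegelMatrix_mulVec_single]
    have hd : ∀ j : Fin (p - 1), (j : ℕ) < k → I * (d j : ℂ) = 0 := by
      intro j hj
      refine eq_zero_of_isNilpotent_of_mulVec_eq hn (v := Pi.single (Sum.inl j) 1) (by simp) ?_
      ext i
      rcases i with i | i
      · by_cases hij : i = j
        · subst hij; simp [parMatrix, hj]
        · simp [parMatrix, hij]
      · simp [parMatrix, hj.not_ge]
    ext i
    rcases i with i | i
    · by_cases hi : (i : ℕ) < k
      · simp [parMatrix, mulVec, dotProduct, diagonal_apply, h1, hi, hd i hi]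
      · simp [parMatrix, mulVec, dotProduct, diagonal_apply, h1, hi, h2 i (not_lt.1 hi)]
    · fin_cases i
      · simp [parMatrix, mulVec, dotProduct, h1, hy]
        refine Finset.sum_eq_zero fun j _ => ?_
        split_ifs with hj
        · rw [h2 j hj, mul_zero]
        · simp
      · simp [parMatrix, mulVec, dotProduct, h1]

theorem finrank_nilpotentKer_parAlg_lt {k k' : ℕ} (h : k < k') (hk' : k' ≤ p - 1) :
    Module.finrank ℂ (nilpotentKer (parAlg p k)) <
      Module.finrank ℂ (nilpotentKer (parAlg p k')) := by
  refine Submodule.finrank_lt_finrank_of_lt (lt_of_le_of_ne (fun x hx => ?_) fun heq => ?_)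
  · rw [mem_nilpotentKer_parAlg] at hx ⊢
    exact ⟨hx.1, fun j hj => hx.2 j (h.le.trans hj)⟩
  · have hmem : Pi.single (Sum.inl ⟨k, by omega⟩) 1 ∈ nilpotentKer (parAlg p k') := by
      refine mem_nilpotentKer_parAlg.2 ⟨by simp, fun j hj => ?_⟩
      rw [Pi.single_apply, if_neg]
      rintro h
      have := congrArg Fin.val (Sum.inl_injective h)
      simp at this
      omega
    rw [← heq, mem_nilpotentKer_parAlg] at hmem
    simpa using hmem.2 ⟨k, by omega⟩ le_rfl

theorem finrank_nilpotentKer_parAlg_lt_top (k : ℕ) :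
    Module.finrank ℂ (nilpotentKer (parAlg p k)) <
      Module.finrank ℂ (⊤ : Submodule ℂ (Idx p → ℂ)) := by
  refine Submodule.finrank_lt_finrank_of_lt (lt_top_iff_ne_top.2 fun heq => ?_)
  have : Pi.single (Sum.inr 1) 1 ∈ nilpotentKer (parAlg p k) := heq ▸ Submodule.mem_top
  simpa using (mem_nilpotentKer_parAlg.1 this).1

/-- The model subalgebras, up to the Cayley transform: the elliptic one, the hyperbolic one, and
those of the parabolic matrices. -/
def plainAlg (p : ℕ) : Option (Option (Fin p)) → LieSubalgebra ℝ (Matrix (Idx p) (Idx p) ℂ)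
  | none => diagIn (uPOne p)
  | some none => hypAlg p
  | some (some k) => parAlg p k

theorem nilpotentKer_plainAlg_none : nilpotentKer (plainAlg p none) = ⊤ :=
  nilpotentKer_eq_top fun _ hX => hX.2

theorem nilpotentKer_plainAlg_some_none : nilpotentKer (plainAlg p (some none)) = ⊤ := by
  refine nilpotentKer_eq_top ?_
  rintro _ ⟨d, z, rfl⟩
  rw [hypMatrix_eq_diagonal]
  exact isDiag_diagonal _

theorem not_gLConj_elliptic_hyperbolic :
    ¬GLConj (plainAlg p (some none)) (plainAlg p none) := by
  rintro ⟨g, h, -⟩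
  obtain ⟨hu, hd⟩ := h _ ⟨0, 1, rfl⟩
  have htr : (g.val * hypMatrix p 0 1 * g⁻¹.val * (g.val * hypMatrix p 0 1 * g⁻¹.val)).trace
      = 2 := by
    rw [conj_mul_conj, trace_mul_comm, ← Matrix.mul_assoc, ← Units.val_mul, inv_mul_cancel,
      Units.val_one, Matrix.one_mul, hypMatrix_eq_diagonal, diagonal_mul_diagonal, trace_diagonal]
    simp
    norm_num
  obtain ⟨c, hc⟩ : ∃ c, g.val * hypMatrix p 0 1 * g⁻¹.val = diagonal c :=
    ⟨_, hd.diagonal_diag.symm⟩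
  rw [hc] at hu htr
  rw [diagonal_mul_diagonal, trace_diagonal] at htr
  have hcre : ∀ j, (c j).re = 0 := by
    intro j
    have h0 : (diagonal c)ᴴ * formJ p + formJ p * diagonal c = 0 := hu
    rw [formJ_eq_diagonal] at h0
    have := congrArg re (congrFun₂ h0 j j)
    rcases j with j | j
    · simp [diagonal_conjTranspose] at this
      linarith
    · fin_cases j <;> simp [diagonal_conjTranspose] at this <;> simp <;> linarith
  have := congrArg re htr
  rw [re_sum] at this
  have hle : ∑ j, (c j * c j).re ≤ 0 :=
    Finset.sum_nonpos fun j _ => by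
      rw [mul_re, hcre]
      nlinarith [mul_self_nonneg (c j).im]
  rw [this] at hle
  norm_num at hle

theorem eq_of_gLConj_plainAlg {i j : Option (Option (Fin p))}
    (h : GLConj (plainAlg p i) (plainAlg p j)) : i = j := by
  have hf := h.finrank_nilpotentKer_eq
  have e1 : Module.finrank ℂ (nilpotentKer (plainAlg p none)) =
      Module.finrank ℂ (⊤ : Submodule ℂ (Idx p → ℂ)) := by rw [nilpotentKer_plainAlg_none]
  have e2 : Module.finrank ℂ (nilpotentKer (plainAlg p (some none))) =
      Module.finrank ℂ (⊤ : Submodule ℂ (Idx p → ℂ)) := by rw [nilpotentKer_plainAlg_some_none]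
  have e3 : ∀ k, Module.finrank ℂ (nilpotentKer (plainAlg p (some (some k)))) <
      Module.finrank ℂ (⊤ : Submodule ℂ (Idx p → ℂ)) := fun k =>
    finrank_nilpotentKer_parAlg_lt_top _
  rcases i with _ | _ | k <;> rcases j with _ | _ | k'
  · rfl
  · exact absurd h.symm not_gLConj_elliptic_hyperbolic
  · have := e3 k'; omega
  · exact absurd h not_gLConj_elliptic_hyperbolic
  · rfl
  · have := e3 k'; omega
  · have := e3 k; omega
  · have := e3 k; omega
  · have hk := k.2
    have hk' := k'.2
    rcases lt_trichotomy (k : ℕ) (k' : ℕ) with hlt | heq | hlt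
    · exact absurd hf (finrank_nilpotentKer_parAlg_lt hlt (by omega)).ne
    · rw [Fin.ext heq]
    · exact absurd hf (finrank_nilpotentKer_parAlg_lt hlt (by omega)).ne'

theorem gLConj_cayleyConj (A : LieSubalgebra ℝ (Matrix (Idx p) (Idx p) ℂ)) :
    GLConj (cayleyConj p A) A := by
  have hval : ((isUnit_cayley p).unit⁻¹).val = (cayley p)⁻¹ := by
    rw [coe_units_inv, IsUnit.unit_spec]
  refine ⟨(isUnit_cayley p).unit, fun X hX => ?_, fun Y hY => ?_⟩
  · rw [hval]
    exact hX
  · have := conj_conj_inv (isUnit_cayley p).unit Y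
    rw [hval] at this ⊢
    change cayley p * _ * (cayley p)⁻¹ ∈ A
    rw [IsUnit.unit_spec] at this ⊢
    rwa [this]

/-- The index of the model subalgebra of a given type. -/
def MASAType.index (hp : 1 ≤ p) : MASAType p → Option (Option (Fin p))
  | .quasiElliptic => none
  | .quasiHyperbolic => some none
  | .quasiParabolic => some (some ⟨p - 1, by omega⟩)
  | .nilpotent => some (some ⟨0, hp⟩)
  | .quasiNilpotent k _ _ => some (some ⟨k, by omega⟩)

theorem gLConj_modelAlg (hp : 1 ≤ p) (t : MASAType p) :
    GLConj (modelAlg p t) (plainAlg p (t.index hp)) := by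
  cases t with
  | quasiElliptic => exact GLConj.refl _
  | quasiHyperbolic => exact gLConj_cayleyConj _
  | quasiParabolic => exact gLConj_cayleyConj _
  | nilpotent => exact gLConj_cayleyConj _
  | quasiNilpotent k _ _ => exact gLConj_cayleyConj _

theorem MASAType.index_surjective (hp : 1 ≤ p) : Function.Surjective (MASAType.index hp) := by
  rintro (_ | _ | k)
  · exact ⟨.quasiElliptic, rfl⟩
  · exact ⟨.quasiHyperbolic, rfl⟩
  · have hk := k.2
    by_cases h0 : (k : ℕ) = 0
    · exact ⟨.nilpotent, by simp [MASAType.index, Fin.ext_iff, h0]⟩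
    · by_cases h1 : (k : ℕ) = p - 1
      · exact ⟨.quasiParabolic, by simp [MASAType.index, Fin.ext_iff, h1]⟩
      · exact ⟨.quasiNilpotent k (by omega) (by omega), rfl⟩

theorem MASAType.index_injective (hp : 2 ≤ p) :
    Function.Injective (MASAType.index (p := p) (by omega)) := by
  intro t t' h
  cases t <;> cases t' <;> simp [MASAType.index] at h ⊢ <;> omega

variable {q : ℕ}

theorem modelAlg_conj_mem (hp : 1 ≤ p) {h h' : LieSubalgebra ℝ (Matrix (Idx p) (Idx p) ℂ)}
    (hh : IsMASA (uPOne p) h) (hh' : IsMASA (uPOne p) h')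
    {h₂ h₂' : LieSubalgebra ℝ (Matrix (Fin q) (Fin q) ℂ)}
    {γ : GL (Idx p ⊕ Fin q) ℂ} {α α' : Matrix (Idx p) (Idx p) ℂ} {β β' : Matrix (Fin q) (Fin q) ℂ}
    (hγ : γ.val = fromBlocks α 0 0 β) (hγi : γ⁻¹.val = fromBlocks α' 0 0 β') (hα : α * α' = 1)
    (hbox : ∀ X ∈ boxZero h h₂, γ.val * X * γ⁻¹.val ∈ boxZero h' h₂') :
    ∀ A ∈ h, α * A * α' ∈ h' := by
  intro A hA
  obtain ⟨c, hc, hct⟩ := exists_scalar_trace_eq hp hh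
    (re_trace_eq_zero (formJ_mul_formJ p) ((isMASA_iff.1 hh).1 hA))
  have hcre : c.re = 0 := by
    have := re_trace_eq_zero (formJ_mul_formJ p) ((isMASA_iff.1 hh).1 hc)
    rw [trace_smul, trace_one, card_idx hp, smul_eq_mul, ← ofReal_natCast, re_mul_ofReal,
      mul_eq_zero] at this
    exact this.resolve_right (by exact_mod_cast p.succ_ne_zero)
  have := hbox _ (fromBlocks_mem_boxZero.2
    ⟨h.sub_mem hA hc, h₂.zero_mem, by rw [trace_sub, hct, sub_self, trace_zero]⟩)
  rw [hγ, hγi, fromBlocks_multiply, fromBlocks_multiply] at this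
  simp only [Matrix.mul_zero, Matrix.zero_mul, add_zero] at this
  have h1 := h'.add_mem (fromBlocks_mem_boxZero.1 this).1 (smul_one_mem_of_isMASA hh' hcre)
  have h2 : α * (A - c • 1) * α' + c • 1 = α * A * α' := by
    rw [Matrix.mul_sub, Matrix.sub_mul, Matrix.mul_smul, Matrix.mul_one, Matrix.smul_mul, hα,
      sub_add_cancel]
  rwa [h2] at h1

theorem gLConj_of_conjAlg_boxZero (hp : 1 ≤ p)
    {h h' : LieSubalgebra ℝ (Matrix (Idx p) (Idx p) ℂ)}
    (hh : IsMASA (uPOne p) h) (hh' : IsMASA (uPOne p) h')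
    {h₂ h₂' : LieSubalgebra ℝ (Matrix (Fin q) (Fin q) ℂ)}
    (H : ConjAlg p q (boxZero h h₂) (boxZero h' h₂')) : GLConj h h' := by
  obtain ⟨γ, hγ, H⟩ := H
  have hmem : ∀ Y, Y ∈ boxZero h' h₂' ↔ ∃ X ∈ boxZero h h₂, γ.val * X * γ⁻¹.val = Y := fun Y => by
    rw [← SetLike.mem_coe, H]
    rfl
  obtain ⟨α, β, hγv, -, -, -⟩ := mem_suGroup_iff.1 hγ
  obtain ⟨α', β', hγi, -, -, -⟩ := mem_suGroup_iff.1 ((suGroup p q).inv_mem hγ)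
  have hi : γ.val * γ⁻¹.val = 1 := by rw [← Units.val_mul, mul_inv_cancel, Units.val_one]
  rw [hγv, hγi, fromBlocks_multiply, ← fromBlocks_one, fromBlocks_inj] at hi
  simp only [Matrix.mul_zero, add_zero] at hi
  have hα' := mul_eq_one_comm.1 hi.1
  refine ⟨⟨α, α', hi.1, hα'⟩, modelAlg_conj_mem hp hh hh' hγv hγi hi.1 fun X hX =>
    (hmem _).2 ⟨X, hX, rfl⟩, ?_⟩
  refine modelAlg_conj_mem (γ := γ⁻¹) (h₂ := h₂') (h₂' := h₂) hp hh' hh hγi (by rwa [inv_inv])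
    hα' fun Y hY => ?_
  obtain ⟨X, hX, rfl⟩ := (hmem Y).1 hY
  rwa [inv_inv, conj_inv_conj]

theorem index_eq_of_conjAlg (hp : 1 ≤ p) {t t' : MASAType p}
    {h₂ h₂' : LieSubalgebra ℝ (Matrix (Fin q) (Fin q) ℂ)}
    (H : ConjAlg p q (boxZero (modelAlg p t) h₂) (boxZero (modelAlg p t') h₂')) :
    t.index hp = t'.index hp :=
  eq_of_gLConj_plainAlg <| (gLConj_modelAlg hp t).symm.trans <|
    (gLConj_of_conjAlg_boxZero hp (isMASA_modelAlg t) (isMASA_modelAlg t') H).trans <|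
      gLConj_modelAlg hp t'

end GLConj

section Exponential

open scoped Matrix.Norms.Operator

variable {n : Type*} [Fintype n] [DecidableEq n]

theorem hasDerivAt_exp_smul_apply (X : Matrix n n ℂ) (i j : n) :
    HasDerivAt (fun t : ℝ => NormedSpace.exp (t • X) i j) (X i j) 0 := by
  have h := hasDerivAt_exp_smul_const X (0 : ℝ)
  rw [zero_smul, NormedSpace.exp_zero, one_mul] at h
  have h1 := hasDerivAt_pi.1 h i
  exact hasDerivAt_pi.1 h1 j

theorem hasDerivAt_det {M : ℝ → Matrix n n ℂ} {M' : Matrix n n ℂ} {t : ℝ}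
    (h : ∀ i j, HasDerivAt (fun s => M s i j) (M' i j) t) :
    HasDerivAt (fun s => (M s).det) (∑ σ : Equiv.Perm n, Equiv.Perm.sign σ •
      ∑ i, (∏ j ∈ Finset.univ.erase i, M t (σ j) j) • M' (σ i) i) t := by
  simp only [det_apply]
  exact HasDerivAt.fun_sum fun σ _ => (HasDerivAt.fun_finsetProd fun i _ => h (σ i) i).const_smul _

theorem hasDerivAt_det_one_add_smul (X : Matrix n n ℂ) :
    HasDerivAt (fun t : ℝ => (1 + t • X).det) X.trace 0 := by
  have h := ((det (1 + (Polynomial.X : Polynomial ℂ) • X.map Polynomial.C)).hasDerivAt 0)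
  rw [derivative_det_one_add_X_smul] at h
  have h' := HasDerivAt.comp_ofReal (z := (0 : ℝ)) (by rwa [ofReal_zero])
  convert! h' using 2 with t
  rw [← Polynomial.coe_evalRingHom, RingHom.map_det]
  congr 1
  ext i j
  by_cases hij : i = j <;> simp [hij] <;> exact mul_comm _ _

theorem hasDerivAt_det_exp_smul (X : Matrix n n ℂ) :
    HasDerivAt (fun t : ℝ => (NormedSpace.exp (t • X)).det) X.trace 0 := by
  have h1 : ∀ i j, HasDerivAt (fun t : ℝ => (1 + t • X) i j) (X i j) 0 := by
    intro i j
    have h := ((hasDerivAt_id (0 : ℝ)).smul_const (X i j)).const_add ((1 : Matrix n n ℂ) i j)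
    rw [one_smul] at h
    exact h
  have h2 := hasDerivAt_det h1
  have h3 := hasDerivAt_det (hasDerivAt_exp_smul_apply X)
  rw [← h2.unique (hasDerivAt_det_one_add_smul X)]
  simpa only [zero_smul, NormedSpace.exp_zero, add_zero] using h3

/-- Jacobi's formula for the determinant of an exponential. -/
theorem det_exp_smul (X : Matrix n n ℂ) (t : ℝ) :
    (NormedSpace.exp (t • X)).det = Complex.exp (t * X.trace) := by
  have hadd : ∀ s t : ℝ, (NormedSpace.exp ((s + t) • X)).det =
      (NormedSpace.exp (s • X)).det * (NormedSpace.exp (t • X)).det := by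
    intro s t
    rw [add_smul, Matrix.exp_add_of_commute _ _ (((Commute.refl X).smul_left s).smul_right t),
      det_mul]
  have hder : ∀ t : ℝ, HasDerivAt (fun t : ℝ => (NormedSpace.exp (t • X)).det)
      ((NormedSpace.exp (t • X)).det * X.trace) t := by
    intro t
    have h0 : HasDerivAt (fun s : ℝ => (NormedSpace.exp (s • X)).det) X.trace (t - t) := by
      rw [sub_self]
      exact hasDerivAt_det_exp_smul X
    have h := (HasDerivAt.comp_sub_const t t h0).const_mul (NormedSpace.exp (t • X)).det
    simp only [← hadd, add_sub_cancel] at h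
    exact h
  have hE : ∀ t : ℝ, HasDerivAt (fun t : ℝ => Complex.exp (-(t * X.trace)))
      (Complex.exp (-(t * X.trace)) * -X.trace) t := by
    intro t
    have h : HasDerivAt (fun t : ℝ => -((t : ℂ) * X.trace)) (-X.trace) t := by
      have h := ((hasDerivAt_id t).ofReal_comp.mul_const X.trace).neg
      rw [ofReal_one, one_mul] at h
      exact h
    exact h.cexp
  have hconst : ∀ s : ℝ, (NormedSpace.exp (s • X)).det * Complex.exp (-(s * X.trace)) =
      (NormedSpace.exp ((0 : ℝ) • X)).det * Complex.exp (-(((0 : ℝ) : ℂ) * X.trace)) := by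
    intro s
    refine is_const_of_deriv_eq_zero (𝕜 := ℝ)
      (f := fun s : ℝ => (NormedSpace.exp (s • X)).det * Complex.exp (-(s * X.trace)))
      (fun t => ((hder t).fun_mul (hE t)).differentiableAt) (fun t => ?_) s 0
    rw [((hder t).fun_mul (hE t)).deriv]
    ring
  have := hconst t
  simp only [zero_smul, NormedSpace.exp_zero, det_one, ofReal_zero, zero_mul, neg_zero,
    Complex.exp_zero, mul_one] at this
  rw [Complex.exp_neg] at this
  rwa [mul_inv_eq_one₀ (Complex.exp_ne_zero _)] at this

theorem hasDerivAt_mul_exp_mul_apply (L X R : Matrix n n ℂ) (i j : n) :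
    HasDerivAt (fun t : ℝ => (L * NormedSpace.exp (t • X) * R) i j) ((L * X * R) i j) 0 := by
  simp only [Matrix.mul_apply]
  exact HasDerivAt.fun_sum fun k _ => (HasDerivAt.fun_sum fun l _ =>
    (hasDerivAt_exp_smul_apply X l k).const_mul (L i l)).mul_const (R k j)

theorem mul_mul_eq_of_exp {L X R L' X' R' : Matrix n n ℂ}
    (h : ∀ t : ℝ, L * NormedSpace.exp (t • X) * R = L' * NormedSpace.exp (t • X') * R') :
    L * X * R = L' * X' * R' := by
  ext i j
  refine (hasDerivAt_mul_exp_mul_apply L X R i j).unique ?_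
  simp only [h]
  exact hasDerivAt_mul_exp_mul_apply L' X' R' i j

theorem exp_fromBlocks_diag {m : Type*} [Fintype m] [DecidableEq m] (A : Matrix m m ℂ)
    (B : Matrix n n ℂ) :
    NormedSpace.exp (fromBlocks A 0 0 B) =
      fromBlocks (NormedSpace.exp A) 0 0 (NormedSpace.exp B) := by
  let f : Matrix m m ℂ × Matrix n n ℂ →+* Matrix (m ⊕ n) (m ⊕ n) ℂ :=
    { toFun := fun X => fromBlocks X.1 0 0 X.2
      map_one' := fromBlocks_one
      map_zero' := fromBlocks_zero
      map_add' := fun X Y => by simp [fromBlocks_add]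
      map_mul' := fun X Y => by simp [fromBlocks_multiply] }
  have hf : Continuous f := by
    change Continuous fun X : Matrix m m ℂ × Matrix n n ℂ => fromBlocks X.1 0 0 X.2
    fun_prop
  have h := NormedSpace.map_exp f hf (A, B)
  rw [show f (A, B) = fromBlocks A 0 0 B from rfl] at h
  exact h.symm.trans (congrArg₂ (fun X Y => fromBlocks X 0 0 Y) (Prod.fst_exp (A, B))
    (Prod.snd_exp (A, B)))

theorem conjTranspose_exp_mul_mul_exp {S X : Matrix n n ℂ} (hS : IsUnit S) (hX : X ∈ uForm S) :
    (NormedSpace.exp X)ᴴ * S * NormedSpace.exp X = S := by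
  have h : Xᴴ * S + S * X = 0 := hX
  have hdet := (isUnit_iff_isUnit_det _).1 hS
  have h1 : Xᴴ = S * (-X) * S⁻¹ := by
    rw [Matrix.mul_neg, ← eq_neg_of_add_eq_zero_left h, mul_nonsing_inv_cancel_right _ _ hdet]
  rw [← exp_conjTranspose, h1, Matrix.exp_conj S (-X) hS, nonsing_inv_mul_cancel_right _ _ hdet,
    Matrix.mul_assoc, ← Matrix.exp_add_of_commute _ _ ((Commute.refl X).neg_left), neg_add_cancel,
    NormedSpace.exp_zero, Matrix.mul_one]

theorem mem_uForm_of_exp {S X : Matrix n n ℂ}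
    (h : ∀ t : ℝ, (NormedSpace.exp (t • X))ᴴ * S * NormedSpace.exp (t • X) = S) :
    X ∈ uForm S := by
  change Xᴴ * S + S * X = 0
  have key : ∀ t : ℝ, 1 * NormedSpace.exp (t • Xᴴ) * S = S * NormedSpace.exp (t • (-X)) * 1 := by
    intro t
    have h1 : NormedSpace.exp (t • X) * NormedSpace.exp (t • (-X)) = 1 := by
      rw [smul_neg, ← Matrix.exp_add_of_commute _ _ ((Commute.refl (t • X)).neg_right),
        add_neg_cancel, NormedSpace.exp_zero]
    calc 1 * NormedSpace.exp (t • Xᴴ) * S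
        = (NormedSpace.exp (t • X))ᴴ * S * (NormedSpace.exp (t • X) * NormedSpace.exp (t • (-X))) := by
          rw [h1, Matrix.one_mul, Matrix.mul_one, ← exp_conjTranspose, conjTranspose_smul,
            star_trivial]
      _ = _ := by rw [← Matrix.mul_assoc, h, Matrix.mul_one]
  have := mul_mul_eq_of_exp key
  rw [Matrix.one_mul, Matrix.mul_one, Matrix.mul_neg] at this
  rw [this, neg_add_cancel]

end Exponential

section MASG

variable {p q : ℕ}

theorem det_exp {n : Type*} [Fintype n] [DecidableEq n] (X : Matrix n n ℂ) :
    (NormedSpace.exp X).det = Complex.exp X.trace := by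
  simpa using det_exp_smul X 1

/-- The exponential of a matrix, as an invertible matrix. -/
def expUnit {n : Type*} [Fintype n] [DecidableEq n] (X : Matrix n n ℂ) : GL n ℂ :=
  (Matrix.isUnit_exp X).unit

@[simp] theorem expUnit_val {n : Type*} [Fintype n] [DecidableEq n] (X : Matrix n n ℂ) :
    (expUnit X).val = NormedSpace.exp X := rfl

theorem expUnit_mem_suGroup {X : Matrix (Idx p ⊕ Fin q) (Idx p ⊕ Fin q) ℂ}
    (hX : X ∈ suEven p q) : expUnit X ∈ suGroup p q := by
  rw [suEven_eq_boxZero] at hX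
  obtain ⟨A, hA, B, hB, ht, rfl⟩ := hX
  refine mem_suGroup_iff.2 ⟨_, _, exp_fromBlocks_diag A B,
    conjTranspose_exp_mul_mul_exp (isUnit_formJ p) hA, ?_, by rw [det_exp, det_exp, ht]⟩
  simpa using conjTranspose_exp_mul_mul_exp isUnit_one hB

theorem mem_suEven_of_exp {X : Matrix (Idx p ⊕ Fin q) (Idx p ⊕ Fin q) ℂ}
    (h : ∀ t : ℝ, expUnit (t • X) ∈ suGroup p q) : X ∈ suEven p q := by
  have h12 : X.toBlocks₁₂ = 0 := by
    ext i j
    refine (hasDerivAt_exp_smul_apply X (Sum.inl i) (Sum.inr j)).unique ?_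
    have : ∀ t : ℝ, NormedSpace.exp (t • X) (Sum.inl i) (Sum.inr j) = 0 := fun t =>
      congrFun₂ (h t).1 i j
    simp only [this]
    exact hasDerivAt_const _ _
  have h21 : X.toBlocks₂₁ = 0 := by
    ext i j
    refine (hasDerivAt_exp_smul_apply X (Sum.inr i) (Sum.inl j)).unique ?_
    have : ∀ t : ℝ, NormedSpace.exp (t • X) (Sum.inr i) (Sum.inl j) = 0 := fun t =>
      congrFun₂ (h t).2.1 i j
    simp only [this]
    exact hasDerivAt_const _ _
  obtain ⟨A, B, rfl⟩ : ∃ A B, X = fromBlocks A 0 0 B :=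
    ⟨_, _, by conv_lhs => rw [← fromBlocks_toBlocks X, h12, h21]⟩
  have key : ∀ t : ℝ, (NormedSpace.exp (t • A))ᴴ * formJ p * NormedSpace.exp (t • A) = formJ p ∧
      (NormedSpace.exp (t • B))ᴴ * NormedSpace.exp (t • B) = 1 ∧
      (NormedSpace.exp (t • A)).det = (NormedSpace.exp (t • B)).det := by
    intro t
    obtain ⟨α, β, hγ, h⟩ := mem_suGroup_iff.1 (h t)
    rw [expUnit_val, fromBlocks_smul, smul_zero, smul_zero, exp_fromBlocks_diag,
      fromBlocks_inj] at hγ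
    rwa [hγ.1, hγ.2.2.2]
  rw [suEven_eq_boxZero]
  refine fromBlocks_mem_boxZero.2 ⟨mem_uForm_of_exp fun t => (key t).1,
    mem_uForm_of_exp fun t => ?_, (hasDerivAt_det_exp_smul A).unique ?_⟩
  · rw [Matrix.mul_one]
    exact (key t).2.1
  · simp only [fun t => (key t).2.2]
    exact hasDerivAt_det_exp_smul B

/-- The connected subgroup generated by the exponentials of the elements of `H`. -/
def expGroup {n : Type*} [Fintype n] [DecidableEq n] (H : Set (Matrix n n ℂ)) :
    Subgroup (GL n ℂ) :=
  Subgroup.closure {g | ∃ X ∈ H, g.val = NormedSpace.exp X}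

theorem exists_eq_exp_of_mem_expGroup {n : Type*} [Fintype n] [DecidableEq n]
    {H : LieSubalgebra ℝ (Matrix n n ℂ)} (hH : ∀ X ∈ H, ∀ Y ∈ H, X * Y = Y * X) {g : GL n ℂ}
    (hg : g ∈ expGroup (H : Set (Matrix n n ℂ))) : ∃ X ∈ H, g.val = NormedSpace.exp X := by
  induction hg using Subgroup.closure_induction with
  | mem g hg => exact hg
  | one => exact ⟨0, H.zero_mem, by rw [NormedSpace.exp_zero, Units.val_one]⟩
  | mul g g' _ _ h h' =>
    obtain ⟨X, hX, hg⟩ := h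
    obtain ⟨Y, hY, hg'⟩ := h'
    exact ⟨X + Y, H.add_mem hX hY, by
      rw [Matrix.exp_add_of_commute _ _ (hH X hX Y hY), Units.val_mul, hg, hg']⟩
  | inv g _ h =>
    obtain ⟨X, hX, hg⟩ := h
    exact ⟨-X, H.neg_mem hX, by rw [Matrix.exp_neg, coe_units_inv, hg]⟩

theorem expGroup_le_suGroup {H : LieSubalgebra ℝ (Matrix (Idx p ⊕ Fin q) (Idx p ⊕ Fin q) ℂ)}
    (hH : H ≤ suEven p q) :
    expGroup (H : Set (Matrix (Idx p ⊕ Fin q) (Idx p ⊕ Fin q) ℂ)) ≤ suGroup p q := by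
  refine (Subgroup.closure_le _).2 ?_
  rintro g ⟨X, hX, hg⟩
  rw [show g = expUnit X from Units.ext hg]
  exact expUnit_mem_suGroup (hH hX)

theorem lieSet_expGroup {H : LieSubalgebra ℝ (Matrix (Idx p ⊕ Fin q) (Idx p ⊕ Fin q) ℂ)}
    (hH : IsEvenMASA p q H) :
    lieSet (expGroup (H : Set (Matrix (Idx p ⊕ Fin q) (Idx p ⊕ Fin q) ℂ))) = H := by
  obtain ⟨hle, hab, hmax⟩ := isMASA_iff.1 hH
  ext X
  constructor
  · intro hX
    refine hmax X (mem_suEven_of_exp fun t => ?_) fun Y hY => ?_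
    · obtain ⟨g, hg, hgX⟩ := hX t
      rw [show expUnit (t • X) = g from Units.ext hgX.symm]
      exact expGroup_le_suGroup hle hg
    · have := mul_mul_eq_of_exp (L := 1) (X := X) (R := Y) (L' := Y) (X' := X) (R' := 1) fun t => by
        obtain ⟨g, hg, hgX⟩ := hX t
        obtain ⟨Z, hZ, hgZ⟩ := exists_eq_exp_of_mem_expGroup hab hg
        rw [← hgX, hgZ, Matrix.one_mul, Matrix.mul_one]
        exact (show Commute Z Y from hab Z hZ Y hY).exp_left.eq
      rwa [Matrix.one_mul, Matrix.mul_one] at this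
  · intro hX t
    exact ⟨expUnit (t • X), Subgroup.subset_closure ⟨t • X, H.smul_mem t hX, rfl⟩, rfl⟩

theorem isEvenMASG_expGroup {H : LieSubalgebra ℝ (Matrix (Idx p ⊕ Fin q) (Idx p ⊕ Fin q) ℂ)}
    (hH : IsEvenMASA p q H) :
    IsEvenMASG p q (expGroup (H : Set (Matrix (Idx p ⊕ Fin q) (Idx p ⊕ Fin q) ℂ))) :=
  ⟨expGroup_le_suGroup (isMASA_iff.1 hH).1, by rw [lieSet_expGroup hH]; rfl,
    H, hH, lieSet_expGroup hH⟩

theorem exp_conj_unit {n : Type*} [Fintype n] [DecidableEq n] (γ : GL n ℂ) (X : Matrix n n ℂ) :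
    NormedSpace.exp (γ.val * X * γ⁻¹.val) = γ.val * NormedSpace.exp X * γ⁻¹.val := by
  have := Matrix.exp_conj γ.val X γ.isUnit
  rwa [← coe_units_inv] at this

theorem lieSet_map_conj {n : Type*} [Fintype n] [DecidableEq n] (γ : GL n ℂ)
    (G : Subgroup (GL n ℂ)) :
    lieSet (G.map (MulAut.conj γ).toMonoidHom) = (fun X => γ.val * X * γ⁻¹.val) '' lieSet G := by
  ext Y
  constructor
  · refine fun hY => ⟨γ⁻¹.val * Y * γ.val, fun t => ?_, conj_conj_inv γ Y⟩
    obtain ⟨_, ⟨g, hg, rfl⟩, hgY⟩ := hY t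
    refine ⟨g, hg, ?_⟩
    have h := exp_conj_unit γ⁻¹ (t • Y)
    rw [inv_inv, ← hgY] at h
    rw [← Matrix.smul_mul, ← Matrix.mul_smul, h]
    exact (conj_inv_conj γ g.val).symm
  · rintro ⟨X, hX, rfl⟩ t
    obtain ⟨g, hg, hgX⟩ := hX t
    refine ⟨_, ⟨g, hg, rfl⟩, ?_⟩
    rw [← Matrix.smul_mul, ← Matrix.mul_smul, exp_conj_unit, ← hgX]
    rfl

theorem expGroup_map_conj {n : Type*} [Fintype n] [DecidableEq n] (γ : GL n ℂ)
    (H : Set (Matrix n n ℂ)) :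
    (expGroup H).map (MulAut.conj γ).toMonoidHom =
      expGroup ((fun X => γ.val * X * γ⁻¹.val) '' H) := by
  rw [expGroup, MonoidHom.map_closure, expGroup]
  congr 1
  ext g
  constructor
  · rintro ⟨g, ⟨X, hX, hg⟩, rfl⟩
    refine ⟨_, ⟨X, hX, rfl⟩, ?_⟩
    rw [exp_conj_unit, ← hg]
    rfl
  · rintro ⟨_, ⟨X, hX, rfl⟩, hg⟩
    refine ⟨expUnit X, ⟨X, hX, rfl⟩, Units.ext ?_⟩
    rw [hg, exp_conj_unit]
    rfl

theorem conjGrp_expGroup_iff {H H' : LieSubalgebra ℝ (Matrix (Idx p ⊕ Fin q) (Idx p ⊕ Fin q) ℂ)}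
    (hH : IsEvenMASA p q H) (hH' : IsEvenMASA p q H') :
    ConjGrp p q (expGroup (H : Set (Matrix (Idx p ⊕ Fin q) (Idx p ⊕ Fin q) ℂ)))
      (expGroup (H' : Set (Matrix (Idx p ⊕ Fin q) (Idx p ⊕ Fin q) ℂ))) ↔ ConjAlg p q H H' := by
  constructor
  · rintro ⟨γ, hγ, h⟩
    refine ⟨γ, hγ, ?_⟩
    rw [← lieSet_expGroup hH', h, lieSet_map_conj, lieSet_expGroup hH]
  · rintro ⟨γ, hγ, h⟩
    exact ⟨γ, hγ, by rw [h, expGroup_map_conj]⟩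

theorem ConjGrp.refl (G : Subgroup (GL (Idx p ⊕ Fin q) ℂ)) : ConjGrp p q G G :=
  ⟨1, (suGroup p q).one_mem, by rw [map_one]; exact (Subgroup.map_id G).symm⟩

theorem ConjGrp.trans {G G' G'' : Subgroup (GL (Idx p ⊕ Fin q) ℂ)} (h : ConjGrp p q G G')
    (h' : ConjGrp p q G' G'') : ConjGrp p q G G'' := by
  obtain ⟨γ, hγ, rfl⟩ := h
  obtain ⟨γ', hγ', rfl⟩ := h'
  refine ⟨γ' * γ, (suGroup p q).mul_mem hγ' hγ, ?_⟩
  rw [Subgroup.map_map, map_mul]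
  rfl

theorem ConjGrp.symm {G G' : Subgroup (GL (Idx p ⊕ Fin q) ℂ)} (h : ConjGrp p q G G') :
    ConjGrp p q G' G := by
  obtain ⟨γ, hγ, rfl⟩ := h
  refine ⟨γ⁻¹, (suGroup p q).inv_mem hγ, ?_⟩
  rw [Subgroup.map_map]
  have : (MulAut.conj γ⁻¹).toMonoidHom.comp (MulAut.conj γ).toMonoidHom =
      MonoidHom.id (GL (Idx p ⊕ Fin q) ℂ) := by
    ext1 g
    simp [mul_assoc]
  rw [this, Subgroup.map_id]

end MASG

section Counting

theorem ncard_classes {α ι : Type*} [Fintype ι] {P : α → Prop} {R : α → α → Prop}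
    (refl : ∀ a, R a a) (symm : ∀ {a b}, R a b → R b a) (trans : ∀ {a b c}, R a b → R b c → R a c)
    {r : ι → α} (hr : ∀ i, P (r i)) (hex : ∀ a, P a → ∃ i, R a (r i))
    (hinj : ∀ i j, R (r i) (r j) → i = j) :
    {C | ∃ a, P a ∧ C = {b | R a b}}.ncard = Fintype.card ι := by
  have : {C | ∃ a, P a ∧ C = {b | R a b}} = Set.range fun i => {b | R (r i) b} := by
    ext C
    constructor
    · rintro ⟨a, ha, rfl⟩
      obtain ⟨i, hi⟩ := hex a ha
      exact ⟨i, Set.ext fun b => ⟨trans hi, trans (symm hi)⟩⟩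
    · rintro ⟨i, rfl⟩
      exact ⟨r i, hr i, rfl⟩
  rw [this, ← Nat.card_eq_fintype_card]
  refine Set.ncard_range_of_injective fun i j hij => hinj i j ?_
  have hij' : {b | R (r i) b} = {b | R (r j) b} := hij
  exact hij'.symm.subset (refl (r j))

variable {p q : ℕ}

/-- A subalgebra `h₁ ⊠₀ D(q)` for each conjugacy class of even MASAs. -/
def representative (hp : 1 ≤ p) (q : ℕ) (i : Option (Option (Fin p))) :
    LieSubalgebra ℝ (Matrix (Idx p ⊕ Fin q) (Idx p ⊕ Fin q) ℂ) :=
  boxZero (modelAlg p (Function.surjInv (MASAType.index_surjective hp) i)) (diagIn (uQ q))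

theorem isEvenMASA_representative (hp : 1 ≤ p) (q : ℕ) (i : Option (Option (Fin p))) :
    IsEvenMASA p q (representative hp q i) :=
  isEvenMASA_boxZero hp (isMASA_modelAlg _) (isMASA_diagIn_uQ q)

theorem eq_of_conjAlg_representative (hp : 1 ≤ p) {i j : Option (Option (Fin p))}
    (h : ConjAlg p q (representative hp q i) (representative hp q j)) : i = j := by
  have := index_eq_of_conjAlg hp h
  rwa [Function.surjInv_eq (MASAType.index_surjective hp),
    Function.surjInv_eq (MASAType.index_surjective hp)] at this

theorem modelAlg_eq_of_index_eq (hp : 1 ≤ p) {t t' : MASAType p} (h : t.index hp = t'.index hp) :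
    modelAlg p t = modelAlg p t' := by
  have key : ∀ t : MASAType p, modelAlg p t = match t.index hp with
      | none => diagIn (uPOne p)
      | some none => cayleyConj p (hypAlg p)
      | some (some k) => cayleyConj p (parAlg p k) := by
    rintro (_ | _) <;> rfl
  rw [key t, key t', h]

theorem exists_conjAlg_representative (hp : 1 ≤ p)
    {H : LieSubalgebra ℝ (Matrix (Idx p ⊕ Fin q) (Idx p ⊕ Fin q) ℂ)} (hH : IsEvenMASA p q H) :
    ∃ i, ConjAlg p q H (representative hp q i) := by
  obtain ⟨t, ht⟩ := isEvenMASA_conjAlg_box hp hH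
  refine ⟨t.index hp, ?_⟩
  rwa [representative, modelAlg_eq_of_index_eq hp
    (Function.surjInv_eq (MASAType.index_surjective hp) (t.index hp))]

end Counting

end
theorem mainTheorem6 (p q : ℕ) (hp : 1 ≤ p) :
    -- the algebras `h₁ ⊠₀ h₂` and the models are what they are claimed to be
    (∀ h₁ h₂, IsMASA (uPOne p) h₁ → IsMASA (uQ q) h₂ → IsEvenMASA p q (boxZero h₁ h₂)) ∧
    IsMASA (uQ q) (diagIn (uQ q)) ∧
    (∀ t : MASAType p, IsMASA (uPOne p) (modelAlg p t)) ∧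
    -- every even MASA is conjugate to a model
    (∀ H, IsEvenMASA p q H →
      ∃ t : MASAType p, ConjAlg p q H (boxZero (modelAlg p t) (diagIn (uQ q)))) ∧
    -- different models are not conjugate
    (2 ≤ p → ∀ t t' : MASAType p,
      ConjAlg p q (boxZero (modelAlg p t) (diagIn (uQ q)))
        (boxZero (modelAlg p t') (diagIn (uQ q))) → t = t') ∧
    -- number of conjugacy classes of even MASAs and of even MASGs
    {C | ∃ H, IsEvenMASA p q H ∧ C = {H' | ConjAlg p q H H'}}.ncard = p + 2 ∧
    {C | ∃ G, IsEvenMASG p q G ∧ C = {G' | ConjGrp p q G G'}}.ncard = p + 2 := by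
  have hcard : Fintype.card (Option (Option (Fin p))) = p + 2 := by simp
  refine ⟨fun h₁ h₂ H₁ H₂ => isEvenMASA_boxZero hp H₁ H₂, isMASA_diagIn_uQ q, isMASA_modelAlg,
    fun H hH => isEvenMASA_conjAlg_box hp hH,
    fun h2 t t' h => MASAType.index_injective h2 (index_eq_of_conjAlg hp h), ?_, ?_⟩
  · rw [← hcard]
    exact ncard_classes ConjAlg.refl ConjAlg.symm ConjAlg.trans (isEvenMASA_representative hp q)
      (fun H hH => exists_conjAlg_representative hp hH)
      fun i j h => eq_of_conjAlg_representative hp h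
  · rw [← hcard]
    refine ncard_classes (r := fun i => expGroup (representative hp q i)) ConjGrp.refl
      ConjGrp.symm ConjGrp.trans
      (fun i => isEvenMASG_expGroup (isEvenMASA_representative hp q i)) ?_ fun i j h => ?_
    · rintro G ⟨-, hG, H, hH, hHG⟩
      rw [hHG] at hG
      obtain ⟨i, hi⟩ := exists_conjAlg_representative hp hH
      refine ⟨i, ?_⟩
      rw [hG]
      exact (conjGrp_expGroup_iff hH (isEvenMASA_representative hp q i)).2 hi
    · exact eq_of_conjAlg_representative hp <|
        (conjGrp_expGroup_iff (isEvenMASA_representative hp q i)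
          (isEvenMASA_representative hp q j)).1 h
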